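/- Let $X$ be a compact Hausdorff space, $U\subseteq X$ an open subset and $\sigma:U\to X$ a local homeomorphism. For $a\in C(X)$ put $\alpha(a)=a\circ\sigma$ (a bounded continuous function on $U$), let $C_c(U)=\{f\in C(X):\operatorname{supp} f\subseteq U\}$, and for $f\in C_c(U)$ let $L(f)\in C(X)$ be $L(f)(x)=\sum_{y\in U,\ \sigma(y)=x}f(y)$ (a finite sum). Let $M$ be the right Hilbert $C(X)$-module obtained by (Hausdorff) completion of $C_c(U)$ with respect to $\langle f,g\rangle=L(f^*g)$ and $f\cdot a=f\,\alpha(a)$, with the left action $\varphi(a)f=af$ of $C(X)$. Let $\mathcal T(X,\alpha,L)$ be the universal $C^*$-algebra generated by $C(X)\cup M$ with the relations of the algebra $C(X)$, of the vector space $M$, of the $C(X)$-bimodule products, and $m^*n=\langle m,n\rangle$ for $m,n\in M$. A redundancy is a pair $(a,k)$ where $a\in C(X)$, $k$ lies in the closed subalgebra of $\mathcal T(X,\alpha,L)$ generated by $\{mn^*:m,n\in M\}$, and $am=km$ for all $m\in M$. Let $I_0=\ker(\varphi)^\perp\cap\varphi^{-1}(K(M))$, where $K(M)$ is the closed span of the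 operators $\xi\mapsto m\langle n,\xi\rangle$ on $M$, and let $\mathcal O(X,\alpha,L)$ be the quotient of $\mathcal T(X,\alpha,L)$ by the closed two-sided ideal generated by the elements $a-k$ for all redundancies $(a,k)$ with $a\in I_0$. The gauge action of the circle $S^1$ on $\mathcal O(X,\alpha,L)$ is induced by $\theta_\lambda(a)=a$ for $a\in C(X)$ and $\theta_\lambda(m)=\lambda m$ for $m\in M$. Ideals are closed and two-sided; an ideal $I$ is gauge-invariant if $\theta_\lambda(I)\subseteq I$ for all $\lambda\in S^1$. For $V\subseteq X$ open, $C_0(V)=\{f\in C(X): f=0\text{ on }X\setminus V\}$, and $V$ is $\sigma,\sigma^{-1}$-invariant if $\sigma(V\cap U)\subseteq V$ and $\sigma^{-1}(V)\subseteq V$. **Theorem 3.9.** The canonical map $C(X)\to\mathcal O(X,\alpha,L)$ is injective, and $C(X)$ is regarded as a subalgebra of $\mathcal O(X,\alpha,L)$. For every gauge-invariant ideal $I$ of $\mathcal O(X,\alpha,L)$ there is exactly one open set $V\subseteq X$ with $I\cap C(X)=C_0(V)$; this $V$ is $\sigma,\sigma^{-1}$-invariant, and $I$ is the ideal $\langle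 C_0(V)\rangle$ generated by $C_0(V)$. The map $\Phi:I\mapsto V$ is a bijection from the set of gauge-invariant ideals of $\mathcal O(X,\alpha,L)$ onto the set of open $\sigma,\sigma^{-1}$-invariant subsets of $X$. -/

import Mathlib

universe u

noncomputable section

namespace PartialCrossedProduct

open TopologicalSpace Set
open scoped RightActions

/-- A local homeomorphism `σ : U → X` defined on an open subset `U` of the space `X`. -/
structure PartialLocalHomeo (X : Type u) [TopologicalSpace X] where
  U : Opens X
  σ : U → X
  isLocalHomeomorph : IsLocalHomeomorph σ

set_option linter.unusedSectionVars false

variable {X : Type u} [TopologicalSpace X] [CompactSpace X] [T2Space X]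

/-- `C_c(U)`: the ideal of those `f ∈ C(X)` whose (closed) support is contained in `U`. -/
def Cc (S : PartialLocalHomeo X) : Ideal C(X, ℂ) where
  carrier := {f | tsupport f ⊆ S.U}
  zero_mem' := by simp [tsupport]
  add_mem' {f g} hf hg := (tsupport_add f g).trans (union_subset hf hg)
  smul_mem' c f hf := (tsupport_mul_subset_right (f := c) (g := f)).trans hf

lemma isCompact_preimage (S : PartialLocalHomeo X) {K : Set X} (hK : IsClosed K)
    (hKU : K ⊆ S.U) : IsCompact ((↑) ⁻¹' K : Set S.U) := by
  have h : ((↑) : S.U → X) '' ((↑) ⁻¹' K) = K := by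
    rw [image_preimage_eq_inter_range, Subtype.range_coe]
    exact inter_eq_left.mpr hKU
  rw [Subtype.isCompact_iff, h]
  exact hK.isCompact

lemma finite_fiber (S : PartialLocalHomeo X) {K : Set X} (hK : IsClosed K)
    (hKU : K ⊆ S.U) (x : X) : {y : S.U | S.σ y = x ∧ (y : X) ∈ K}.Finite := by
  have hc : IsCompact ((↑) ⁻¹' K : Set S.U) := isCompact_preimage S hK hKU
  have hcl : IsClosed (S.σ ⁻¹' {x}) := isClosed_singleton.preimage S.isLocalHomeomorph.continuous
  have h2 : IsCompact (((↑) ⁻¹' K : Set S.U) ∩ S.σ ⁻¹' {x}) := hc.inter_right hcl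
  have h3 : {y : S.U | S.σ y = x ∧ (y : X) ∈ K} = ((↑) ⁻¹' K : Set S.U) ∩ S.σ ⁻¹' {x} := by
    ext y; simp [and_comm]
  rw [h3]
  refine h2.finite ?_
  refine (S.isLocalHomeomorph.isLocalHomeomorphOn.mono (subset_univ _)).isDiscrete_of_image ?_
  refine Set.Subsingleton.isDiscrete ?_
  rintro _ ⟨a, ha, rfl⟩ _ ⟨b, hb, rfl⟩
  exact ha.2.trans hb.2.symm

lemma finite_support (S : PartialLocalHomeo X) {f : C(X, ℂ)} (hf : f ∈ Cc S) (x : X) :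
    ((S.σ ⁻¹' {x}) ∩ Function.support fun y : S.U => f y).Finite :=
  (finite_fiber S (isClosed_tsupport f) hf x).subset fun _ hy => ⟨hy.1, subset_tsupport _ hy.2⟩

/-- The sum `∑_{σ(y) = x} f(y)` over the fibre of `σ` at `x` (finite for `f ∈ C_c(U)`). -/
def fiberSum (S : PartialLocalHomeo X) (f : C(X, ℂ)) (x : X) : ℂ :=
  ∑ᶠ y ∈ S.σ ⁻¹' {x}, f (y : X)

lemma fiberSum_add (S : PartialLocalHomeo X) {f g : C(X, ℂ)} (hf : f ∈ Cc S) (hg : g ∈ Cc S)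
    (x : X) : fiberSum S (f + g) x = fiberSum S f x + fiberSum S g x :=
  finsum_mem_add_distrib' (finite_support S hf x) (finite_support S hg x)

lemma fiberSum_eq_sum (S : PartialLocalHomeo X) {f : C(X, ℂ)} {x : X}
    (s : Finset S.U) (hs : ∀ y ∈ s, S.σ y = x) (hs' : ∀ y : S.U, S.σ y = x → f y ≠ 0 → y ∈ s) :
    fiberSum S f x = ∑ y ∈ s, f y := by
  refine finsum_mem_eq_sum_of_inter_support_eq _ ?_
  ext y
  simp only [mem_inter_iff, mem_preimage, mem_singleton_iff, Function.mem_support,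
    Finset.mem_coe]
  exact ⟨fun h => ⟨hs' y h.1 h.2, h.2⟩, fun h => ⟨hs y h.1, h.2⟩⟩

lemma fiberSum_eq_sum_fiber (S : PartialLocalHomeo X) {f : C(X, ℂ)} {K : Set X}
    (hK : IsClosed K) (hKU : K ⊆ S.U) (hf : ∀ y, f y ≠ 0 → y ∈ K) (x : X) :
    fiberSum S f x = ∑ y ∈ (finite_fiber S hK hKU x).toFinset, f y :=
  fiberSum_eq_sum S _ (fun y hy => by simpa using ((Set.Finite.mem_toFinset _).mp hy).1)
    fun y hy hfy => (Set.Finite.mem_toFinset _).mpr ⟨hy, hf _ hfy⟩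

lemma fiberSum_smul (S : PartialLocalHomeo X) (c : ℂ) {f : C(X, ℂ)} (hf : f ∈ Cc S)
    (x : X) : fiberSum S (c • f) x = c * fiberSum S f x := by
  have h : ∀ y, f y ≠ 0 → y ∈ tsupport f := fun y hy => subset_tsupport f hy
  rw [fiberSum_eq_sum_fiber S (isClosed_tsupport f) hf h,
    fiberSum_eq_sum_fiber S (isClosed_tsupport f) hf, Finset.mul_sum]
  · rfl
  · intro y hy
    refine h y fun h0 => hy ?_
    simp [h0]

lemma fiberSum_sum (S : PartialLocalHomeo X) {ι : Type*} (t : Finset ι) (f : ι → C(X, ℂ))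
    (hf : ∀ i ∈ t, f i ∈ Cc S) (x : X) :
    fiberSum S (∑ i ∈ t, f i) x = ∑ i ∈ t, fiberSum S (f i) x := by
  classical
  induction t using Finset.induction_on with
  | empty => simp [fiberSum]
  | insert a t ha ih =>
    rw [Finset.sum_insert ha, Finset.sum_insert ha, fiberSum_add S (hf a (by simp))
      ((Cc S).sum_mem fun i hi => hf i (by simp [hi])), ih fun i hi => hf i (by simp [hi])]

lemma continuous_fiberSum_of_subset (S : PartialLocalHomeo X) {f : C(X, ℂ)}
    (e : OpenPartialHomeomorph S.U X) (he : S.σ = e)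
    (hf : tsupport f ⊆ (↑) '' e.source) : Continuous (fiberSum S f) := by
  have hfU : f ∈ Cc S := fun x hx => by
    obtain ⟨y, -, rfl⟩ := hf hx
    exact y.2
  rw [continuous_iff_continuousAt]
  intro x
  by_cases hx : x ∈ e.target
  · have h1 : ∀ z ∈ e.target, fiberSum S f z = f (e.symm z) := by
      intro z hz
      have := fiberSum_eq_sum S (f := f) (x := z) {e.symm z}
        (by simp [he, e.right_inv hz]) (by
          intro y hy hfy
          obtain ⟨y', hy', hyy⟩ := hf (subset_tsupport f hfy)
          obtain rfl : y' = y := Subtype.ext hyy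
          rw [Finset.mem_singleton, ← hy, he, e.left_inv hy'])
      simpa using this
    have h2 : ContinuousAt (fun z => f (e.symm z)) x :=
      f.continuous.continuousAt.comp (continuous_subtype_val.continuousAt.comp
        (e.symm.continuousAt hx))
    exact h2.congr (Filter.eventuallyEq_of_mem (e.open_target.mem_nhds hx)
      fun z hz => (h1 z hz).symm)
  · have hc : IsCompact ((↑) ⁻¹' tsupport f : Set S.U) :=
      isCompact_preimage S (isClosed_tsupport f) hfU
    have hcl : IsClosed (S.σ '' ((↑) ⁻¹' tsupport f)) :=
      (hc.image S.isLocalHomeomorph.continuous).isClosed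
    have hx' : x ∉ S.σ '' ((↑) ⁻¹' tsupport f) := by
      rintro ⟨y, hy, rfl⟩
      obtain ⟨y', hy', hyy⟩ := hf hy
      obtain rfl : y' = y := Subtype.ext hyy
      exact hx (he ▸ e.map_source hy')
    have h1 : ∀ z ∈ (S.σ '' ((↑) ⁻¹' tsupport f))ᶜ, (0 : ℂ) = fiberSum S f z := by
      intro z hz
      rw [fiberSum_eq_sum S (f := f) (x := z) ∅ (by simp), Finset.sum_empty]
      intro y hy hfy
      exact (hz ⟨y, subset_tsupport f hfy, hy⟩).elim
    exact continuousAt_const.congr (Filter.eventuallyEq_of_mem (hcl.isOpen_compl.mem_nhds hx') h1)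

lemma continuous_fiberSum (S : PartialLocalHomeo X) {f : C(X, ℂ)} (hf : f ∈ Cc S) :
    Continuous (fiberSum S f) := by
  classical
  choose e hemem he using S.isLocalHomeomorph
  have hopen : ∀ y : S.U, IsOpen ((↑) '' (e y).source : Set X) := fun y =>
    S.U.isOpen.isOpenMap_subtype_val _ (e y).open_source
  obtain ⟨t, ht⟩ := (isClosed_tsupport f).isCompact.elim_finite_subcover _ hopen
    (fun x hx => mem_iUnion.mpr ⟨⟨x, hf hx⟩, ⟨⟨x, hf hx⟩, hemem _, rfl⟩⟩)
  obtain ⟨ρ, hρ, -⟩ := PartitionOfUnity.exists_isSubordinate_of_locallyFinite_t2space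
    (isClosed_tsupport f).isCompact (fun y : t => ((↑) '' (e y).source : Set X))
    (fun y => hopen y) (locallyFinite_of_finite _) (by simpa [iUnion_subtype] using ht)
  let g : t → C(X, ℂ) := fun i => ⟨fun x => (ρ i x : ℂ) * f x, by fun_prop⟩
  have hg : ∀ i, tsupport (g i) ⊆ (↑) '' (e i).source := fun i => by
    refine subset_trans ?_ (hρ i)
    refine closure_mono fun x hx => ?_
    simp only [g, ContinuousMap.coe_mk, Function.mem_support, ne_eq, mul_eq_zero, not_or,
      Complex.ofReal_eq_zero] at hx
    exact hx.1
  have hgU : ∀ i, g i ∈ Cc S := fun i x hx => by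
    obtain ⟨y, -, rfl⟩ := hg i hx
    exact y.2
  have hsum : f = ∑ i, g i := by
    ext x
    by_cases hx : x ∈ tsupport f
    · have h1 := ρ.sum_eq_one hx
      rw [finsum_eq_sum_of_fintype] at h1
      simp only [ContinuousMap.coe_sum, Finset.sum_apply, g, ContinuousMap.coe_mk]
      rw [← Finset.sum_mul, ← Complex.ofReal_sum, h1]
      simp
    · have : f x = 0 := image_eq_zero_of_notMem_tsupport hx
      simp [g, this]
  have : fiberSum S f = fun x => ∑ i, fiberSum S (g i) x := by
    ext x
    conv_lhs => rw [hsum]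
    exact fiberSum_sum S _ g (fun i _ => hgU i) x
  rw [this]
  exact continuous_finsetSum _ fun i _ => continuous_fiberSum_of_subset S (e i) (he i) (hg i)

/-- The transfer operator `L : C_c(U) → C(X)`, `L(f)(x) = ∑_{σ(y) = x} f(y)`. -/
def transfer (S : PartialLocalHomeo X) : Cc S →ₗ[ℂ] C(X, ℂ) where
  toFun f := ⟨fiberSum S f, continuous_fiberSum S f.2⟩
  map_add' f g := ContinuousMap.ext fun x => fiberSum_add S f.2 g.2 x
  map_smul' c f := ContinuousMap.ext fun x => fiberSum_smul S c f.2 x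


/-- `C_c(U)` as a type of its own: its norm is not the supremum norm. -/
def PreMod (S : PartialLocalHomeo X) : Type u := Cc S

namespace PreMod

variable {S : PartialLocalHomeo X}

instance : AddCommGroup (PreMod S) := inferInstanceAs (AddCommGroup (Cc S))
instance : Module ℂ (PreMod S) := inferInstanceAs (Module ℂ (Cc S))

/-- Left multiplication of `C(X)` on `C_c(U)`. -/
instance : Module C(X, ℂ) (PreMod S) := inferInstanceAs (Module C(X, ℂ) (Cc S))
instance : SMulCommClass C(X, ℂ) ℂ (PreMod S) :=
  inferInstanceAs (SMulCommClass C(X, ℂ) ℂ (Cc S))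

instance : FunLike (PreMod S) X ℂ where
  coe f := (f.1 : C(X, ℂ))
  coe_injective _ _ h := Subtype.ext (DFunLike.coe_injective h)

@[ext] lemma ext {f g : PreMod S} (h : ∀ x, f x = g x) : f = g := DFunLike.ext f g h

lemma add_apply (f g : PreMod S) (x : X) : (f + g) x = f x + g x := rfl
lemma smul_apply (c : ℂ) (f : PreMod S) (x : X) : (c • f) x = c * f x := rfl
lemma lsmul_apply (a : C(X, ℂ)) (f : PreMod S) (x : X) : (a • f) x = a x * f x := rfl
lemma zero_apply (x : X) : (0 : PreMod S) x = 0 := rfl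

open Classical in
/-- `f · (a ∘ σ)`, extended by `0` outside `U`. -/
def mulAlphaFun (f : PreMod S) (a : C(X, ℂ)) (x : X) : ℂ :=
  if h : x ∈ S.U then f x * a (S.σ ⟨x, h⟩) else 0

lemma continuous_mulAlphaFun (f : PreMod S) (a : C(X, ℂ)) : Continuous (mulAlphaFun f a) := by
  rw [continuous_iff_continuousAt]
  intro x
  by_cases hx : x ∈ S.U
  · have h1 : ContinuousOn (mulAlphaFun f a) S.U := by
      rw [continuousOn_iff_continuous_domRestrict]
      have : (S.U : Set X).domRestrict (mulAlphaFun f a) = fun y : S.U => f.1.1 y * a (S.σ y) := by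
        ext y
        exact dif_pos y.2
      rw [this]
      exact (f.1.continuous.comp continuous_subtype_val).mul
        (a.continuous.comp S.isLocalHomeomorph.continuous)
    exact h1.continuousAt (S.U.isOpen.mem_nhds hx)
  · have h1 : ∀ z ∈ (tsupport f.1.1)ᶜ, (0 : ℂ) = mulAlphaFun f a z := by
      intro z hz
      have : f z = 0 := image_eq_zero_of_notMem_tsupport hz
      simp [mulAlphaFun, this]
    exact continuousAt_const.congr (Filter.eventuallyEq_of_mem
      ((isClosed_tsupport f.1.1).isOpen_compl.mem_nhds fun h => hx (f.2 h)) h1)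

/-- The function `f · α(a) = f · (a ∘ σ)` in `C_c(U)`. -/
def mulAlpha (f : PreMod S) (a : C(X, ℂ)) : PreMod S :=
  ⟨⟨mulAlphaFun f a, continuous_mulAlphaFun f a⟩, by
    refine subset_trans (closure_mono fun x hx => ?_) f.2
    simp only [ContinuousMap.coe_mk, Function.mem_support, mulAlphaFun] at hx ⊢
    intro h0
    have : f x = 0 := h0
    simp [this] at hx⟩

lemma mulAlpha_apply_mem (f : PreMod S) (a : C(X, ℂ)) (y : S.U) :
    mulAlpha f a y = f y * a (S.σ y) := dif_pos y.2

lemma apply_notMem (f : PreMod S) {x : X} (hx : x ∉ S.U) : f x = 0 := by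
  by_contra h
  exact hx (f.2 (subset_tsupport _ h))

lemma ext_mem {f g : PreMod S} (h : ∀ y : S.U, f y = g y) : f = g := by
  ext x
  by_cases hx : x ∈ S.U
  · exact h ⟨x, hx⟩
  · rw [f.apply_notMem hx, g.apply_notMem hx]

/-- The right action `f · a = f α(a)` of `C(X)` on `C_c(U)`. -/
instance : Module (C(X, ℂ))ᵐᵒᵖ (PreMod S) where
  smul a f := mulAlpha f a.unop
  one_smul f := ext_mem fun y => (mulAlpha_apply_mem f _ y).trans (by simp)
  mul_smul a b f := ext_mem fun y => by
    change mulAlpha f _ y = mulAlpha (mulAlpha f _) _ y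
    simp only [mulAlpha_apply_mem, MulOpposite.unop_mul, ContinuousMap.mul_apply]
    ring
  smul_zero a := ext_mem fun y => (mulAlpha_apply_mem 0 _ y).trans (by simp [zero_apply])
  zero_smul f := ext_mem fun y => (mulAlpha_apply_mem f _ y).trans (by simp [zero_apply])
  smul_add a f g := ext_mem fun y => by
    change mulAlpha _ _ (y : X) = mulAlpha _ _ (y : X) + mulAlpha _ _ (y : X)
    simp only [mulAlpha_apply_mem, add_apply]
    ring
  add_smul a b f := ext_mem fun y => by
    change mulAlpha _ _ (y : X) = mulAlpha _ _ (y : X) + mulAlpha _ _ (y : X)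
    simp only [mulAlpha_apply_mem, MulOpposite.unop_add, ContinuousMap.add_apply]
    ring

lemma rsmul_apply (f : PreMod S) (a : C(X, ℂ)) (y : S.U) : (f <• a) y = f y * a (S.σ y) :=
  mulAlpha_apply_mem f a y

instance : IsScalarTower ℂ (C(X, ℂ))ᵐᵒᵖ (PreMod S) where
  smul_assoc c a f := ext_mem fun y => by
    obtain ⟨a, rfl⟩ := MulOpposite.op_surjective a
    rw [← MulOpposite.op_smul, rsmul_apply, smul_apply, rsmul_apply]
    simp only [ContinuousMap.smul_apply, smul_eq_mul]
    ring

/-- The function `f^* g` in `C_c(U)`. -/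
def starMul (f g : PreMod S) : Cc S := ⟨star f.1 * g.1, (Cc S).mul_mem_left _ g.2⟩

/-- The semi-inner product `⟨f, g⟩ = L(f^* g)` on `C_c(U)`. -/
instance : Inner C(X, ℂ) (PreMod S) where
  inner f g := transfer S (starMul f g)

lemma inner_eq_sum (f g : PreMod S) {K : Set X} (hK : IsClosed K) (hKU : K ⊆ S.U)
    (hf : (∀ y, f y ≠ 0 → y ∈ K) ∨ ∀ y, g y ≠ 0 → y ∈ K) (x : X) : inner C(X, ℂ) f g x =
      ∑ y ∈ (finite_fiber S hK hKU x).toFinset, star (f y) * g y := by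
  refine fiberSum_eq_sum_fiber S hK hKU (fun y hy => ?_) x
  have h : star (f y) * g y ≠ 0 := hy
  rcases hf with hf | hf
  · exact hf y fun h0 => h (by simp [h0])
  · exact hf y fun h0 => h (by simp [h0])

lemma support_subset (f : PreMod S) (y : X) (hy : f y ≠ 0) : y ∈ tsupport f.1.1 :=
  subset_tsupport _ hy

lemma inner_eq_sum_left (f g : PreMod S) (x : X) : inner C(X, ℂ) f g x =
    ∑ y ∈ (finite_fiber S (isClosed_tsupport f.1.1) f.2 x).toFinset, star (f y) * g y :=
  inner_eq_sum f g (isClosed_tsupport f.1.1) f.2 (.inl f.support_subset) x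

lemma inner_eq_sum_right (f g : PreMod S) (x : X) : inner C(X, ℂ) f g x =
    ∑ y ∈ (finite_fiber S (isClosed_tsupport g.1.1) g.2 x).toFinset, star (f y) * g y :=
  inner_eq_sum f g (isClosed_tsupport g.1.1) g.2 (.inr g.support_subset) x

lemma inner_add_right (f g h : PreMod S) :
    inner C(X, ℂ) f (g + h) = inner C(X, ℂ) f g + inner C(X, ℂ) f h := by
  ext x
  simp only [ContinuousMap.add_apply, inner_eq_sum_left, add_apply, mul_add,
    Finset.sum_add_distrib]

lemma inner_smul_right (c : ℂ) (f g : PreMod S) :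
    inner C(X, ℂ) f (c • g) = c • inner C(X, ℂ) f g := by
  ext x
  simp only [ContinuousMap.smul_apply, inner_eq_sum_left, smul_apply, smul_eq_mul, Finset.mul_sum]
  exact Finset.sum_congr rfl fun _ _ => by ring

lemma star_inner (f g : PreMod S) : star (inner C(X, ℂ) f g) = inner C(X, ℂ) g f := by
  ext x
  rw [ContinuousMap.star_apply, inner_eq_sum_left, inner_eq_sum_right, star_sum]
  exact Finset.sum_congr rfl fun _ _ => by rw [star_mul, star_star]

lemma inner_add_left (f g h : PreMod S) :
    inner C(X, ℂ) (f + g) h = inner C(X, ℂ) f h + inner C(X, ℂ) g h := by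
  rw [← star_inner, inner_add_right, star_add, star_inner, star_inner]

lemma inner_smul_left (c : ℂ) (f g : PreMod S) :
    inner C(X, ℂ) (c • f) g = star c • inner C(X, ℂ) f g := by
  rw [← star_inner, inner_smul_right, star_smul, star_inner]

lemma inner_rsmul_right (f g : PreMod S) (a : C(X, ℂ)) :
    inner C(X, ℂ) f (g <• a) = inner C(X, ℂ) f g * a := by
  ext x
  rw [ContinuousMap.mul_apply, inner_eq_sum_left, inner_eq_sum_left, Finset.sum_mul]
  refine Finset.sum_congr rfl fun y hy => ?_
  rw [rsmul_apply, ((Set.Finite.mem_toFinset _).mp hy).1]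
  ring

lemma inner_rsmul_left (f g : PreMod S) (a : C(X, ℂ)) :
    inner C(X, ℂ) (f <• a) g = star a * inner C(X, ℂ) f g := by
  rw [← star_inner, inner_rsmul_right, star_mul, star_inner]

lemma inner_lsmul_right (a : C(X, ℂ)) (f g : PreMod S) :
    inner C(X, ℂ) f (a • g) = inner C(X, ℂ) (star a • f) g := by
  change transfer S _ = transfer S _
  congr 1
  refine Subtype.ext ?_
  change star f.1 * (a * g.1) = star (star a * f.1) * g.1
  rw [star_mul, star_star, mul_assoc]

lemma inner_self_re_nonneg (f : PreMod S) (x : X) : 0 ≤ (inner C(X, ℂ) f f x).re := by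
  rw [inner_eq_sum_left, Complex.re_sum]
  refine Finset.sum_nonneg fun y _ => ?_
  simp only [Complex.star_def, Complex.mul_re, Complex.conj_re, Complex.conj_im]
  nlinarith [sq_nonneg (f y).re, sq_nonneg (f y).im]

/-- The positive semidefinite form `(f, g) ↦ L(f^* g)(x)`. -/
@[reducible] def core (S : PartialLocalHomeo X) (x : X) :
    PreInnerProductSpace.Core ℂ (PreMod S) where
  inner f g := inner C(X, ℂ) f g x
  conj_inner_symm f g := by rw [← star_inner g f]; rfl
  re_inner_nonneg f := f.inner_self_re_nonneg x
  add_left f g h := by rw [inner_add_left]; rfl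
  smul_left f g c := by rw [inner_smul_left]; rfl

instance : Norm (PreMod S) where
  norm f := √‖inner C(X, ℂ) f f‖

lemma norm_def (f : PreMod S) : ‖f‖ = √‖inner C(X, ℂ) f f‖ := rfl

/-- The seminorm `L(f^* f)(x)^{1/2}`. -/
def normAt (x : X) (f : PreMod S) : ℝ := √(inner C(X, ℂ) f f x).re

lemma normAt_nonneg (x : X) (f : PreMod S) : 0 ≤ normAt x f := Real.sqrt_nonneg _

lemma norm_inner_self_apply (f : PreMod S) (x : X) :
    ‖inner C(X, ℂ) f f x‖ = (inner C(X, ℂ) f f x).re := by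
  have him : (inner C(X, ℂ) f f x).im = 0 := by
    have h : star (inner C(X, ℂ) f f x) = inner C(X, ℂ) f f x :=
      congrArg (fun u : C(X, ℂ) => u x) (star_inner f f)
    exact Complex.conj_eq_iff_im.mp h
  have h2 : inner C(X, ℂ) f f x = ((inner C(X, ℂ) f f x).re : ℂ) := Complex.ext rfl (by simpa)
  rw [h2, Complex.norm_real, Complex.ofReal_re, Real.norm_of_nonneg (f.inner_self_re_nonneg x)]

lemma normAt_le (x : X) (f : PreMod S) : normAt x f ≤ ‖f‖ := by
  refine Real.sqrt_le_sqrt ?_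
  rw [← norm_inner_self_apply]
  exact ContinuousMap.norm_coe_le_norm _ x

lemma norm_le {f : PreMod S} {c : ℝ} (hc : 0 ≤ c) (h : ∀ x, normAt x f ≤ c) : ‖f‖ ≤ c := by
  rw [norm_def, Real.sqrt_le_left hc, ContinuousMap.norm_le _ (sq_nonneg c)]
  intro x
  rw [norm_inner_self_apply]
  exact (Real.sqrt_le_left hc).mp (h x)

lemma norm_inner_apply_le (f g : PreMod S) (x : X) :
    ‖inner C(X, ℂ) f g x‖ ≤ normAt x f * normAt x g := by
  let _ := core S x
  exact InnerProductSpace.Core.norm_inner_le_norm (𝕜 := ℂ) f g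

lemma normAt_add_le (f g : PreMod S) (x : X) : normAt x (f + g) ≤ normAt x f + normAt x g := by
  let _ := core S x
  let _ := InnerProductSpace.Core.toSeminormedAddCommGroup (𝕜 := ℂ) (F := PreMod S)
  exact norm_add_le f g

/-- The seminorm `‖f‖ = ‖⟨f, f⟩‖^{1/2}` on `C_c(U)`. -/
instance : SeminormedAddCommGroup (PreMod S) where
  __ := AddGroupSeminorm.toSeminormedAddCommGroup
    { toFun := fun f : PreMod S => ‖f‖
      map_zero' := by
        have h : inner C(X, ℂ) (0 : PreMod S) 0 = 0 := by
          simpa using inner_smul_left (0 : ℂ) (0 : PreMod S) 0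
        simp [norm_def, h]
      add_le' := fun f g => norm_le (add_nonneg (Real.sqrt_nonneg _) (Real.sqrt_nonneg _))
        fun x => (normAt_add_le f g x).trans (add_le_add (normAt_le x f) (normAt_le x g))
      neg' := fun f => by
        have h : inner C(X, ℂ) (-f) (-f) = inner C(X, ℂ) f f := by
          have h1 : -f = (-1 : ℂ) • f := by simp
          rw [h1, inner_smul_left, inner_smul_right]
          simp
        simp only [norm_def, h] }

lemma norm_inner_le (f g : PreMod S) : ‖inner C(X, ℂ) f g‖ ≤ ‖f‖ * ‖g‖ := by
  rw [ContinuousMap.norm_le _ (by positivity)]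
  exact fun x => (norm_inner_apply_le f g x).trans
    (mul_le_mul (normAt_le x f) (normAt_le x g) (normAt_nonneg _ _) (norm_nonneg _))

instance : NormedSpace ℂ (PreMod S) where
  norm_smul_le c f := by
    rw [norm_def, norm_def, inner_smul_left, inner_smul_right, smul_smul, norm_smul,
      Real.sqrt_mul (norm_nonneg _), norm_mul, norm_star, Real.sqrt_mul_self (norm_nonneg _)]

lemma norm_lsmul_le (a : C(X, ℂ)) (f : PreMod S) : ‖a • f‖ ≤ ‖a‖ * ‖f‖ := by
  refine norm_le (by positivity) fun x => ?_
  refine le_trans ?_ (mul_le_mul_of_nonneg_left (normAt_le x f) (norm_nonneg a))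
  rw [normAt, normAt, ← Real.sqrt_sq (norm_nonneg a), ← Real.sqrt_mul (sq_nonneg _)]
  refine Real.sqrt_le_sqrt ?_
  have h : ∀ y : X, (a • f) y ≠ 0 → y ∈ tsupport f.1.1 := fun y hy =>
    f.support_subset y fun h0 => hy (by simp [lsmul_apply, h0])
  rw [inner_eq_sum _ _ (isClosed_tsupport f.1.1) f.2 (.inl h), inner_eq_sum_left, Complex.re_sum,
    Complex.re_sum, Finset.mul_sum]
  refine Finset.sum_le_sum fun y _ => ?_
  have key : ∀ z : ℂ, (star z * z).re = ‖z‖ ^ 2 := fun z => by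
    rw [Complex.star_def, ← Complex.normSq_eq_conj_mul_self, Complex.ofReal_re,
      Complex.normSq_eq_norm_sq]
  rw [key, key, lsmul_apply, norm_mul, mul_pow]
  have := ContinuousMap.norm_coe_le_norm a (y : X)
  gcongr

lemma norm_rsmul_le (f : PreMod S) (a : C(X, ℂ)) : ‖f <• a‖ ≤ ‖f‖ * ‖a‖ := by
  rw [norm_def, inner_rsmul_right, inner_rsmul_left, norm_def,
    ← Real.sqrt_sq (norm_nonneg a), ← Real.sqrt_mul (norm_nonneg _)]
  refine Real.sqrt_le_sqrt ?_
  calc ‖star a * inner C(X, ℂ) f f * a‖ ≤ ‖star a‖ * ‖inner C(X, ℂ) f f‖ * ‖a‖ :=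
        (norm_mul_le _ _).trans (mul_le_mul_of_nonneg_right (norm_mul_le _ _) (norm_nonneg _))
    _ = _ := by rw [norm_star]; ring

instance : UniformContinuousConstSMul C(X, ℂ) (PreMod S) where
  uniformContinuous_const_smul a :=
    AddMonoidHomClass.uniformContinuous_of_bound (DistribSMul.toAddMonoidHom (PreMod S) a) ‖a‖
      fun f => norm_lsmul_le a f

instance : UniformContinuousConstSMul (C(X, ℂ))ᵐᵒᵖ (PreMod S) where
  uniformContinuous_const_smul a :=
    AddMonoidHomClass.uniformContinuous_of_bound (DistribSMul.toAddMonoidHom (PreMod S) a)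
      ‖a.unop‖ fun f => (norm_rsmul_le f a.unop).trans_eq (mul_comm _ _)

/-- The semi-inner product as a bounded sesquilinear map. -/
def innerL (S : PartialLocalHomeo X) : PreMod S →L⋆[ℂ] PreMod S →L[ℂ] C(X, ℂ) :=
  LinearMap.mkContinuous₂
    (LinearMap.mk₂'ₛₗ (starRingEnd ℂ) (RingHom.id ℂ) (fun f g => inner C(X, ℂ) f g)
      inner_add_left inner_smul_left inner_add_right fun c f g => inner_smul_right c f g)
    1 fun f g => by rw [one_mul]; exact norm_inner_le f g

lemma continuous_inner : Continuous fun p : PreMod S × PreMod S => inner C(X, ℂ) p.1 p.2 := by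
  have h : Continuous fun p : PreMod S × PreMod S => innerL S p.1 p.2 :=
    ((innerL S).continuous.comp continuous_fst).clm_apply continuous_snd
  exact h

end PreMod


/-- The right Hilbert `C(X)`-module `M`: the Hausdorff completion of `C_c(U)` for the seminorm
`‖⟨f, f⟩‖^{1/2}`. The left and right actions of `C(X)` are extended from `C_c(U)` by continuity, and
so is the inner product. -/
abbrev HilbMod (S : PartialLocalHomeo X) : Type u := UniformSpace.Completion (PreMod S)

namespace HilbMod

open UniformSpace

variable {S : PartialLocalHomeo X}

lemma inner_coe (f g : PreMod S) :
    inner C(X, ℂ) (f : HilbMod S) (g : HilbMod S) = inner C(X, ℂ) f g :=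
  (Completion.isDenseInducing_coe.prodMap Completion.isDenseInducing_coe).extend_eq
    (f := Function.uncurry (inner C(X, ℂ))) PreMod.continuous_inner (f, g)

lemma continuous_inner :
    Continuous fun p : HilbMod S × HilbMod S => inner C(X, ℂ) p.1 p.2 := by
  let B : PreMod S →+ PreMod S →+ C(X, ℂ) :=
    AddMonoidHom.mk' (fun f => AddMonoidHom.mk' (fun g => inner C(X, ℂ) f g)
      (PreMod.inner_add_right f)) fun f g => by ext1 h; exact PreMod.inner_add_left f g h
  have h : Continuous fun p : PreMod S × PreMod S => B p.1 p.2 := PreMod.continuous_inner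
  exact (Completion.isDenseInducing_toCompl (PreMod S)).extend_Z_bilin
    (Completion.isDenseInducing_toCompl (PreMod S)) h

lemma continuous_inner_right (m : HilbMod S) : Continuous fun n : HilbMod S =>
    inner C(X, ℂ) m n := continuous_inner.comp (by fun_prop : Continuous fun n => (m, n))

lemma inner_add_right (m n p : HilbMod S) :
    inner C(X, ℂ) m (n + p) = inner C(X, ℂ) m n + inner C(X, ℂ) m p := by
  refine Completion.induction_on₃ m n p (isClosed_eq
    (continuous_inner.comp (by fun_prop : Continuous fun x : HilbMod S × HilbMod S × HilbMod S =>
      (x.1, x.2.1 + x.2.2)))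
    ((continuous_inner.comp (by fun_prop : Continuous
      fun x : HilbMod S × HilbMod S × HilbMod S => (x.1, x.2.1))).add
    (continuous_inner.comp (by fun_prop : Continuous
      fun x : HilbMod S × HilbMod S × HilbMod S => (x.1, x.2.2))))) fun f g h => ?_
  rw [← Completion.coe_add, inner_coe, inner_coe, inner_coe, PreMod.inner_add_right]

lemma inner_smul_right (c : ℂ) (m n : HilbMod S) :
    inner C(X, ℂ) m (c • n) = c • inner C(X, ℂ) m n := by
  refine Completion.induction_on₂ m n (isClosed_eq
    (continuous_inner.comp (continuous_fst.prodMk (continuous_snd.const_smul c)))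
    (continuous_inner.const_smul c)) fun f g => ?_
  rw [← Completion.coe_smul, inner_coe, inner_coe, PreMod.inner_smul_right]

lemma norm_inner_le (m n : HilbMod S) : ‖inner C(X, ℂ) m n‖ ≤ ‖m‖ * ‖n‖ := by
  refine Completion.induction_on₂ m n (isClosed_le continuous_inner.norm (by fun_prop))
    fun f g => ?_
  rw [inner_coe, Completion.norm_coe, Completion.norm_coe]
  exact PreMod.norm_inner_le f g

lemma norm_inner_self (m : HilbMod S) : ‖inner C(X, ℂ) m m‖ = ‖m‖ ^ 2 := by
  refine Completion.induction_on m (isClosed_eq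
    (continuous_inner.comp (by fun_prop : Continuous fun x : HilbMod S => (x, x))).norm
    (by fun_prop)) fun f => ?_
  rw [inner_coe, Completion.norm_coe, PreMod.norm_def, Real.sq_sqrt (norm_nonneg _)]

lemma norm_rsmul_le (m : HilbMod S) (a : C(X, ℂ)) : ‖m <• a‖ ≤ ‖m‖ * ‖a‖ := by
  refine Completion.induction_on m (isClosed_le (continuous_const_smul _).norm
    (continuous_norm.mul_const _)) fun f => ?_
  rw [← Completion.coe_smul, Completion.norm_coe, Completion.norm_coe]
  exact PreMod.norm_rsmul_le f a

/-- The left multiplication `φ(a) : M → M`. -/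
def leftMul (S : PartialLocalHomeo X) (a : C(X, ℂ)) : HilbMod S →L[ℂ] HilbMod S where
  toFun m := a • m
  map_add' := smul_add a
  map_smul' c m := smul_comm a c m
  cont := continuous_const_smul a

/-- The rank one operator `m ⊗ n : ξ ↦ m ⟨n, ξ⟩`. -/
def rankOne (m n : HilbMod S) : HilbMod S →L[ℂ] HilbMod S :=
  LinearMap.mkContinuous
    { toFun := fun ξ => m <• inner C(X, ℂ) n ξ
      map_add' := fun ξ η => by rw [inner_add_right, MulOpposite.op_add, add_smul]
      map_smul' := fun c ξ => by
        rw [inner_smul_right, MulOpposite.op_smul, smul_assoc, RingHom.id_apply] }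
    (‖m‖ * ‖n‖) fun ξ => by
      refine (norm_rsmul_le m _).trans ?_
      rw [mul_assoc]
      exact mul_le_mul_of_nonneg_left (norm_inner_le n ξ) (norm_nonneg m)

/-- The generalized compact operators `K(M)`: the closed linear span of the `m ⊗ n`. -/
def compacts (S : PartialLocalHomeo X) : Submodule ℂ (HilbMod S →L[ℂ] HilbMod S) :=
  (Submodule.span ℂ {T | ∃ m n : HilbMod S, T = rankOne m n}).topologicalClosure

end HilbMod

/-- The ideal `I₀ = ker(φ)^⊥ ∩ φ⁻¹(K(M))` of `C(X)`, as a set. -/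
def idealI₀ (S : PartialLocalHomeo X) : Set C(X, ℂ) :=
  {a | (∀ b, HilbMod.leftMul S b = 0 → a * b = 0) ∧ HilbMod.leftMul S a ∈ HilbMod.compacts S}

/-- A representation in the C⋆-algebra `B` of the relations that define the Toeplitz algebra:
those of the algebra `C(X)`, of the vector space `M`, of the bimodule products, and
`m^* n = ⟨m, n⟩`. -/
structure ToeplitzRep (S : PartialLocalHomeo X) (B : Type u) [CStarAlgebra B] where
  fn : C(X, ℂ) →⋆ₐ[ℂ] B
  vec : HilbMod S →ₗ[ℂ] B
  fn_mul_vec : ∀ a m, fn a * vec m = vec (a • m)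
  vec_mul_fn : ∀ m a, vec m * fn a = vec (m <• a)
  star_vec_mul_vec : ∀ m n, star (vec m) * vec n = fn (inner C(X, ℂ) m n)

/-- The generators of the Toeplitz algebra: the elements of `C(X)` and of `M`, and formal adjoints
of the elements of `M`. -/
inductive Gen (S : PartialLocalHomeo X) : Type u
  | fn (a : C(X, ℂ))
  | vec (m : HilbMod S)
  | adj (m : HilbMod S)

namespace Gen

variable {S : PartialLocalHomeo X}

/-- The formal adjoint of a generator. -/
def star : Gen S → Gen S
  | fn a => fn (Star.star a)
  | vec m => adj m
  | adj m => vec m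

/-- Multiplication of the generators in `M` by the scalar `z`, and of their adjoints by its
conjugate. -/
def rotate (z : ℂ) : Gen S → Gen S
  | fn a => fn a
  | vec m => vec (z • m)
  | adj m => adj (z • m)

lemma star_star (g : Gen S) : g.star.star = g := by
  cases g <;> simp [star]

end Gen

/-- The free unital complex algebra on the generators. -/
def FreeToeplitz (S : PartialLocalHomeo X) : Type u := FreeAlgebra ℂ (Gen S)

namespace FreeToeplitz

variable {S : PartialLocalHomeo X}

instance : Ring (FreeToeplitz S) := inferInstanceAs (Ring (FreeAlgebra ℂ (Gen S)))
instance : Algebra ℂ (FreeToeplitz S) := inferInstanceAs (Algebra ℂ (FreeAlgebra ℂ (Gen S)))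

/-- The generators in the free algebra. -/
def ι (g : Gen S) : FreeToeplitz S := FreeAlgebra.ι ℂ g

/-- The universal property of the free algebra. -/
def lift {B : Type*} [Semiring B] [Algebra ℂ B] (F : Gen S → B) : FreeToeplitz S →ₐ[ℂ] B :=
  FreeAlgebra.lift ℂ F

@[simp] lemma lift_ι {B : Type*} [Semiring B] [Algebra ℂ B] (F : Gen S → B) (g : Gen S) :
    lift F (ι g) = F g := FreeAlgebra.lift_ι_apply F g

lemma induction {p : FreeToeplitz S → Prop} (hc : ∀ c : ℂ, p (algebraMap ℂ _ c))
    (hι : ∀ g, p (ι g)) (hmul : ∀ x y, p x → p y → p (x * y))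
    (hadd : ∀ x y, p x → p y → p (x + y)) (x : FreeToeplitz S) : p x :=
  FreeAlgebra.induction ℂ (Gen S) hc hι hmul hadd x

/-- The conjugate-linear antimultiplicative map that extends the formal adjoint of generators. -/
def starHom (S : PartialLocalHomeo X) : FreeToeplitz S →+* (FreeToeplitz S)ᵐᵒᵖ :=
  let _ : Algebra ℂ (FreeToeplitz S)ᵐᵒᵖ :=
    RingHom.toAlgebra' ((algebraMap ℂ (FreeToeplitz S)ᵐᵒᵖ).comp (starRingEnd ℂ))
      fun c x => Algebra.commutes (R := ℂ) (A := (FreeToeplitz S)ᵐᵒᵖ) (starRingEnd ℂ c) x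
  (lift fun g : Gen S => MulOpposite.op (ι g.star)).toRingHom

lemma starHom_ι (g : Gen S) : starHom S (ι g) = MulOpposite.op (ι g.star) := by
  unfold starHom
  exact @lift_ι X _ _ _ S _ _ (_) _ g

lemma starHom_algebraMap (c : ℂ) :
    starHom S (algebraMap ℂ _ c) = MulOpposite.op (algebraMap ℂ _ (star c)) := by
  unfold starHom
  exact @AlgHom.commutes ℂ (FreeToeplitz S) (FreeToeplitz S)ᵐᵒᵖ _ _ _ _ (_) _ c

instance : StarRing (FreeToeplitz S) where
  star x := (starHom S x).unop
  star_involutive x := by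
    refine induction (p := fun x => (starHom S (starHom S x).unop).unop = x) ?_ ?_ ?_ ?_ x
    · intro c
      rw [starHom_algebraMap, MulOpposite.unop_op, starHom_algebraMap, MulOpposite.unop_op,
        star_star]
    · intro g
      rw [starHom_ι, MulOpposite.unop_op, starHom_ι, MulOpposite.unop_op, Gen.star_star]
    · intro x y hx hy
      simp only [map_mul, MulOpposite.unop_mul, hx, hy]
    · intro x y hx hy
      simp only [map_add, MulOpposite.unop_add, hx, hy]
  star_mul x y := by simp only [map_mul, MulOpposite.unop_mul]
  star_add x y := by simp only [map_add, MulOpposite.unop_add]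

lemma star_ι (g : Gen S) : star (ι g) = ι g.star := congrArg MulOpposite.unop (starHom_ι g)

lemma star_algebraMap (c : ℂ) :
    star (algebraMap ℂ (FreeToeplitz S) c) = algebraMap ℂ _ (star c) :=
  congrArg MulOpposite.unop (starHom_algebraMap c)

instance : StarModule ℂ (FreeToeplitz S) where
  star_smul c x := by
    rw [Algebra.smul_def, star_mul, star_algebraMap, Algebra.smul_def, Algebra.commutes]

end FreeToeplitz

namespace ToeplitzRep

variable {S : PartialLocalHomeo X} {B : Type u} [CStarAlgebra B]

/-- The extension of a representation to the free algebra. -/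
def eval (ρ : ToeplitzRep S B) : FreeToeplitz S →ₐ[ℂ] B :=
  FreeToeplitz.lift fun g => match g with
    | .fn a => ρ.fn a
    | .vec m => ρ.vec m
    | .adj m => star (ρ.vec m)

lemma eval_star (ρ : ToeplitzRep S B) (x : FreeToeplitz S) : ρ.eval (star x) = star (ρ.eval x) := by
  refine FreeToeplitz.induction (p := fun x => ρ.eval (star x) = star (ρ.eval x)) ?_ ?_ ?_ ?_ x
  · intro c
    rw [FreeToeplitz.star_algebraMap, AlgHom.commutes, AlgHom.commutes, algebraMap_star_comm]
  · intro g
    rw [FreeToeplitz.star_ι]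
    cases g <;> simp [eval, Gen.star, map_star]
  · intro x y hx hy
    rw [star_mul, map_mul, map_mul, star_mul, hx, hy]
  · intro x y hx hy
    rw [star_add, map_add, map_add, star_add, hx, hy]

/-- The representation `(fn, z • vec)` for `|z| = 1`. -/
def rotate (ρ : ToeplitzRep S B) (z : Circle) : ToeplitzRep S B where
  fn := ρ.fn
  vec := (z : ℂ) • ρ.vec
  fn_mul_vec a m := by
    rw [LinearMap.smul_apply, LinearMap.smul_apply, mul_smul_comm, ρ.fn_mul_vec]
  vec_mul_fn m a := by
    rw [LinearMap.smul_apply, LinearMap.smul_apply, smul_mul_assoc, ρ.vec_mul_fn]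
  star_vec_mul_vec m n := by
    have hz : star (z : ℂ) * (z : ℂ) = 1 := by
      rw [Complex.star_def, ← Complex.normSq_eq_conj_mul_self, Circle.normSq_coe,
        Complex.ofReal_one]
    rw [LinearMap.smul_apply, LinearMap.smul_apply, star_smul, smul_mul_smul_comm,
      ρ.star_vec_mul_vec, hz, one_smul]

lemma norm_vec_le (ρ : ToeplitzRep S B) (m : HilbMod S) : ‖ρ.vec m‖ ≤ ‖m‖ := by
  have h : ‖ρ.vec m‖ ^ 2 ≤ ‖m‖ ^ 2 := by
    rw [← HilbMod.norm_inner_self, sq, ← CStarRing.norm_star_mul_self, ρ.star_vec_mul_vec]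
    exact NonUnitalStarAlgHom.norm_apply_le ρ.fn _
  exact (sq_le_sq₀ (norm_nonneg _) (norm_nonneg _)).mp h

end ToeplitzRep

namespace FreeToeplitz

variable {S : PartialLocalHomeo X}

/-- The norms of `x` in all representations of the relations. -/
def normSet (x : FreeToeplitz S) : Set ℝ :=
  {r | ∃ (B : Type u) (_ : CStarAlgebra B) (ρ : ToeplitzRep S B), r = ‖ρ.eval x‖}

lemma bddAbove_normSet (x : FreeToeplitz S) : BddAbove (normSet x) := by
  refine induction (p := fun x => BddAbove (normSet x)) ?_ ?_ ?_ ?_ x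
  · intro c
    refine ⟨‖c‖ * 1, ?_⟩
    rintro _ ⟨B, _, ρ, rfl⟩
    rw [AlgHom.commutes, norm_algebraMap]
    gcongr
    rcases subsingleton_or_nontrivial B with h | h
    · rw [Subsingleton.elim (1 : B) 0, norm_zero]; exact zero_le_one
    · rw [CStarRing.norm_one]
  · rintro (a | m | m)
    · refine ⟨‖a‖, ?_⟩
      rintro _ ⟨B, _, ρ, rfl⟩
      simpa [ToeplitzRep.eval] using NonUnitalStarAlgHom.norm_apply_le ρ.fn a
    · refine ⟨‖m‖, ?_⟩
      rintro _ ⟨B, _, ρ, rfl⟩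
      simpa [ToeplitzRep.eval] using ρ.norm_vec_le m
    · refine ⟨‖m‖, ?_⟩
      rintro _ ⟨B, _, ρ, rfl⟩
      simpa [ToeplitzRep.eval] using ρ.norm_vec_le m
  · rintro x y ⟨c, hc⟩ ⟨d, hd⟩
    refine ⟨c * d, ?_⟩
    rintro _ ⟨B, _, ρ, rfl⟩
    have h1 := hc ⟨B, _, ρ, rfl⟩
    have h2 := hd ⟨B, _, ρ, rfl⟩
    rw [map_mul]
    exact (norm_mul_le _ _).trans
      (mul_le_mul h1 h2 (norm_nonneg _) ((norm_nonneg _).trans h1))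
  · rintro x y ⟨c, hc⟩ ⟨d, hd⟩
    refine ⟨c + d, ?_⟩
    rintro _ ⟨B, _, ρ, rfl⟩
    rw [map_add]
    exact (norm_add_le _ _).trans (add_le_add (hc ⟨B, _, ρ, rfl⟩) (hd ⟨B, _, ρ, rfl⟩))

/-- The universal C⋆-seminorm: the supremum of the norms in all representations. -/
instance : Norm (FreeToeplitz S) where
  norm x := sSup (normSet x)

lemma norm_eval_le {B : Type u} [CStarAlgebra B] (ρ : ToeplitzRep S B) (x : FreeToeplitz S) :
    ‖ρ.eval x‖ ≤ ‖x‖ := le_csSup (bddAbove_normSet x) ⟨B, _, ρ, rfl⟩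

lemma norm_le {x : FreeToeplitz S} {c : ℝ} (hc : 0 ≤ c)
    (h : ∀ (B : Type u) [CStarAlgebra B] (ρ : ToeplitzRep S B), ‖ρ.eval x‖ ≤ c) : ‖x‖ ≤ c := by
  refine Real.sSup_le ?_ hc
  rintro _ ⟨B, _, ρ, rfl⟩
  exact h B ρ

lemma nonneg (x : FreeToeplitz S) : 0 ≤ ‖x‖ := by
  refine Real.sSup_nonneg ?_
  rintro _ ⟨B, _, ρ, rfl⟩
  exact norm_nonneg _

instance : SeminormedRing (FreeToeplitz S) where
  __ := (inferInstance : Ring (FreeToeplitz S))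
  __ := AddGroupSeminorm.toSeminormedAddCommGroup
    { toFun := fun x : FreeToeplitz S => ‖x‖
      map_zero' := le_antisymm (norm_le le_rfl fun B _ ρ => by rw [map_zero, norm_zero]) (nonneg _)
      add_le' := fun x y => norm_le (add_nonneg (nonneg x) (nonneg y)) fun B _ ρ => by
        rw [map_add]
        exact (norm_add_le _ _).trans (add_le_add (norm_eval_le ρ x) (norm_eval_le ρ y))
      neg' := fun x => le_antisymm
        (norm_le (nonneg x) fun B _ ρ => by rw [map_neg, norm_neg]; exact norm_eval_le ρ x)
        (norm_le (nonneg _) fun B _ ρ => by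
          rw [← norm_neg, ← map_neg]; exact norm_eval_le ρ (-x)) }
  norm_mul_le x y := norm_le (mul_nonneg (nonneg x) (nonneg y)) fun B _ ρ => by
    rw [map_mul]
    exact (norm_mul_le _ _).trans
      (mul_le_mul (norm_eval_le ρ x) (norm_eval_le ρ y) (norm_nonneg _) (nonneg x))

instance : NormedAlgebra ℂ (FreeToeplitz S) where
  norm_smul_le c x := norm_le (mul_nonneg (norm_nonneg c) (nonneg x)) fun B _ ρ => by
    rw [map_smul, norm_smul]
    exact mul_le_mul_of_nonneg_left (norm_eval_le ρ x) (norm_nonneg c)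

instance : NormedStarGroup (FreeToeplitz S) where
  norm_star_le x := norm_le (nonneg x) fun B _ ρ => by
    rw [ρ.eval_star, norm_star]; exact norm_eval_le ρ x

lemma norm_mul_self_le (x : FreeToeplitz S) : ‖x‖ * ‖x‖ ≤ ‖star x * x‖ := by
  have h : ‖x‖ ≤ √‖star x * x‖ := norm_le (Real.sqrt_nonneg _) fun B _ ρ => by
    refine Real.le_sqrt_of_sq_le ?_
    rw [sq, ← CStarRing.norm_star_mul_self, ← ρ.eval_star, ← map_mul]
    exact norm_eval_le ρ _
  calc ‖x‖ * ‖x‖ ≤ √‖star x * x‖ * √‖star x * x‖ := mul_self_le_mul_self (nonneg x) h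
    _ = _ := Real.mul_self_sqrt (nonneg _)

/-- The automorphism of the free algebra induced by multiplication of `M` by `z`, `|z| = 1`. -/
def rotate (S : PartialLocalHomeo X) (z : Circle) : FreeToeplitz S →ₐ[ℂ] FreeToeplitz S :=
  lift fun g => ι (g.rotate z)

lemma eval_rotate {B : Type u} [CStarAlgebra B] (ρ : ToeplitzRep S B) (z : Circle)
    (x : FreeToeplitz S) : ρ.eval (rotate S z x) = (ρ.rotate z).eval x := by
  refine induction (p := fun x => ρ.eval (rotate S z x) = (ρ.rotate z).eval x) ?_ ?_ ?_ ?_ x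
  · intro c
    simp only [AlgHom.commutes]
  · intro g
    cases g <;> simp [rotate, ToeplitzRep.eval, Gen.rotate, ToeplitzRep.rotate]
  · intro x y hx hy
    simp only [map_mul, hx, hy]
  · intro x y hx hy
    simp only [map_add, hx, hy]

lemma norm_rotate_le (z : Circle) (x : FreeToeplitz S) : ‖rotate S z x‖ ≤ ‖x‖ :=
  norm_le (norm_nonneg x) fun B _ ρ => by rw [eval_rotate]; exact norm_eval_le _ x

lemma continuous_rotate (z : Circle) : Continuous (rotate S z) :=
  AddMonoidHomClass.continuous_of_bound (rotate S z) 1 fun x => by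
    rw [one_mul]; exact norm_rotate_le z x

end FreeToeplitz

/-- The Toeplitz algebra `T(X, α, L)`: the universal C⋆-algebra generated by `C(X) ∪ M` subject to
the relations in `ToeplitzRep`, that is, the Hausdorff completion of the free algebra for the
universal C⋆-seminorm. -/
abbrev Toeplitz (S : PartialLocalHomeo X) : Type u := UniformSpace.Completion (FreeToeplitz S)

namespace Toeplitz

open UniformSpace

variable {S : PartialLocalHomeo X}

instance : NormedAlgebra ℂ (Toeplitz S) where
  norm_smul_le := norm_smul_le

instance : Star (Toeplitz S) where
  star := Completion.map star

lemma uniformContinuous_star : UniformContinuous (star : FreeToeplitz S → FreeToeplitz S) :=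
  star_isometry.uniformContinuous

lemma continuous_star : Continuous (star : Toeplitz S → Toeplitz S) := Completion.continuous_map

lemma coe_star (x : FreeToeplitz S) : ((star x : FreeToeplitz S) : Toeplitz S) = star ↑x :=
  (Completion.map_coe uniformContinuous_star x).symm

instance : StarRing (Toeplitz S) where
  star_involutive x := by
    refine Completion.induction_on x
      (isClosed_eq (continuous_star.comp continuous_star) continuous_id) fun x => ?_
    rw [← coe_star, ← coe_star, star_star]
  star_mul x y := by
    refine Completion.induction_on₂ x y (isClosed_eq
      (continuous_star.comp (by fun_prop))
      ((continuous_star.comp (by fun_prop)).mul (continuous_star.comp (by fun_prop))))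
      fun x y => ?_
    rw [← Completion.coe_mul, ← coe_star, ← coe_star, ← coe_star, star_mul, Completion.coe_mul]
  star_add x y := by
    refine Completion.induction_on₂ x y (isClosed_eq
      (continuous_star.comp (by fun_prop))
      ((continuous_star.comp (by fun_prop)).add (continuous_star.comp (by fun_prop))))
      fun x y => ?_
    rw [← Completion.coe_add, ← coe_star, ← coe_star, ← coe_star, star_add, Completion.coe_add]

instance : StarModule ℂ (Toeplitz S) where
  star_smul c x := by
    refine Completion.induction_on x (isClosed_eq
      (continuous_star.comp (continuous_const_smul c)) ((continuous_const_smul (star c)).comp continuous_star)) fun x => ?_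
    rw [← Completion.coe_smul, ← coe_star, ← coe_star, star_smul, Completion.coe_smul]

instance : CStarRing (Toeplitz S) where
  norm_mul_self_le x := by
    refine Completion.induction_on x (isClosed_le (by fun_prop)
      ((continuous_star.mul continuous_id).norm)) fun x => ?_
    rw [← coe_star, ← Completion.coe_mul, Completion.norm_coe, Completion.norm_coe]
    exact FreeToeplitz.norm_mul_self_le x

instance : CStarAlgebra (Toeplitz S) where

/-- The copy of `f ∈ C(X)` in the Toeplitz algebra. -/
def fn (S : PartialLocalHomeo X) (f : C(X, ℂ)) : Toeplitz S :=
  (FreeToeplitz.ι (.fn f) : FreeToeplitz S)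

/-- The copy of `m ∈ M` in the Toeplitz algebra. -/
def vec (m : HilbMod S) : Toeplitz S := (FreeToeplitz.ι (.vec m) : FreeToeplitz S)

/-- The closed subalgebra `K̂₁` of the Toeplitz algebra generated by the elements `m n^*`. -/
def K₁ (S : PartialLocalHomeo X) : NonUnitalSubalgebra ℂ (Toeplitz S) :=
  (NonUnitalAlgebra.adjoin ℂ
    {x : Toeplitz S | ∃ m n : HilbMod S, x = vec m * star (vec n)}).topologicalClosure

/-- A redundancy: a pair `(a, k)`, `a ∈ C(X)`, `k ∈ K̂₁`, with `a m = k m` for all `m ∈ M`. -/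
def IsRedundancy (a : C(X, ℂ)) (k : Toeplitz S) : Prop :=
  k ∈ K₁ S ∧ ∀ m : HilbMod S, fn S a * vec m = k * vec m

/-- The gauge automorphism `θ_z` of the Toeplitz algebra: `θ_z(f) = f` for `f ∈ C(X)` and
`θ_z(m) = z m` for `m ∈ M`. -/
def gauge (S : PartialLocalHomeo X) (z : Circle) : Toeplitz S →+* Toeplitz S :=
  Completion.mapRingHom (FreeToeplitz.rotate S z : FreeToeplitz S →+* FreeToeplitz S)
    (FreeToeplitz.continuous_rotate z)

lemma continuous_gauge (z : Circle) : Continuous (gauge S z) := Completion.continuous_map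

lemma gauge_coe (z : Circle) (x : FreeToeplitz S) :
    gauge S z (x : Toeplitz S) = ((FreeToeplitz.rotate S z x : FreeToeplitz S) : Toeplitz S) :=
  Completion.mapRingHom_coe (FreeToeplitz.continuous_rotate z) x

lemma coe_eq_coe {x y : FreeToeplitz S}
    (h : ∀ (B : Type u) [CStarAlgebra B] (ρ : ToeplitzRep S B), ρ.eval x = ρ.eval y) :
    (x : Toeplitz S) = (y : Toeplitz S) := by
  have h0 : ‖x - y‖ ≤ 0 := FreeToeplitz.norm_le le_rfl fun B _ ρ => by
    rw [map_sub, h B ρ, sub_self, norm_zero]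
  rw [← sub_eq_zero, ← norm_le_zero_iff, ← Completion.coe_sub, Completion.norm_coe]
  exact h0

lemma gauge_fn (z : Circle) (f : C(X, ℂ)) : gauge S z (fn S f) = fn S f := by
  rw [fn, gauge_coe, FreeToeplitz.rotate, FreeToeplitz.lift_ι]
  rfl

lemma gauge_vec (z : Circle) (m : HilbMod S) : gauge S z (vec m) = (z : ℂ) • vec m := by
  rw [vec, gauge_coe, FreeToeplitz.rotate, FreeToeplitz.lift_ι, ← Completion.coe_smul]
  refine coe_eq_coe fun B _ ρ => ?_
  simp [ToeplitzRep.eval, Gen.rotate]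

lemma gauge_star_vec (z : Circle) (m : HilbMod S) :
    gauge S z (star (vec m)) = star (z : ℂ) • star (vec m) := by
  rw [vec, ← coe_star, FreeToeplitz.star_ι, gauge_coe, FreeToeplitz.rotate, FreeToeplitz.lift_ι,
    ← Completion.coe_smul]
  refine coe_eq_coe fun B _ ρ => ?_
  simp [ToeplitzRep.eval, Gen.rotate, Gen.star]

lemma gauge_smul (z : Circle) (c : ℂ) (x : Toeplitz S) : gauge S z (c • x) = c • gauge S z x := by
  refine Completion.induction_on x (isClosed_eq
    ((continuous_gauge z).comp (continuous_const_smul c))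
    ((continuous_const_smul c).comp (continuous_gauge z))) fun x => ?_
  rw [← Completion.coe_smul, gauge_coe, gauge_coe, map_smul, Completion.coe_smul]

lemma gauge_of_mem_K₁ (z : Circle) {k : Toeplitz S} (hk : k ∈ K₁ S) : gauge S z k = k := by
  have hcl : IsClosed {k : Toeplitz S | gauge S z k = k} :=
    isClosed_eq (continuous_gauge z) continuous_id
  refine hcl.closure_subset_iff.mpr ?_ (show k ∈ closure _ from hk)
  intro x hx
  refine NonUnitalAlgebra.adjoin_induction (p := fun x _ => gauge S z x = x) ?_ ?_ ?_ ?_ ?_ hx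
  · rintro _ ⟨m, n, rfl⟩
    have hz : (z : ℂ) * star (z : ℂ) = 1 := by
      rw [mul_comm, Complex.star_def, ← Complex.normSq_eq_conj_mul_self, Circle.normSq_coe,
        Complex.ofReal_one]
    rw [map_mul, gauge_vec, gauge_star_vec, smul_mul_smul_comm, hz, one_smul]
  · intro x y _ _ hx hy
    rw [map_add, hx, hy]
  · exact map_zero _
  · intro x y _ _ hx hy
    rw [map_mul, hx, hy]
  · intro c x _ hx
    rw [gauge_smul, hx]

end Toeplitz

/-- The closed two-sided ideal `⟨s⟩` generated by a set `s`. -/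
def closedIdeal {R : Type*} [Ring R] [TopologicalSpace R] (s : Set R) : TwoSidedIdeal R :=
  sInf {I | IsClosed (I : Set R) ∧ s ⊆ I}

lemma mem_closedIdeal {R : Type*} [Ring R] [TopologicalSpace R] {s : Set R} {x : R} :
    x ∈ closedIdeal s ↔ ∀ I : TwoSidedIdeal R, IsClosed (I : Set R) → s ⊆ I → x ∈ I := by
  simp [closedIdeal, TwoSidedIdeal.mem_sInf]

lemma isClosed_closedIdeal {R : Type*} [Ring R] [TopologicalSpace R] (s : Set R) :
    IsClosed (closedIdeal s : Set R) := by
  have h : (closedIdeal s : Set R) =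
      ⋂ (I : TwoSidedIdeal R) (_ : IsClosed (I : Set R)) (_ : s ⊆ I), (I : Set R) := by
    ext x
    simp [mem_closedIdeal]
  rw [h]
  exact isClosed_iInter fun I => isClosed_iInter fun hI => isClosed_iInter fun _ => hI

lemma subset_closedIdeal {R : Type*} [Ring R] [TopologicalSpace R] (s : Set R) :
    s ⊆ closedIdeal s := fun _ hx => mem_closedIdeal.mpr fun _ _ h => h hx

/-- The closed ideal of `T(X, α, L)` generated by the `a - k` for the redundancies `(a, k)` with
`a ∈ I₀`. -/
def redundancyIdeal (S : PartialLocalHomeo X) : Ideal (Toeplitz S) :=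
  (closedIdeal {x | ∃ a ∈ idealI₀ S, ∃ k, Toeplitz.IsRedundancy a k ∧
    x = Toeplitz.fn S a - k}).asIdeal

instance (S : PartialLocalHomeo X) : (redundancyIdeal S).IsTwoSided :=
  inferInstanceAs (TwoSidedIdeal.asIdeal _).IsTwoSided

instance (S : PartialLocalHomeo X) : IsClosed (redundancyIdeal S : Set (Toeplitz S)) :=
  isClosed_closedIdeal _

lemma redundancyIdeal_le_comap (S : PartialLocalHomeo X) (z : Circle) :
    redundancyIdeal S ≤ (redundancyIdeal S).comap (Toeplitz.gauge S z) := by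
  intro x hx
  have hcl : IsClosed ((closedIdeal {x | ∃ a ∈ idealI₀ S, ∃ k, Toeplitz.IsRedundancy a k ∧
      x = Toeplitz.fn S a - k}).comap (Toeplitz.gauge S z) : Set (Toeplitz S)) := by
    have h := (isClosed_closedIdeal {x | ∃ a ∈ idealI₀ S, ∃ k, Toeplitz.IsRedundancy a k ∧
      x = Toeplitz.fn S a - k}).preimage (Toeplitz.continuous_gauge z)
    convert h using 1
    ext y
    exact TwoSidedIdeal.mem_comap _
  have hx' := mem_closedIdeal.mp hx _ hcl ?_
  · exact (TwoSidedIdeal.mem_comap _).mp hx'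
  · rintro _ ⟨a, ha, k, hk, rfl⟩
    refine (TwoSidedIdeal.mem_comap _).mpr ?_
    rw [map_sub, Toeplitz.gauge_fn, Toeplitz.gauge_of_mem_K₁ z hk.1]
    exact subset_closedIdeal _ ⟨a, ha, k, hk, rfl⟩

/-- The crossed product by a partial endomorphism `O(X, α, L)`: the quotient of the C⋆-algebra
`T(X, α, L)` by the redundancy ideal, with the quotient norm. (Closed two-sided ideals of
C⋆-algebras are self-adjoint, so that this is the quotient C⋆-algebra.) -/
abbrev CrossedProduct (S : PartialLocalHomeo X) : Type u := Toeplitz S ⧸ redundancyIdeal S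

namespace CrossedProduct

variable {S : PartialLocalHomeo X}

instance : NormedRing (CrossedProduct S) where
  __ := (inferInstance : Ring (CrossedProduct S))
  __ := (inferInstance : NormedAddCommGroup (CrossedProduct S))
  norm_mul_le x y := by
    have h : ∀ ε > 0, ‖x * y‖ ≤ (‖x‖ + ε) * (‖y‖ + ε) := fun ε hε => by
      obtain ⟨a, rfl, ha⟩ := Submodule.Quotient.norm_mk_lt x hε
      obtain ⟨b, rfl, hb⟩ := Submodule.Quotient.norm_mk_lt y hε
      exact (Submodule.Quotient.norm_mk_le (redundancyIdeal S) (a * b)).trans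
        ((norm_mul_le a b).trans (mul_le_mul ha.le hb.le (norm_nonneg b)
          ((norm_nonneg a).trans ha.le)))
    have hlim : Filter.Tendsto (fun ε : ℝ => (‖x‖ + ε) * (‖y‖ + ε)) (nhdsWithin 0 (Ioi 0))
        (nhds ((‖x‖ + 0) * (‖y‖ + 0))) :=
      (Continuous.tendsto (by fun_prop) 0).mono_left nhdsWithin_le_nhds
    rw [add_zero, add_zero] at hlim
    exact ge_of_tendsto hlim (Filter.eventually_of_mem self_mem_nhdsWithin fun ε hε => h ε hε)

/-- The canonical map `C(X) → O(X, α, L)`. -/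
def fn (S : PartialLocalHomeo X) (f : C(X, ℂ)) : CrossedProduct S :=
  Ideal.Quotient.mk (redundancyIdeal S) (Toeplitz.fn S f)

/-- The gauge action of the circle on `O(X, α, L)`, induced by that on `T(X, α, L)`. -/
def gauge (S : PartialLocalHomeo X) (z : Circle) : CrossedProduct S →+* CrossedProduct S :=
  Ideal.quotientMap (redundancyIdeal S) (Toeplitz.gauge S z) (redundancyIdeal_le_comap S z)

end CrossedProduct

/-- A gauge-invariant ideal of `O(X, α, L)`: a closed two-sided ideal `I` with `θ_z(I) ⊆ I` for all
`z` in the circle. -/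
structure IsGaugeInvariantIdeal (S : PartialLocalHomeo X)
    (I : TwoSidedIdeal (CrossedProduct S)) : Prop where
  isClosed : IsClosed (I : Set (CrossedProduct S))
  gauge_mem : ∀ z : Circle, ∀ x ∈ I, CrossedProduct.gauge S z x ∈ I

/-- `V` is `σ, σ⁻¹`-invariant: `σ(V ∩ U) ⊆ V` and `σ⁻¹(V) ⊆ V`. -/
structure IsInvariant (S : PartialLocalHomeo X) (V : Set X) : Prop where
  apply_mem : ∀ y : S.U, (y : X) ∈ V → S.σ y ∈ V
  mem_of_apply_mem : ∀ y : S.U, S.σ y ∈ V → (y : X) ∈ V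

/-- `C₀(V)` for an open set `V`, as the set of all `f ∈ C(X)` that vanish outside `V`. -/
def C₀ (V : Opens X) : Set C(X, ℂ) := {f | ∀ x ∉ V, f x = 0}

/-- `I ∩ C(X)`, as a set of functions on `X`. -/
def interFn (S : PartialLocalHomeo X) (I : TwoSidedIdeal (CrossedProduct S)) : Set C(X, ℂ) :=
  {f | CrossedProduct.fn S f ∈ I}

end PartialCrossedProduct

end

/-! The link between ideals and open sets is the orbit representation of the Toeplitz algebra on
ℓ²(X \ V): functions act by multiplication and f ∈ C_c(U) acts by ξ ↦ f · (ξ ∘ σ). For invariant V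
it satisfies the Toeplitz relations and kills every redundancy (`orbitHom_eq_zero`), so it descends
to O(X, α, L), and the functions in its kernel are exactly C₀(V). The case V = ∅ gives injectivity
of C(X) → O(X, α, L); the general case gives ⟨C₀(V)⟩ ∩ C(X) = C₀(V), hence surjectivity of Φ.
Conversely, I ∩ C(X) is a closed ideal of C(X), hence some C₀(V). Conjugating functions by creation
operators supported where σ is injective shows that V is invariant; the input is that there f g^*
and the product of the creation by f with the annihilation by g agree modulo redundancies
(`fn_sub_vec_mul_star_vec_mem`).

Injectivity of Φ is a gauge-invariant uniqueness theorem, proved for preimages in the Toeplitz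
algebra (`le_of_fn_mem_imp`). Averaging against characters of the circle gives spectral components:
those of an element of a gauge-invariant closed ideal I stay in I, and x lies in a closed ideal J as
soon as all its components do. Since y^* y ∈ J implies y ∈ J, only elements fixed by the gauge
action matter, and these form the core, the closed span of the balanced products.

On the core the kernel of the orbit representation separates I from J. If I ∩ C(X) ⊆ C₀(V), the core
elements of I act as zero, because modulo redundancies an element of the core is locally a function
(`orbitHom_eq_zero_of_mem_gaugeCore`). If C₀(V) ⊆ J, the core elements acting as zero lie in J, by
induction on the number of creations (`mem_of_mem_gaugeCore_of_orbitHom_eq_zero`). With J = ⟨C₀(V)⟩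
this yields I ⊆ ⟨C₀(V)⟩. -/

noncomputable section

namespace PartialCrossedProduct

open TopologicalSpace Set

/-! ### Ideals and functional calculus in C⋆-algebras. -/

section CStar

variable {A : Type*} [CStarAlgebra A]

/-- With `a = star y * y`, the elements `F = ε⁴ / (ε⁴ + a²)` and `G = a / (ε⁴ + a²)` satisfy `F + a
G = 1`. So `y` differs from `y a G ∈ J` by `y F`, whose squared norm is that of `F a F`. Only the
algebraic ideal property of `J` enters; neither its self-adjointness nor a quotient C⋆-algebra is
needed. -/
theorem exists_norm_sub_le_of_star_mul_self_mem (J : TwoSidedIdeal A) {y : A}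
    (h : star y * y ∈ J) {ε : ℝ} (hε : 0 < ε) : ∃ j ∈ J, ‖y - j‖ ≤ ε := by
  set a := star y * y with ha
  have hsa : IsSelfAdjoint a := IsSelfAdjoint.star_mul_self y
  have hne : ∀ t : ℝ, (ε ^ 2) ^ 2 + t ^ 2 ≠ 0 := fun t => by positivity
  have hc1 : Continuous fun t : ℝ => t / ((ε ^ 2) ^ 2 + t ^ 2) := by
    fun_prop (disch := exact hne _)
  have hc2 : Continuous fun t : ℝ => (ε ^ 2) ^ 2 / ((ε ^ 2) ^ 2 + t ^ 2) := by
    fun_prop (disch := exact hne _)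
  set G := cfc (fun t : ℝ => t / ((ε ^ 2) ^ 2 + t ^ 2)) a with hG
  set F := cfc (fun t : ℝ => (ε ^ 2) ^ 2 / ((ε ^ 2) ^ 2 + t ^ 2)) a with hF
  have h1 : F + a * G = 1 := by
    have haG : a * G = cfc (fun t : ℝ => t * (t / ((ε ^ 2) ^ 2 + t ^ 2))) a := by
      rw [cfc_mul (fun t : ℝ => t) _ a (by fun_prop) hc1.continuousOn, cfc_id' ℝ a]
    have hc3 : Continuous fun t : ℝ => t * (t / ((ε ^ 2) ^ 2 + t ^ 2)) := continuous_id'.mul hc1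
    rw [haG, hF, ← cfc_add a _ _ hc2.continuousOn hc3.continuousOn,
      ← cfc_one ℝ a]
    refine cfc_congr fun t _ => ?_
    have := hne t
    simp only [Pi.one_apply]
    field_simp
  have hFsa : IsSelfAdjoint F := cfc_predicate _ a
  have h2 : ‖star (y * F) * (y * F)‖ ≤ ε ^ 2 := by
    have h3 : star (y * F) * (y * F) = F * a * F := by
      rw [star_mul, hFsa.star_eq, ha]
      simp only [mul_assoc]
    have h4 : F * a * F = cfc (fun t : ℝ => (ε ^ 2) ^ 2 / ((ε ^ 2) ^ 2 + t ^ 2) * t *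
        ((ε ^ 2) ^ 2 / ((ε ^ 2) ^ 2 + t ^ 2))) a := by
      rw [cfc_mul _ _ a (by fun_prop) hc2.continuousOn,
        cfc_mul _ _ a hc2.continuousOn (by fun_prop), cfc_id' ℝ a]
    rw [h3, h4]
    refine norm_cfc_le (by positivity) fun t _ => ?_
    have hp : 0 < (ε ^ 2) ^ 2 + t ^ 2 := by positivity
    have h5 : (ε ^ 2) ^ 2 / ((ε ^ 2) ^ 2 + t ^ 2) ≤ 1 := by
      rw [div_le_one hp]
      nlinarith [sq_nonneg t]
    -- The parameter ε⁴ is chosen for this bound, which is ε² |t| ≤ ε⁴ + t² multiplied by ε².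
    have h6 : (ε ^ 2) ^ 2 / ((ε ^ 2) ^ 2 + t ^ 2) * |t| ≤ ε ^ 2 := by
      rw [div_mul_eq_mul_div, div_le_iff₀ hp]
      have : (ε ^ 2) * |t| ≤ (ε ^ 2) ^ 2 + t ^ 2 := by
        rw [← sq_abs t]
        nlinarith [sq_nonneg (ε ^ 2 - |t|), sq_nonneg (ε ^ 2), sq_nonneg |t|]
      nlinarith [sq_nonneg ε]
    rw [norm_mul, norm_mul, Real.norm_eq_abs, Real.norm_eq_abs, abs_of_nonneg (by positivity)]
    exact (mul_le_mul h6 h5 (by positivity) (by positivity)).trans_eq (mul_one _)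
  refine ⟨y * (a * G), J.mul_mem_left _ _ (J.mul_mem_right _ _ h), ?_⟩
  have h3 : y - y * (a * G) = y * F := by
    rw [eq_sub_of_add_eq h1, mul_sub, mul_one]
  rw [h3]
  rw [CStarRing.norm_star_mul_self, ← sq] at h2
  exact (sq_le_sq₀ (norm_nonneg _) hε.le).mp h2

theorem mem_of_forall_exists_norm_sub_le {J : TwoSidedIdeal A} (hJ : IsClosed (J : Set A)) {y : A}
    (h : ∀ ε > 0, ∃ j ∈ J, ‖y - j‖ ≤ ε) : y ∈ J := by
  have : y ∈ closure (J : Set A) := by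
    rw [Metric.mem_closure_iff]
    intro ε hε
    obtain ⟨j, hj, hle⟩ := h (ε / 2) (by positivity)
    exact ⟨j, hj, by rw [dist_eq_norm]; linarith⟩
  rwa [hJ.closure_eq] at this

/-- This replaces a spectral component, which is only homogeneous for the gauge action, by the
gauge-invariant element `star y * y`. -/
theorem mem_of_star_mul_self_mem {J : TwoSidedIdeal A} (hJ : IsClosed (J : Set A)) {y : A}
    (h : star y * y ∈ J) : y ∈ J :=
  mem_of_forall_exists_norm_sub_le hJ fun _ hε => exists_norm_sub_le_of_star_mul_self_mem J h hε

/-- If a homomorphism is injective modulo `J` on the closed subalgebra `C`, then self-adjoint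
elements of `C` with small image are close to `J`. -/
theorem exists_norm_sub_le_of_norm_map_le {B : Type*} [CStarAlgebra B] (ρ : A →⋆ₐ[ℂ] B)
    (C : StarSubalgebra ℂ A) (hC : IsClosed (C : Set A)) (J : TwoSidedIdeal A)
    (hker : ∀ b ∈ C, ρ b = 0 → b ∈ J) {b : A} (hb : b ∈ C) (hsa : IsSelfAdjoint b) {ε : ℝ}
    (hε : 0 ≤ ε) (hle : ‖ρ b‖ ≤ ε) : ∃ j ∈ J, ‖b - j‖ ≤ ε := by
  -- Split `b` by clamping to [-ε, ε]. The excess is killed by `ρ`, because the spectrum of `ρ b`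
  -- lies in that interval, and so it belongs to `J`; the clamped part has norm at most `ε`.
  have hcont : Continuous fun t : ℝ => max (-ε) (min ε t) := by fun_prop
  have hρ : Continuous ρ := AddMonoidHomClass.continuous_of_bound ρ 1 fun x => by
    rw [one_mul]; exact NonUnitalStarAlgHom.norm_apply_le ρ x
  refine ⟨cfc (fun t : ℝ => t - max (-ε) (min ε t)) b, hker _ ?_ ?_, ?_⟩
  · exact cfc_mem (hs := hC) _ hb
  · have hsa' : IsSelfAdjoint (ρ b) := hsa.map ρ
    have := StarAlgHomClass.map_cfc (R := ℝ) (S := ℂ) ρ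
      (fun t : ℝ => t - max (-ε) (min ε t)) b (by fun_prop) hρ hsa hsa'
    rw [this, ← cfc_zero ℝ (ρ b)]
    refine cfc_congr fun t ht => ?_
    have h1 : |t| ≤ ε := by
      rw [← Real.norm_eq_abs]
      rcases subsingleton_or_nontrivial B with h | h
      · rw [spectrum.of_subsingleton] at ht
        exact ht.elim
      · exact (spectrum.norm_le_norm_of_mem ht).trans hle
    rw [abs_le] at h1
    simp [min_eq_right h1.2, max_eq_right h1.1]
  · have h1 : b - cfc (fun t : ℝ => t - max (-ε) (min ε t)) b =
        cfc (fun t : ℝ => max (-ε) (min ε t)) b := by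
      rw [cfc_sub (fun t : ℝ => t) _ b (by fun_prop) hcont.continuousOn, cfc_id' ℝ b]
      abel
    rw [h1]
    refine norm_cfc_le hε fun t _ => ?_
    rw [Real.norm_eq_abs, abs_le]
    exact ⟨le_max_left _ _, max_le (by linarith) (min_le_left _ _)⟩

end CStar

variable {X : Type u} [TopologicalSpace X] [CompactSpace X] [T2Space X]
  {S : PartialLocalHomeo X}

/-! ### The universal property and the relations of the Toeplitz algebra. -/

namespace ToeplitzRep

open UniformSpace

variable {B : Type u} [CStarAlgebra B] (ρ : ToeplitzRep S B)

lemma continuous_eval : Continuous ρ.eval :=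
  AddMonoidHomClass.continuous_of_bound ρ.eval 1 fun x => by
    rw [one_mul]; exact FreeToeplitz.norm_eval_le ρ x

/-- The representation of the Toeplitz algebra given by its universal property. -/
def toHom : Toeplitz S →⋆ₐ[ℂ] B where
  __ := Completion.extensionHom (ρ.eval : FreeToeplitz S →+* B) ρ.continuous_eval
  commutes' c := by
    have h := Completion.extensionHom_coe (ρ.eval : FreeToeplitz S →+* B) ρ.continuous_eval
      (algebraMap ℂ _ c)
    exact h.trans (ρ.eval.commutes c)
  map_star' x := by
    refine Completion.induction_on x (isClosed_eq
      (Completion.continuous_extension.comp Toeplitz.continuous_star)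
      (Completion.continuous_extension.star)) fun x => ?_
    have h := fun x => Completion.extensionHom_coe (ρ.eval : FreeToeplitz S →+* B)
      ρ.continuous_eval x
    rw [← Toeplitz.coe_star]
    exact (h (star x)).trans ((ρ.eval_star x).trans (congrArg star (h x).symm))

lemma toHom_coe (x : FreeToeplitz S) : ρ.toHom (x : Toeplitz S) = ρ.eval x :=
  Completion.extensionHom_coe (ρ.eval : FreeToeplitz S →+* B) ρ.continuous_eval x

@[simp] lemma toHom_fn (a : C(X, ℂ)) : ρ.toHom (Toeplitz.fn S a) = ρ.fn a := by
  rw [Toeplitz.fn, toHom_coe]; simp [eval]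

@[simp] lemma toHom_vec (m : HilbMod S) : ρ.toHom (Toeplitz.vec m) = ρ.vec m := by
  rw [Toeplitz.vec, toHom_coe]; simp [eval]

end ToeplitzRep

namespace Toeplitz

open UniformSpace

/-- An element of the free algebra that vanishes in every representation has universal seminorm
zero. Each relation between generators is therefore checked in an arbitrary `ρ`; the same scheme
serves the relations that follow. -/
lemma fn_add (a b : C(X, ℂ)) : fn S (a + b) = fn S a + fn S b := by
  rw [fn, fn, fn, ← Completion.coe_add]
  exact coe_eq_coe fun B _ ρ => by simp [ToeplitzRep.eval]

lemma fn_mul (a b : C(X, ℂ)) : fn S (a * b) = fn S a * fn S b := by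
  rw [fn, fn, fn, ← Completion.coe_mul]
  exact coe_eq_coe fun B _ ρ => by simp [ToeplitzRep.eval]

lemma fn_algebraMap (c : ℂ) : fn S (algebraMap ℂ _ c) = algebraMap ℂ _ c := by
  rw [fn]
  refine (coe_eq_coe (y := algebraMap ℂ _ c) fun B _ ρ => ?_)
  simp only [ToeplitzRep.eval, FreeToeplitz.lift_ι, AlgHomClass.commutes]

lemma fn_star (a : C(X, ℂ)) : fn S (star a) = star (fn S a) := by
  rw [fn, fn, ← coe_star]
  exact coe_eq_coe fun B _ ρ => by rw [ρ.eval_star]; simp [ToeplitzRep.eval, map_star]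

variable (S) in
/-- The map `C(X) → T(X, α, L)` as a homomorphism. -/
def fnHom : C(X, ℂ) →⋆ₐ[ℂ] Toeplitz S where
  toFun := fn S
  map_one' := by rw [← map_one (algebraMap ℂ C(X, ℂ)), fn_algebraMap, map_one]
  map_mul' := fn_mul
  map_zero' := by rw [← map_zero (algebraMap ℂ C(X, ℂ)), fn_algebraMap, map_zero]
  map_add' := fn_add
  commutes' := fn_algebraMap
  map_star' := fn_star

lemma norm_fn_le (a : C(X, ℂ)) : ‖fn S a‖ ≤ ‖a‖ :=
  NonUnitalStarAlgHom.norm_apply_le (fnHom S) a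

lemma fn_one : fn S (1 : C(X, ℂ)) = 1 := map_one (fnHom S)

lemma fn_zero : fn S (0 : C(X, ℂ)) = 0 := map_zero (fnHom S)

lemma fn_sub (a b : C(X, ℂ)) : fn S (a - b) = fn S a - fn S b := map_sub (fnHom S) a b

lemma continuous_fn : Continuous (fn S) :=
  AddMonoidHomClass.continuous_of_bound (fnHom S) 1 fun a => by rw [one_mul]; exact norm_fn_le a

lemma vec_add (m n : HilbMod S) : vec (m + n) = vec m + vec n := by
  rw [vec, vec, vec, ← Completion.coe_add]
  exact coe_eq_coe fun B _ ρ => by simp [ToeplitzRep.eval]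

lemma vec_smul (c : ℂ) (m : HilbMod S) : vec (c • m) = c • vec m := by
  rw [vec, vec, ← Completion.coe_smul]
  exact coe_eq_coe fun B _ ρ => by simp [ToeplitzRep.eval]

lemma norm_vec_le (m : HilbMod S) : ‖vec m‖ ≤ ‖m‖ := by
  rw [vec, Completion.norm_coe]
  exact FreeToeplitz.norm_le (norm_nonneg m) fun B _ ρ => by
    simpa [ToeplitzRep.eval] using ρ.norm_vec_le m

variable (S) in
/-- The map `M → T(X, α, L)` as a bounded linear map. -/
def vecL : HilbMod S →L[ℂ] Toeplitz S :=
  LinearMap.mkContinuous { toFun := vec, map_add' := vec_add, map_smul' := vec_smul } 1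
    fun m => by rw [one_mul]; exact norm_vec_le m

lemma continuous_vec : Continuous (vec : HilbMod S → Toeplitz S) := (vecL S).continuous

lemma fn_mul_vec (a : C(X, ℂ)) (m : HilbMod S) : fn S a * vec m = vec (a • m) := by
  rw [fn, vec, vec, ← Completion.coe_mul]
  exact coe_eq_coe fun B _ ρ => by simp [ToeplitzRep.eval, ρ.fn_mul_vec]

open scoped RightActions in
lemma vec_mul_fn (m : HilbMod S) (a : C(X, ℂ)) : vec m * fn S a = vec (m <• a) := by
  rw [fn, vec, vec, ← Completion.coe_mul]
  exact coe_eq_coe fun B _ ρ => by simp [ToeplitzRep.eval, ρ.vec_mul_fn]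

lemma star_vec_mul_vec (m n : HilbMod S) :
    star (vec m) * vec n = fn S (inner C(X, ℂ) m n) := by
  rw [fn, vec, vec, ← coe_star, ← Completion.coe_mul]
  exact coe_eq_coe fun B _ ρ => by
    rw [map_mul, ρ.eval_star]; simp [ToeplitzRep.eval, ρ.star_vec_mul_vec]

lemma gauge_star (z : Circle) (x : Toeplitz S) : gauge S z (star x) = star (gauge S z x) := by
  refine Completion.induction_on x (isClosed_eq ((continuous_gauge z).comp continuous_star)
    (continuous_star.comp (continuous_gauge z))) fun x => ?_
  refine FreeToeplitz.induction (p := fun x => gauge S z (star (x : Toeplitz S)) =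
    star (gauge S z (x : Toeplitz S))) ?_ ?_ ?_ ?_ x
  · intro c
    rw [← coe_star, FreeToeplitz.star_algebraMap, gauge_coe, gauge_coe, AlgHom.commutes,
      AlgHom.commutes, ← coe_star, FreeToeplitz.star_algebraMap]
  · rintro (a | m | m)
    · change gauge S z (star (fn S a)) = star (gauge S z (fn S a))
      rw [← fn_star, gauge_fn, gauge_fn, fn_star]
    · change gauge S z (star (vec m)) = star (gauge S z (vec m))
      rw [gauge_star_vec, gauge_vec, star_smul]
    · have h : ((FreeToeplitz.ι (.adj m) : FreeToeplitz S) : Toeplitz S) = star (vec m) := by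
        rw [vec, ← coe_star, FreeToeplitz.star_ι]; rfl
      rw [h, gauge_star_vec, star_star, gauge_vec, star_smul, star_star, star_star]
  · intro x y hx hy
    rw [Completion.coe_mul, star_mul, map_mul, map_mul, star_mul, hx, hy]
  · intro x y hx hy
    rw [Completion.coe_add, star_add, map_add, map_add, star_add, hx, hy]

lemma norm_gauge_le (z : Circle) (x : Toeplitz S) : ‖gauge S z x‖ ≤ ‖x‖ := by
  refine Completion.induction_on x (isClosed_le (continuous_gauge z).norm continuous_norm)
    fun x => ?_
  rw [gauge_coe, Completion.norm_coe, Completion.norm_coe]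
  exact FreeToeplitz.norm_rotate_le z x

end Toeplitz

end PartialCrossedProduct

end

/-! ### The orbit representations on ℓ²(X \ V). -/

noncomputable section

namespace PartialCrossedProduct

open TopologicalSpace Set
open scoped RightActions

set_option linter.unusedSectionVars false

variable {X : Type u} [TopologicalSpace X] [CompactSpace X] [T2Space X]
  {S : PartialLocalHomeo X}

/-- The Hilbert space `ℓ²(X \ V)`. -/
abbrev OrbitSpace (V : Set X) : Type u := lp (fun _ : {x // x ∉ V} => ℂ) 2

namespace OrbitSpace

variable {V : Set X}

/-- A bounded operator on `ℓ²(X \ V)` from a formula for the coordinates. -/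
def mkOp (T : OrbitSpace V →ₗ[ℂ] ({x // x ∉ V} → ℂ)) (C : ℝ) (hC : 0 ≤ C)
    (hT : ∀ ξ (s : Finset {x // x ∉ V}), ∑ y ∈ s, ‖T ξ y‖ ^ 2 ≤ (C * ‖ξ‖) ^ 2) :
    OrbitSpace V →L[ℂ] OrbitSpace V :=
  LinearMap.mkContinuous
    { toFun := fun ξ => ⟨T ξ, memℓp_gen' fun s => by simpa using hT ξ s⟩
      map_add' := fun ξ η => Subtype.ext (map_add T ξ η)
      map_smul' := fun c ξ => Subtype.ext (map_smul T c ξ) }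
    C fun ξ => by
      refine lp.norm_le_of_forall_sum_le (by simp) (by positivity) fun s => ?_
      simpa using hT ξ s

lemma norm_mkOp_le (T : OrbitSpace V →ₗ[ℂ] ({x // x ∉ V} → ℂ)) (C : ℝ) (hC : 0 ≤ C)
    (hT : ∀ ξ (s : Finset {x // x ∉ V}), ∑ y ∈ s, ‖T ξ y‖ ^ 2 ≤ (C * ‖ξ‖) ^ 2) :
    ‖mkOp T C hC hT‖ ≤ C := LinearMap.mkContinuous_norm_le _ hC _

lemma sum_sq_le (ξ : OrbitSpace V) (s : Finset {x // x ∉ V}) :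
    ∑ y ∈ s, ‖ξ y‖ ^ 2 ≤ ‖ξ‖ ^ 2 := by
  simpa using lp.sum_rpow_le_norm_rpow (p := 2) (by simp) ξ s

open Classical in
/-- The basis vector `δ_x`. -/
def δ (x : {x // x ∉ V}) : OrbitSpace V := lp.single 2 x 1

open Classical in
lemma δ_apply (x y : {x // x ∉ V}) : δ x y = if y = x then 1 else 0 := by
  rw [δ, lp.single_apply, Pi.single_apply]

@[simp] lemma δ_apply_self (x : {x // x ∉ V}) : δ x x = 1 := by simp [δ_apply]

lemma δ_apply_ne {x y : {x // x ∉ V}} (h : y ≠ x) : δ x y = 0 := by simp [δ_apply, h]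

lemma inner_δ_left (x : {x // x ∉ V}) (ξ : OrbitSpace V) : inner ℂ (δ x) ξ = ξ x := by
  classical
  rw [δ, lp.inner_single_left]
  simp

@[simp] lemma norm_δ (x : {x // x ∉ V}) : ‖δ x‖ = 1 := by
  have h : inner ℂ (δ x) (δ x) = (1 : ℂ) := by rw [inner_δ_left, δ_apply_self]
  rw [inner_self_eq_norm_sq_to_K] at h
  have h2 : ‖δ x‖ ^ 2 = 1 := by
    have h3 : ((‖δ x‖ ^ 2 : ℝ) : ℂ) = (1 : ℝ) := by
      rw [Complex.ofReal_pow, Complex.ofReal_one]; exact h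
    exact Complex.ofReal_injective h3
  nlinarith [norm_nonneg (δ x)]

lemma ext_δ {D E : OrbitSpace V →L[ℂ] OrbitSpace V} (h : ∀ x, D (δ x) = E (δ x)) : D = E := by
  classical
  refine lp.ext_continuousLinearMap (by simp) fun x => ?_
  ext1
  simpa [δ] using h x

lemma norm_apply_le (ξ : OrbitSpace V) (x : {x // x ∉ V}) : ‖ξ x‖ ≤ ‖ξ‖ :=
  lp.norm_apply_le_norm (by simp) ξ x

/-- Multiplication by a bounded function. -/
def mulOp (V : Set X) (a : C(X, ℂ)) : OrbitSpace V →L[ℂ] OrbitSpace V :=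
  mkOp { toFun := fun ξ y => a y * ξ y
         map_add' := fun ξ η => by ext y; simp [mul_add]
         map_smul' := fun c ξ => by ext y; simp; ring } ‖a‖ (norm_nonneg a) fun ξ s => by
    refine le_trans ?_ ((mul_le_mul_of_nonneg_left (sum_sq_le ξ s) (sq_nonneg ‖a‖)).trans_eq
      (mul_pow _ _ _).symm)
    rw [Finset.mul_sum]
    refine Finset.sum_le_sum fun y _ => ?_
    simp only [LinearMap.coe_mk, AddHom.coe_mk, norm_mul, mul_pow]
    have := ContinuousMap.norm_coe_le_norm a (y : X)
    gcongr

@[simp] lemma mulOp_apply (a : C(X, ℂ)) (ξ : OrbitSpace V) (y : {x // x ∉ V}) :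
    mulOp V a ξ y = a y * ξ y := rfl

/-- The diagonal representation of `C(X)` on `ℓ²(X \ V)`. -/
def mulHom (V : Set X) : C(X, ℂ) →⋆ₐ[ℂ] (OrbitSpace V →L[ℂ] OrbitSpace V) where
  toFun := mulOp V
  map_one' := by ext; simp
  map_mul' a b := by ext; simp [mul_assoc]
  map_zero' := by ext; simp
  map_add' a b := by ext; simp [add_mul]
  commutes' c := by ext; simp [Algebra.algebraMap_eq_smul_one]
  map_star' a := by
    rw [ContinuousLinearMap.star_eq_adjoint, ContinuousLinearMap.eq_adjoint_iff]
    intro ξ η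
    rw [lp.inner_eq_tsum, lp.inner_eq_tsum]
    refine tsum_congr fun y => ?_
    simp
    ring

@[simp] lemma mulHom_apply (a : C(X, ℂ)) : mulHom V a = mulOp V a := rfl

open Classical in
/-- Extension of `ξ ∈ ℓ²(X \ V)` by `0` to `X`. -/
def zeroExt (ξ : OrbitSpace V) (x : X) : ℂ := if h : x ∉ V then ξ ⟨x, h⟩ else 0

lemma zeroExt_of_notMem (ξ : OrbitSpace V) {x : X} (h : x ∉ V) : zeroExt ξ x = ξ ⟨x, h⟩ :=
  dif_pos h

lemma zeroExt_of_mem (ξ : OrbitSpace V) {x : X} (h : x ∈ V) : zeroExt ξ x = 0 :=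
  dif_neg (not_not.mpr h)

lemma sum_zeroExt_sq_le (ξ : OrbitSpace V) (t : Finset X) :
    ∑ x ∈ t, ‖zeroExt ξ x‖ ^ 2 ≤ ‖ξ‖ ^ 2 := by
  classical
  refine le_trans ?_ (sum_sq_le ξ (t.subtype (· ∉ V)))
  rw [← Finset.sum_filter_add_sum_filter_not t (· ∉ V)]
  have h1 : ∑ x ∈ t with ¬ x ∉ V, ‖zeroExt ξ x‖ ^ 2 = 0 :=
    Finset.sum_eq_zero fun x hx => by
      rw [zeroExt_of_mem ξ (not_not.mp (Finset.mem_filter.mp hx).2)]; simp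
  rw [h1, add_zero, ← Finset.sum_subtype_eq_sum_filter]
  refine le_of_eq (Finset.sum_congr rfl fun x _ => ?_)
  rw [zeroExt_of_notMem ξ x.2]

open Classical in
/-- The function `f · (ξ ∘ σ)` on `X`, zero outside `U`. -/
def shiftFun (f : PreMod S) (ξ : OrbitSpace V) (y : X) : ℂ :=
  if h : y ∈ S.U then f y * zeroExt ξ (S.σ ⟨y, h⟩) else 0

lemma shiftFun_mem (f : PreMod S) (ξ : OrbitSpace V) (y : S.U) :
    shiftFun f ξ y = f y * zeroExt ξ (S.σ y) := dif_pos y.2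

lemma shiftFun_notMem (f : PreMod S) (ξ : OrbitSpace V) {y : X} (hy : y ∉ S.U) :
    shiftFun f ξ y = 0 := dif_neg hy

lemma sum_fiber_sq_le (f : PreMod S) (x : X) (t : Finset S.U) (ht : ∀ u ∈ t, S.σ u = x) :
    ∑ u ∈ t, ‖f u‖ ^ 2 ≤ ‖f‖ ^ 2 := by
  classical
  have h1 : (inner C(X, ℂ) f f x).re ≤ ‖f‖ ^ 2 := by
    rw [PreMod.norm_def, Real.sq_sqrt (norm_nonneg _), ← PreMod.norm_inner_self_apply]
    exact ContinuousMap.norm_coe_le_norm _ x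
  refine le_trans ?_ h1
  have key : ∀ z : ℂ, (star z * z).re = ‖z‖ ^ 2 := fun z => by
    rw [Complex.star_def, ← Complex.normSq_eq_conj_mul_self, Complex.ofReal_re,
      Complex.normSq_eq_norm_sq]
  rw [PreMod.inner_eq_sum_left, Complex.re_sum]
  simp only [key]
  rw [← Finset.sum_filter_add_sum_filter_not t (fun u : S.U => f (u : X) ≠ 0)]
  have h2 : ∑ u ∈ t.filter fun u : S.U => ¬ f (u : X) ≠ 0, ‖f (u : X)‖ ^ 2 = 0 :=
    Finset.sum_eq_zero fun u hu => by
      rw [not_not.mp (Finset.mem_filter.mp hu).2]; simp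
  rw [h2, add_zero]
  refine Finset.sum_le_sum_of_subset_of_nonneg (fun u hu => ?_) fun _ _ _ => by positivity
  rw [Finset.mem_filter] at hu
  exact (Set.Finite.mem_toFinset _).mpr ⟨ht u hu.1, f.support_subset u hu.2⟩

/-- Grouping the points by their image under σ bounds the sum by ‖f‖² ∑ |ξ(x)|², since each fibre
contributes at most L(f^* f)(x) ≤ ‖f‖². As ξ is extended by zero, the operator is bounded for every
`V`; invariance enters only in the relation for adjoints. -/
lemma sum_shiftFun_sq_le (f : PreMod S) (ξ : OrbitSpace V) (s : Finset {x // x ∉ V}) :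
    ∑ y ∈ s, ‖shiftFun f ξ y‖ ^ 2 ≤ (‖f‖ * ‖ξ‖) ^ 2 := by
  classical
  let t : Finset S.U := (s.map (Function.Embedding.subtype _)).subtype (· ∈ S.U)
  have h1 : ∑ y ∈ s, ‖shiftFun f ξ y‖ ^ 2 = ∑ u ∈ t, ‖shiftFun f ξ u‖ ^ 2 := by
    have h2 : ∑ y ∈ s, ‖shiftFun f ξ y‖ ^ 2 =
        ∑ y ∈ s.map (Function.Embedding.subtype _), ‖shiftFun f ξ y‖ ^ 2 := by
      rw [Finset.sum_map]; rfl
    rw [h2, ← Finset.sum_filter_add_sum_filter_not _ (· ∈ S.U),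
      ← Finset.sum_subtype_eq_sum_filter, Finset.sum_eq_zero (s := Finset.filter _ _), add_zero]
    intro y hy
    rw [shiftFun_notMem f ξ (Finset.mem_filter.mp hy).2]
    simp
  rw [h1, ← Finset.sum_fiberwise_of_maps_to (g := S.σ) (t := t.image S.σ)
    fun u hu => Finset.mem_image_of_mem _ hu]
  rw [mul_pow]
  refine le_trans ?_ (mul_le_mul_of_nonneg_left (sum_zeroExt_sq_le ξ (t.image S.σ))
    (sq_nonneg ‖f‖))
  rw [Finset.mul_sum]
  refine Finset.sum_le_sum fun x _ => ?_
  refine le_trans (le_of_eq ?_) (mul_le_mul_of_nonneg_right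
    (sum_fiber_sq_le f x {u ∈ t | S.σ u = x} fun u hu => (Finset.mem_filter.mp hu).2)
    (sq_nonneg ‖zeroExt ξ x‖))
  rw [Finset.sum_mul]
  refine Finset.sum_congr rfl fun u hu => ?_
  rw [shiftFun_mem, norm_mul, mul_pow, (Finset.mem_filter.mp hu).2]

lemma zeroExt_add (ξ η : OrbitSpace V) (x : X) :
    zeroExt (ξ + η) x = zeroExt ξ x + zeroExt η x := by
  unfold zeroExt; split_ifs <;> simp

lemma zeroExt_smul (c : ℂ) (ξ : OrbitSpace V) (x : X) :
    zeroExt (c • ξ) x = c * zeroExt ξ x := by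
  unfold zeroExt; split_ifs <;> simp

variable (V) in
/-- The operator `ξ ↦ f · (ξ ∘ σ)` on `ℓ²(X \ V)`. -/
def shiftOp (f : PreMod S) : OrbitSpace V →L[ℂ] OrbitSpace V :=
  mkOp { toFun := fun ξ y => shiftFun f ξ y
         map_add' := fun ξ η => by
          ext y
          by_cases hy : (y : X) ∈ S.U
          · have h := fun ζ => shiftFun_mem (V := V) f ζ ⟨y, hy⟩
            simp only at h
            simp only [Pi.add_apply, h, zeroExt_add, mul_add]
          · simp [shiftFun_notMem _ _ hy]
         map_smul' := fun c ξ => by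
          ext y
          by_cases hy : (y : X) ∈ S.U
          · have h := fun ζ => shiftFun_mem (V := V) f ζ ⟨y, hy⟩
            simp only at h
            simp only [Pi.smul_apply, h, zeroExt_smul, RingHom.id_apply, smul_eq_mul]
            ring
          · simp [shiftFun_notMem _ _ hy] } ‖f‖ (norm_nonneg f) (sum_shiftFun_sq_le f)

lemma norm_shiftOp_le (f : PreMod S) : ‖shiftOp V f‖ ≤ ‖f‖ := norm_mkOp_le _ _ _ _

lemma shiftOp_apply_mem (f : PreMod S) (ξ : OrbitSpace V) (y : S.U) (hy : (y : X) ∉ V) :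
    shiftOp V f ξ ⟨y, hy⟩ = f y * zeroExt ξ (S.σ y) := shiftFun_mem f ξ y

lemma shiftOp_apply_notMem (f : PreMod S) (ξ : OrbitSpace V) (y : {x // x ∉ V})
    (hy : (y : X) ∉ S.U) : shiftOp V f ξ y = 0 := shiftFun_notMem f ξ hy

lemma zeroExt_δ_self (x : {x // x ∉ V}) : zeroExt (δ x) x = 1 := by
  rw [zeroExt_of_notMem _ x.2]; simp

lemma zeroExt_δ_ne {x : {x // x ∉ V}} {z : X} (h : z ≠ x) : zeroExt (δ x) z = 0 := by
  by_cases hz : z ∈ V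
  · exact zeroExt_of_mem _ hz
  · rw [zeroExt_of_notMem _ hz, δ_apply_ne]
    exact fun h' => h (congrArg Subtype.val h')

/-- An equality of two coordinates for `ξ` supported on `U`. -/
lemma ext_mem {ξ η : OrbitSpace V} (h : ∀ (y : S.U) (hy : (y : X) ∉ V), ξ ⟨y, hy⟩ = η ⟨y, hy⟩)
    (h' : ∀ y : {x // x ∉ V}, (y : X) ∉ S.U → ξ y = η y) : ξ = η := by
  ext y
  by_cases hy : (y : X) ∈ S.U
  · exact h ⟨y, hy⟩ y.2
  · exact h' y hy

variable (V) in
/-- `f ↦ (ξ ↦ f · (ξ ∘ σ))` as a bounded linear map. -/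
def shiftL (S : PartialLocalHomeo X) :
    PreMod S →L[ℂ] (OrbitSpace V →L[ℂ] OrbitSpace V) :=
  LinearMap.mkContinuous
    { toFun := shiftOp V
      map_add' := fun f g => by
        ext1 ξ
        refine ext_mem (S := S) (fun y hy => ?_) fun y hy => ?_
        · simp [shiftOp_apply_mem, PreMod.add_apply, add_mul]
        · simp [shiftOp_apply_notMem _ _ _ hy]
      map_smul' := fun c f => by
        ext1 ξ
        refine ext_mem (S := S) (fun y hy => ?_) fun y hy => ?_
        · simp [shiftOp_apply_mem, PreMod.smul_apply, mul_assoc]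
        · simp [shiftOp_apply_notMem _ _ _ hy] }
    1 fun f => by rw [one_mul]; exact norm_shiftOp_le f

lemma mulOp_comp_shiftOp (a : C(X, ℂ)) (f : PreMod S) :
    mulOp V a * shiftOp V f = shiftOp V (a • f) := by
  ext1 ξ
  refine ext_mem (S := S) (fun y hy => ?_) fun y hy => ?_
  · simp [shiftOp_apply_mem, PreMod.lsmul_apply, mul_assoc]
  · simp [shiftOp_apply_notMem _ _ _ hy]

lemma zeroExt_mulOp (a : C(X, ℂ)) (ξ : OrbitSpace V) (x : X) :
    zeroExt (mulOp V a ξ) x = a x * zeroExt ξ x := by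
  unfold zeroExt; split_ifs <;> simp

lemma shiftOp_comp_mulOp (a : C(X, ℂ)) (f : PreMod S) :
    shiftOp V f * mulOp V a = shiftOp V (f <• a) := by
  ext1 ξ
  refine ext_mem (S := S) (fun y hy => ?_) fun y hy => ?_
  · simp [shiftOp_apply_mem, PreMod.rsmul_apply, zeroExt_mulOp, mul_assoc]
  · simp [shiftOp_apply_notMem _ _ _ hy]

/-- Both vectors are supported on the fibre over `x`, where they are the values of `f` and `g`, so
their pairing is the fibre sum L(f^* g)(x). Forward invariance guarantees that no term of this sum
is lost in passing to X \ V: a point of the fibre in `V` would force `x ∈ V`. -/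
lemma inner_shiftOp_δ (hV : IsInvariant S V) (f g : PreMod S) (x : {x // x ∉ V}) :
    inner ℂ (shiftOp V f (δ x)) (shiftOp V g (δ x)) = inner C(X, ℂ) f g x := by
  classical
  rw [lp.inner_eq_tsum, PreMod.inner_eq_sum_left]
  set F := (finite_fiber S (isClosed_tsupport f.1.1) f.2 (x : X)).toFinset with hF
  have hmem : ∀ u ∈ F, (u : X) ∉ V := fun u hu huV =>
    x.2 (((Set.Finite.mem_toFinset _).mp hu).1 ▸ hV.apply_mem u huV)
  let s : Finset {x // x ∉ V} := (F.map (Function.Embedding.subtype _)).subtype (· ∉ V)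
  rw [tsum_eq_sum (s := s)]
  · refine Eq.trans (Finset.sum_subtype_of_mem (p := (· ∉ V)) (s := F.map (Function.Embedding.subtype _))
      (f := fun y => inner ℂ (shiftFun f (δ x) y) (shiftFun g (δ x) y)) ?_) ?_
    rotate_left
    · rw [Finset.sum_map]
      refine Finset.sum_congr rfl fun u hu => ?_
      simp only [Function.Embedding.subtype_apply, shiftFun_mem]
      rw [((Set.Finite.mem_toFinset _).mp hu).1, zeroExt_δ_self]
      simp [mul_comm]
    · intro y hy
      obtain ⟨u, hu, rfl⟩ := Finset.mem_map.mp hy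
      exact hmem u hu
  · intro y hy
    by_cases hyU : (y : X) ∈ S.U
    · have h1 : shiftOp V f (δ x) y = 0 := by
        refine (shiftOp_apply_mem f (δ x) ⟨y, hyU⟩ y.2).trans ?_
        by_contra h
        rw [mul_eq_zero, not_or] at h
        refine hy (Finset.mem_subtype.mpr (Finset.mem_map.mpr ⟨⟨y, hyU⟩, ?_, rfl⟩))
        refine (Set.Finite.mem_toFinset _).mpr ⟨?_, f.support_subset _ h.1⟩
        by_contra h'
        exact h.2 (zeroExt_δ_ne h')
      rw [h1, inner_zero_left]
    · rw [shiftOp_apply_notMem f _ y hyU, inner_zero_left]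

/-- Fibres over distinct points are disjoint. This is why `star (shiftOp V f) * shiftOp V g` is
diagonal. -/
lemma inner_shiftOp_δ_ne (f g : PreMod S) {x z : {x // x ∉ V}} (h : z ≠ x) :
    inner ℂ (shiftOp V f (δ z)) (shiftOp V g (δ x)) = 0 := by
  rw [lp.inner_eq_tsum]
  refine (tsum_congr fun y => ?_).trans tsum_zero
  by_cases hyU : (y : X) ∈ S.U
  · have h1 := shiftOp_apply_mem f (δ z) ⟨y, hyU⟩ y.2
    have h2 := shiftOp_apply_mem g (δ x) ⟨y, hyU⟩ y.2
    by_cases hz : S.σ ⟨y, hyU⟩ = z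
    · have : shiftOp V g (δ x) y = 0 := by
        refine h2.trans ?_
        rw [zeroExt_δ_ne, mul_zero]
        rw [hz]
        exact fun h' => h (Subtype.ext h')
      rw [this, inner_zero_right]
    · have : shiftOp V f (δ z) y = 0 := by
        refine h1.trans ?_
        rw [zeroExt_δ_ne hz, mul_zero]
      rw [this, inner_zero_left]
  · rw [shiftOp_apply_notMem f _ y hyU, inner_zero_left]

lemma star_shiftOp_mul_shiftOp (hV : IsInvariant S V) (f g : PreMod S) :
    star (shiftOp V f) * shiftOp V g = mulOp V (inner C(X, ℂ) f g) := by
  refine ext_δ fun x => ?_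
  ext z
  rw [← inner_δ_left z, ContinuousLinearMap.star_eq_adjoint, mul_apply_eq_comp,
    ContinuousLinearMap.adjoint_inner_right, mulOp_apply]
  by_cases h : z = x
  · subst h
    rw [inner_shiftOp_δ hV, δ_apply_self, mul_one]
  · rw [inner_shiftOp_δ_ne f g h, δ_apply_ne h, mul_zero]

open UniformSpace

variable (V) in
/-- The extension of `shiftL` to the module `M`. -/
def vecL (S : PartialLocalHomeo X) : HilbMod S →L[ℂ] (OrbitSpace V →L[ℂ] OrbitSpace V) :=
  (shiftL V S).extend Completion.toComplL

lemma vecL_coe (f : PreMod S) : vecL V S (f : HilbMod S) = shiftOp V f :=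
  ContinuousLinearMap.extend_eq (e := Completion.toComplL) (shiftL V S)
    Completion.denseRange_coe (Completion.isUniformInducing_coe _) f

/-- The representation of the Toeplitz algebra on `ℓ²(X \ V)` for an invariant set `V`. -/
def orbitRep (hV : IsInvariant S V) : ToeplitzRep S (OrbitSpace V →L[ℂ] OrbitSpace V) where
  fn := mulHom V
  vec := vecL V S
  fn_mul_vec a m := by
    refine Completion.induction_on m (isClosed_eq (continuous_const.mul (vecL V S).continuous)
      ((vecL V S).continuous.comp (continuous_const_smul a))) fun f => ?_
    rw [← Completion.coe_smul]
    exact (congrArg (mulHom V a * ·) (vecL_coe f)).trans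
      ((mulOp_comp_shiftOp a f).trans (vecL_coe _).symm)
  vec_mul_fn m a := by
    refine Completion.induction_on m (isClosed_eq ((vecL V S).continuous.mul continuous_const)
      ((vecL V S).continuous.comp (continuous_const_smul _))) fun f => ?_
    rw [← Completion.coe_smul]
    exact (congrArg (· * mulHom V a) (vecL_coe f)).trans
      ((shiftOp_comp_mulOp a f).trans (vecL_coe _).symm)
  star_vec_mul_vec m n := by
    have hc : Continuous (mulHom V) := AddMonoidHomClass.continuous_of_bound (mulHom V) 1
      fun a => by rw [one_mul]; exact NonUnitalStarAlgHom.norm_apply_le (mulHom V) a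
    refine Completion.induction_on₂ m n (isClosed_eq
      (((vecL V S).continuous.comp continuous_fst).star.mul
        ((vecL V S).continuous.comp continuous_snd))
      (hc.comp HilbMod.continuous_inner)) fun f g => ?_
    rw [HilbMod.inner_coe]
    simpa [vecL_coe] using star_shiftOp_mul_shiftOp hV f g

/-- The homomorphism given by `orbitRep`. -/
def orbitHom (hV : IsInvariant S V) : Toeplitz S →⋆ₐ[ℂ] (OrbitSpace V →L[ℂ] OrbitSpace V) :=
  (orbitRep hV).toHom

lemma orbitHom_fn (hV : IsInvariant S V) (a : C(X, ℂ)) :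
    orbitHom hV (Toeplitz.fn S a) = mulOp V a := (orbitRep hV).toHom_fn a

lemma orbitHom_vec (hV : IsInvariant S V) (f : PreMod S) :
    orbitHom hV (Toeplitz.vec (f : HilbMod S)) = shiftOp V f :=
  ((orbitRep hV).toHom_vec f).trans (vecL_coe f)

lemma norm_orbitHom_le (hV : IsInvariant S V) (x : Toeplitz S) : ‖orbitHom hV x‖ ≤ ‖x‖ :=
  NonUnitalStarAlgHom.norm_apply_le (orbitHom hV) x

lemma continuous_orbitHom (hV : IsInvariant S V) : Continuous (orbitHom hV) :=
  AddMonoidHomClass.continuous_of_bound (orbitHom hV) 1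
    fun x => by rw [one_mul]; exact norm_orbitHom_le hV x

/-- The diagonal matrix coefficient of `x` at `y`. -/
def diag (hV : IsInvariant S V) (x : Toeplitz S) (y : {x // x ∉ V}) : ℂ :=
  orbitHom hV x (δ y) y

lemma norm_diag_le (hV : IsInvariant S V) (x : Toeplitz S) (y : {x // x ∉ V}) :
    ‖diag hV x y‖ ≤ ‖x‖ :=
  (norm_apply_le _ y).trans (((orbitHom hV x).le_opNorm _).trans (by
    rw [norm_δ, mul_one]; exact norm_orbitHom_le hV x))

lemma diag_sub (hV : IsInvariant S V) (x x' : Toeplitz S) (y : {x // x ∉ V}) :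
    diag hV (x - x') y = diag hV x y - diag hV x' y := by simp [diag]

lemma diag_fn (hV : IsInvariant S V) (a : C(X, ℂ)) (y : {x // x ∉ V}) :
    diag hV (Toeplitz.fn S a) y = a y := by simp [diag, orbitHom_fn]

lemma diag_eq_inner (hV : IsInvariant S V) (x : Toeplitz S) (y : {x // x ∉ V}) :
    diag hV x y = inner ℂ (δ y) (orbitHom hV x (δ y)) := (inner_δ_left _ _).symm

lemma diag_star_mul_self (hV : IsInvariant S V) (x : Toeplitz S) (y : {x // x ∉ V}) :
    diag hV (star x * x) y = (‖orbitHom hV x (δ y)‖ ^ 2 : ℝ) := by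
  rw [diag_eq_inner, map_mul, map_star, mul_apply_eq_comp,
    ContinuousLinearMap.star_eq_adjoint, ContinuousLinearMap.adjoint_inner_right,
    inner_self_eq_norm_sq_to_K]
  norm_cast

end OrbitSpace

end PartialCrossedProduct

end

/-! ### Bisections and the redundancies they produce. -/

noncomputable section

namespace PartialCrossedProduct

open TopologicalSpace Set Filter Topology UniformSpace
open scoped RightActions

set_option linter.unusedSectionVars false

variable {X : Type u} [TopologicalSpace X] [CompactSpace X] [T2Space X]
  {S : PartialLocalHomeo X}

/-- An Urysohn function with values in [0, 1]. The bounds on both `a` and `1 - a` are recorded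
because elements of the core are cut by both without increasing norms. -/
lemma exists_cutoff {K W : Set X} (hK : IsClosed K) (hW : IsOpen W) (hKW : K ⊆ W) :
    ∃ a : C(X, ℂ), tsupport a ⊆ W ∧ (∀ x ∈ K, a x = 1) ∧ (∀ x, ‖a x‖ ≤ 1) ∧
      (∀ x, ‖1 - a x‖ ≤ 1) ∧ star a = a := by
  obtain ⟨f, hf, hf1, hf01⟩ := exists_tsupport_one_of_isOpen_isClosed hW
    (isClosed_closure.isCompact) hK hKW
  refine ⟨⟨fun x => (f x : ℂ), by fun_prop⟩, ?_, fun x hx => ?_, fun x => ?_, fun x => ?_, ?_⟩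
  · refine subset_trans (closure_mono fun x hx => ?_) hf
    simpa using hx
  · simp [hf1 hx]
  · simp only [ContinuousMap.coe_mk, Complex.norm_real, Real.norm_eq_abs]
    rw [abs_le]
    exact ⟨by linarith [(hf01 x).1], (hf01 x).2⟩
  · simp only [ContinuousMap.coe_mk]
    rw [← Complex.ofReal_one, ← Complex.ofReal_sub, Complex.norm_real, Real.norm_eq_abs, abs_le]
    exact ⟨by linarith [(hf01 x).2], by linarith [(hf01 x).1]⟩
  · ext x
    simp

lemma exists_bump {x : X} {W : Set X} (hW : IsOpen W) (hx : x ∈ W) :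
    ∃ a : C(X, ℂ), tsupport a ⊆ W ∧ a x = 1 ∧ (∀ x, ‖a x‖ ≤ 1) ∧ star a = a := by
  obtain ⟨a, h1, h2, h3, -, h4⟩ := exists_cutoff isClosed_singleton hW (singleton_subset_iff.mpr hx)
  exact ⟨a, h1, h2 x rfl, h3, h4⟩

/-- `σ` is injective on the subset `W` of `U`. -/
structure IsBisection (S : PartialLocalHomeo X) (W : Set X) : Prop where
  subset : W ⊆ S.U
  inj : ∀ u v : S.U, (u : X) ∈ W → (v : X) ∈ W → S.σ u = S.σ v → u = v

lemma exists_isBisection (y : S.U) : ∃ W : Set X, IsOpen W ∧ (y : X) ∈ W ∧ IsBisection S W := by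
  obtain ⟨e, he, heq⟩ := S.isLocalHomeomorph y
  refine ⟨(↑) '' e.source, S.U.isOpen.isOpenMap_subtype_val _ e.open_source, ⟨y, he, rfl⟩, ?_, ?_⟩
  · rintro _ ⟨u, -, rfl⟩
    exact u.2
  · rintro u v ⟨u', hu, hu'⟩ ⟨v', hv, hv'⟩ h
    obtain rfl := Subtype.ext hu'
    obtain rfl := Subtype.ext hv'
    rw [heq] at h
    exact e.injOn hu hv h

namespace PreMod

/-- A function with support in `U` as an element of `C_c(U)`. -/
def of (a : C(X, ℂ)) (ha : tsupport a ⊆ S.U) : PreMod S := ⟨a, ha⟩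

@[simp] lemma of_apply (a : C(X, ℂ)) (ha : tsupport a ⊆ S.U) (x : X) : of a ha x = a x := rfl

lemma norm_apply_le (f : PreMod S) (x : X) : ‖f x‖ ≤ ‖f‖ := by
  by_cases hx : x ∈ S.U
  · have h := OrbitSpace.sum_fiber_sq_le f (S.σ ⟨x, hx⟩) {⟨x, hx⟩} (by simp)
    rw [Finset.sum_singleton] at h
    exact (sq_le_sq₀ (norm_nonneg _) (norm_nonneg _)).mp h
  · rw [f.apply_notMem hx, norm_zero]
    exact norm_nonneg f

lemma eq_zero_of_coe_eq_zero {f : PreMod S} (h : (f : HilbMod S) = 0) (x : X) : f x = 0 := by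
  have h1 : ‖f‖ = 0 := by rw [← Completion.norm_coe, h, norm_zero]
  exact norm_le_zero_iff.mp (h1 ▸ f.norm_apply_le x)

lemma inner_apply_of_isBisection {W : Set X} (hW : IsBisection S W) {f : PreMod S}
    (hf : ∀ z, f z ≠ 0 → z ∈ W) (g : PreMod S) (u : S.U) (hu : (u : X) ∈ W) :
    inner C(X, ℂ) f g (S.σ u) = star (f u) * g u := by
  rw [inner_eq_sum_left]
  refine Finset.sum_eq_single u (fun v hv hvu => ?_) fun hu' => ?_
  · have : f v = 0 := by
      by_contra h
      exact hvu (hW.inj v u (hf _ h) hu ((Set.Finite.mem_toFinset _).mp hv).1)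
    simp [this]
  · have : f u = 0 := by
      by_contra h
      exact hu' ((Set.Finite.mem_toFinset _).mpr ⟨rfl, f.support_subset _ h⟩)
    simp [this]

end PreMod

open PreMod

section Redundancy

variable {W : Set X} (hW : IsBisection S W) {f g : PreMod S} (hf : ∀ z, f z ≠ 0 → z ∈ W)
  (hg : ∀ z, g z ≠ 0 → z ∈ W)
include hW hf hg

/-- For `y ∈ W` the fibre sum ⟨g, m⟩(σ(y)) has the single term at `y`, because `g` lives on a set
where σ is injective. The rank one operator of `f` and `g` is therefore a multiplication operator.
-/
lemma smul_eq_rsmul_inner (m : HilbMod S) :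
    (f.1 * star g.1) • m = (f : HilbMod S) <• inner C(X, ℂ) (g : HilbMod S) m := by
  have hc : Continuous fun m : HilbMod S =>
      (f : HilbMod S) <• inner C(X, ℂ) (g : HilbMod S) m := (HilbMod.rankOne _ _).continuous
  refine Completion.induction_on m (isClosed_eq (continuous_const_smul _) hc) fun m => ?_
  rw [HilbMod.inner_coe, ← Completion.coe_smul, ← Completion.coe_smul]
  congr 1
  refine ext_mem fun y => ?_
  rw [rsmul_apply, lsmul_apply]
  change f y * star (g y) * m y = _
  by_cases hy : f y = 0
  · simp [hy]
  · rw [inner_apply_of_isBisection hW hg m y (hf y hy), mul_assoc]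

/-- If φ(b) = 0 then `b • f` vanishes in M, hence pointwise, since the norm of M dominates every
value of a function. Compactness is the rank one formula. -/
lemma mul_star_mem_idealI₀ : f.1 * star g.1 ∈ idealI₀ S := by
  refine ⟨fun b hb => ?_, ?_⟩
  · ext x
    have h1 : ((b • f : PreMod S) : HilbMod S) = 0 := by
      rw [Completion.coe_smul]
      exact DFunLike.congr_fun hb _
    have h2 : b x * f x = 0 := eq_zero_of_coe_eq_zero h1 x
    change f x * star (g x) * b x = 0
    linear_combination star (g x) * h2
  · refine subset_closure (Submodule.subset_span ⟨f, g, ?_⟩)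
    ext1 m
    exact smul_eq_rsmul_inner hW hf hg m

/-- All nontrivial memberships in `redundancyIdeal` established below are derived from this one. -/
lemma fn_sub_vec_mul_star_vec_mem :
    Toeplitz.fn S (f.1 * star g.1) - Toeplitz.vec (f : HilbMod S) *
      star (Toeplitz.vec (g : HilbMod S)) ∈ redundancyIdeal S := by
  refine subset_closedIdeal _ ⟨_, mul_star_mem_idealI₀ hW hf hg, _, ⟨?_, fun m => ?_⟩, rfl⟩
  · exact subset_closure (NonUnitalAlgebra.subset_adjoin ℂ ⟨_, _, rfl⟩)
  · rw [Toeplitz.fn_mul_vec, smul_eq_rsmul_inner hW hf hg, ← Toeplitz.vec_mul_fn,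
      ← Toeplitz.star_vec_mul_vec, mul_assoc]

end Redundancy

/-- Modulo redundancies, functions supported in `U` are generalized compact operators. -/
lemma exists_fn_sub_mem (a : C(X, ℂ)) (ha : tsupport a ⊆ S.U) :
    ∃ k ∈ Submodule.span ℂ {x : Toeplitz S | ∃ f g : PreMod S,
      x = Toeplitz.vec (f : HilbMod S) * star (Toeplitz.vec (g : HilbMod S))},
      Toeplitz.fn S a - k ∈ redundancyIdeal S := by
  classical
  choose W hWo hWm hW using exists_isBisection (S := S)
  obtain ⟨t, ht⟩ := (isClosed_tsupport a).isCompact.elim_finite_subcover _ hWo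
    (fun x hx => mem_iUnion.mpr ⟨⟨x, ha hx⟩, hWm _⟩)
  obtain ⟨ρ, hρ, -⟩ := PartitionOfUnity.exists_isSubordinate_of_locallyFinite_t2space
    (isClosed_tsupport a).isCompact (fun y : t => W y)
    (fun y => hWo y) (locallyFinite_of_finite _) (by simpa [iUnion_subtype] using ht)
  let F : t → C(X, ℂ) := fun i => ⟨fun x => (ρ i x : ℂ) * a x, by fun_prop⟩
  have hF : ∀ i, tsupport (F i) ⊆ W i := fun i => by
    refine subset_trans (closure_mono fun x hx => ?_) (hρ i)
    simp only [F, ContinuousMap.coe_mk, Function.mem_support, ne_eq, mul_eq_zero, not_or,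
      Complex.ofReal_eq_zero] at hx
    exact hx.1
  have hsum : a = ∑ i, F i := by
    ext x
    by_cases hx : x ∈ tsupport a
    · have h1 := ρ.sum_eq_one hx
      rw [finsum_eq_sum_of_fintype] at h1
      simp only [ContinuousMap.coe_sum, Finset.sum_apply, F, ContinuousMap.coe_mk]
      rw [← Finset.sum_mul, ← Complex.ofReal_sum, h1]
      simp
    · have : a x = 0 := image_eq_zero_of_notMem_tsupport hx
      simp [F, this]
  have key : ∀ i, ∃ k ∈ Submodule.span ℂ {x : Toeplitz S | ∃ f g : PreMod S,
      x = Toeplitz.vec (f : HilbMod S) * star (Toeplitz.vec (g : HilbMod S))},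
      Toeplitz.fn S (F i) - k ∈ redundancyIdeal S := fun i => by
    -- As `c = 1` on the support of `F i`, one has `F i = F i * star c`, a product of two functions
    -- supported in the same bisection.
    obtain ⟨c, hc, hc1, -, -, hcs⟩ := exists_cutoff (isClosed_tsupport (F i)) (hWo i) (hF i)
    have h := fn_sub_vec_mul_star_vec_mem (hW i)
      (f := of (F i) ((hF i).trans (hW i).subset)) (g := of c (hc.trans (hW i).subset))
      (fun z hz => hF i (subset_tsupport _ hz)) (fun z hz => hc (subset_tsupport _ hz))
    have h2 : F i * star c = F i := by
      ext x
      rw [hcs, ContinuousMap.mul_apply]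
      by_cases hx : x ∈ tsupport (F i)
      · rw [hc1 x hx, mul_one]
      · rw [image_eq_zero_of_notMem_tsupport hx, zero_mul]
    change Toeplitz.fn S (F i * star c) - _ ∈ _ at h
    rw [h2] at h
    exact ⟨_, Submodule.subset_span ⟨_, _, rfl⟩, h⟩
  choose k hk hkR using key
  refine ⟨∑ i, k i, Submodule.sum_mem _ fun i _ => hk i, ?_⟩
  have h : Toeplitz.fn S a - ∑ i, k i = ∑ i, (Toeplitz.fn S (F i) - k i) := by
    rw [Finset.sum_sub_distrib]
    congr 1
    conv_lhs => rw [hsum]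
    exact map_sum (Toeplitz.fnHom S) _ _
  rw [h]
  exact Ideal.sum_mem _ fun i _ => hkR i

/-- Left multiplication by functions supported in `U`, modulo an ideal. -/
lemma fn_mul_mem_of_forall {J : TwoSidedIdeal (Toeplitz S)}
    (hR : ∀ x ∈ redundancyIdeal S, x ∈ J) {b : Toeplitz S}
    (hb : ∀ f : PreMod S, star (Toeplitz.vec (f : HilbMod S)) * b ∈ J) {a : C(X, ℂ)}
    (ha : tsupport a ⊆ S.U) : Toeplitz.fn S a * b ∈ J := by
  obtain ⟨k, hk, hak⟩ := exists_fn_sub_mem a ha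
  have h1 : k * b ∈ J := by
    refine Submodule.span_induction (p := fun k _ => k * b ∈ J) ?_ ?_ ?_ ?_ hk
    · rintro _ ⟨f, g, rfl⟩
      rw [mul_assoc]
      exact J.mul_mem_left _ _ (hb g)
    · rw [zero_mul]; exact J.zero_mem
    · intro x y _ _ hx hy
      rw [add_mul]; exact J.add_mem hx hy
    · intro c x _ hx
      rw [Algebra.smul_def, mul_assoc]
      exact J.mul_mem_left _ _ hx
  have h2 := J.add_mem (J.mul_mem_right _ b (hR _ hak)) h1
  rwa [sub_mul, sub_add_cancel] at h2

/-- Right multiplication by functions supported in `U`, modulo an ideal. -/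
lemma mul_fn_mem_of_forall {J : TwoSidedIdeal (Toeplitz S)}
    (hR : ∀ x ∈ redundancyIdeal S, x ∈ J) {b : Toeplitz S}
    (hb : ∀ f : PreMod S, b * Toeplitz.vec (f : HilbMod S) ∈ J) {a : C(X, ℂ)}
    (ha : tsupport a ⊆ S.U) : b * Toeplitz.fn S a ∈ J := by
  obtain ⟨k, hk, hak⟩ := exists_fn_sub_mem a ha
  have h1 : b * k ∈ J := by
    refine Submodule.span_induction (p := fun k _ => b * k ∈ J) ?_ ?_ ?_ ?_ hk
    · rintro _ ⟨f, g, rfl⟩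
      rw [← mul_assoc]
      exact J.mul_mem_right _ _ (hb f)
    · rw [mul_zero]; exact J.zero_mem
    · intro x y _ _ hx hy
      rw [mul_add]; exact J.add_mem hx hy
    · intro c x _ hx
      rw [mul_smul_comm, Algebra.smul_def]
      exact J.mul_mem_left _ _ hx
  have h2 := J.add_mem (J.mul_mem_left b _ (hR _ hak)) h1
  rwa [mul_sub, sub_add_cancel] at h2

/-! ### Orbit representations annihilate the redundancies. -/

namespace OrbitSpace

variable {V : Set X} (hV : IsInvariant S V)

lemma apply_σ_notMem (hV : IsInvariant S V) {y : S.U} (hy : (y : X) ∉ V) : S.σ y ∉ V :=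
  fun h => hy (hV.mem_of_apply_mem y h)

/-- A bump at `y` supported in a bisection vanishes at the other points of the fibre through `y`.
Backward invariance makes the basis vector at σ(y) available. -/
lemma exists_shiftOp_δ_eq (y : S.U) (hy : (y : X) ∉ V) :
    ∃ f : PreMod S, shiftOp V f (δ ⟨S.σ y, apply_σ_notMem hV hy⟩) = δ ⟨(y : X), hy⟩ := by
  obtain ⟨W, hWo, hyW, hW⟩ := exists_isBisection y
  obtain ⟨a, ha, ha1, -⟩ := exists_bump hWo hyW
  refine ⟨of a (ha.trans hW.subset), ext_mem (S := S) (fun z hz => ?_) fun z hz => ?_⟩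
  · rw [shiftOp_apply_mem, of_apply]
    by_cases h : z = y
    · subst h
      rw [δ_apply_self, ha1, zeroExt_δ_self ⟨S.σ z, _⟩, mul_one]
    · rw [δ_apply_ne fun h' => h (Subtype.ext (Subtype.mk.inj h'))]
      by_cases h0 : a z = 0
      · rw [h0, zero_mul]
      · rw [zeroExt_δ_ne, mul_zero]
        exact fun h' => h (hW.inj _ _ (ha (subset_tsupport _ h0)) hyW h')
  · rw [shiftOp_apply_notMem _ _ _ hz, δ_apply_ne]
    rintro rfl
    exact hz y.2

lemma star_shiftOp_δ_eq_zero (f : PreMod S) (y : {x // x ∉ V}) (hy : f y = 0) :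
    star (shiftOp V f) (δ y) = 0 := by
  ext x
  rw [← inner_δ_left, ContinuousLinearMap.star_eq_adjoint,
    ContinuousLinearMap.adjoint_inner_right, ← inner_conj_symm, inner_δ_left]
  have : shiftOp V f (δ x) y = 0 := by
    by_cases hyU : (y : X) ∈ S.U
    · refine (shiftOp_apply_mem f _ ⟨y, hyU⟩ y.2).trans ?_
      simp [hy]
    · exact shiftOp_apply_notMem _ _ _ hyU
  rw [this]
  simp

/-- For f ∈ C_c(U) the complement of the support is a neighbourhood of `x ∉ U`, and the adjoint of
the operator of `f` kills the basis vectors at its points. A general `m` is approximated by such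
`f`, with an error uniform in `y`. -/
lemma star_vec_δ_tendsto (m : HilbMod S) (x : {x // x ∉ V}) (hx : (x : X) ∉ S.U) :
    Tendsto (fun y => orbitHom hV (star (Toeplitz.vec m)) (δ y)) (𝓝 x) (𝓝 0) := by
  rw [Metric.tendsto_nhds]
  intro ε hε
  obtain ⟨f, hf⟩ : ∃ f : PreMod S, dist m f < ε := by
    exact (Completion.denseRange_coe (α := PreMod S)).exists_dist_lt m hε
  have hN : {y : {x // x ∉ V} | (y : X) ∈ (tsupport f.1.1)ᶜ} ∈ 𝓝 x :=
    (((isClosed_tsupport f.1.1).isOpen_compl).preimage continuous_subtype_val).mem_nhds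
      fun h => hx (f.2 h)
  filter_upwards [hN] with y hy
  rw [dist_zero_right]
  have h0 : f y = 0 := image_eq_zero_of_notMem_tsupport hy
  have h1 : orbitHom hV (star (Toeplitz.vec m)) (δ y) =
      orbitHom hV (star (Toeplitz.vec (m - (f : HilbMod S)))) (δ y) := by
    have h2 : Toeplitz.vec (m - (f : HilbMod S)) = Toeplitz.vec m - Toeplitz.vec ↑f :=
      map_sub (Toeplitz.vecL S) _ _
    rw [h2, star_sub, map_sub, map_star _ (Toeplitz.vec (f : HilbMod S)), orbitHom_vec]
    simp [star_shiftOp_δ_eq_zero f y h0]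
  rw [h1]
  refine lt_of_le_of_lt (((orbitHom hV _).le_opNorm _).trans ?_) ((dist_eq_norm m f).symm ▸ hf)
  rw [norm_δ, mul_one]
  refine (norm_orbitHom_le hV _).trans ?_
  rw [norm_star]
  exact Toeplitz.norm_vec_le _

/-- The generators `m n^*` end in an annihilation, so the limit passes to products and to the
closure. The neighbourhood filter is not punctured, so `k` also kills `δ x` itself. -/
lemma K₁_δ_tendsto {k : Toeplitz S} (hk : k ∈ Toeplitz.K₁ S) (x : {x // x ∉ V}) (hx : (x : X) ∉ S.U) :
    Tendsto (fun y => orbitHom hV k (δ y)) (𝓝 x) (𝓝 0) := by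
  have h0 : ∀ k ∈ NonUnitalAlgebra.adjoin ℂ
      {x : Toeplitz S | ∃ m n : HilbMod S, x = Toeplitz.vec m * star (Toeplitz.vec n)},
      Tendsto (fun y => orbitHom hV k (δ y)) (𝓝 x) (𝓝 0) := by
    intro k hk
    refine NonUnitalAlgebra.adjoin_induction
      (p := fun k _ => Tendsto (fun y => orbitHom hV k (δ y)) (𝓝 x) (𝓝 0)) ?_ ?_ ?_ ?_ ?_ hk
    · rintro _ ⟨m, n, rfl⟩
      have h := ((orbitHom hV (Toeplitz.vec m)).continuous.tendsto 0).comp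
        (star_vec_δ_tendsto hV n x hx)
      rw [map_zero] at h
      refine h.congr fun y => ?_
      rw [map_mul]; rfl
    · intro a b _ _ ha hb
      simpa using ha.add hb
    · simp
    · intro a b _ _ _ hb
      have h := ((orbitHom hV a).continuous.tendsto 0).comp hb
      rw [map_zero] at h
      refine h.congr fun y => ?_
      rw [map_mul]; rfl
    · intro c a _ ha
      have h := ha.const_smul c
      rw [smul_zero] at h
      refine h.congr fun y => ?_
      rw [map_smul]; rfl
  rw [Metric.tendsto_nhds]
  intro ε hε
  obtain ⟨k', hk', hd⟩ := Metric.mem_closure_iff.mp (show k ∈ closure _ from hk) (ε / 2)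
    (by positivity)
  filter_upwards [(Metric.tendsto_nhds.mp (h0 k' hk')) (ε / 2) (by positivity)] with y hy
  rw [dist_zero_right] at hy ⊢
  have h1 : orbitHom hV k (δ y) = orbitHom hV (k - k') (δ y) + orbitHom hV k' (δ y) := by
    simp
  rw [h1]
  have h2 : ‖orbitHom hV (k - k') (δ y)‖ ≤ ‖k - k'‖ := by
    refine ((orbitHom hV _).le_opNorm _).trans ?_
    rw [norm_δ, mul_one]
    exact norm_orbitHom_le hV _
  rw [dist_eq_norm] at hd
  linarith [norm_add_le (orbitHom hV (k - k') (δ y)) (orbitHom hV k' (δ y))]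

lemma fn_δ (a : C(X, ℂ)) (y : {x // x ∉ V}) :
    orbitHom hV (Toeplitz.fn S a) (δ y) = a y • δ y := by
  rw [orbitHom_fn]
  ext z
  by_cases h : z = y
  · subst h; simp
  · simp [δ_apply_ne h]

/-- For `y ∈ U` the vector `δ y` is in the range of a creation operator, where `a m = k m`
determines `k`. -/
lemma redundancy_δ_eq {a : C(X, ℂ)} {k : Toeplitz S} (h : Toeplitz.IsRedundancy a k)
    (y : {x // x ∉ V}) (hy : (y : X) ∈ S.U) :
    orbitHom hV k (δ y) = a y • δ y := by
  obtain ⟨f, hf⟩ := exists_shiftOp_δ_eq hV ⟨y, hy⟩ y.2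
  rw [← fn_δ hV]
  change orbitHom hV k (δ ⟨y, y.2⟩) = orbitHom hV _ (δ ⟨y, y.2⟩)
  have h1 := congrArg (orbitHom hV) (h.2 (f : HilbMod S))
  rw [map_mul, map_mul, orbitHom_vec] at h1
  have h2 := DFunLike.congr_fun h1 (δ ⟨S.σ ⟨y, hy⟩, apply_σ_notMem hV (y := ⟨y, hy⟩) y.2⟩)
  simp only [mul_apply_eq_comp, hf] at h2
  exact h2.symm

lemma isInvariant_empty (S : PartialLocalHomeo X) : IsInvariant S ∅ :=
  ⟨fun _ h => h.elim, fun _ h => h.elim⟩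

/-- Off the closure of `U`, a bump acts as zero on M, so orthogonality to ker φ forces `a x = 0`. At
a boundary point, |a(y)| for `y ∈ U` is the norm of `k` applied to `δ y`, which tends to 0. The
representation with V = ∅ is used so that no point of `U` near `x` is missing. -/
lemma eq_zero_of_isRedundancy {a : C(X, ℂ)} (ha : a ∈ idealI₀ S) {k : Toeplitz S}
    (h : Toeplitz.IsRedundancy a k) {x : X} (hx : x ∉ S.U) : a x = 0 := by
  by_cases hxU : x ∈ closure (S.U : Set X)
  · have h1 : Tendsto (fun y : X => ‖orbitHom (isInvariant_empty S) k (δ ⟨y, fun h => h⟩)‖)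
        (𝓝[S.U] x) (𝓝 0) := by
      have h2 := (K₁_δ_tendsto (isInvariant_empty S) h.1 ⟨x, fun h => h⟩ hx).norm
      rw [norm_zero] at h2
      have h3 : Continuous fun y : X => (⟨y, fun h => h⟩ : {x : X // x ∉ (∅ : Set X)}) := by
        fun_prop
      exact (h2.comp (h3.tendsto x)).mono_left nhdsWithin_le_nhds
    have h2 : Tendsto (fun y : X => ‖a y‖) (𝓝[S.U] x) (𝓝 ‖a x‖) :=
      ((map_continuous a).norm.tendsto x).mono_left nhdsWithin_le_nhds
    have : (𝓝[S.U] x).NeBot := mem_closure_iff_nhdsWithin_neBot.mp hxU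
    have h3 : Tendsto (fun y : X => ‖a y‖) (𝓝[S.U] x) (𝓝 0) := by
      refine h1.congr' ?_
      filter_upwards [self_mem_nhdsWithin] with y hy
      rw [redundancy_δ_eq (isInvariant_empty S) h ⟨y, fun h => h⟩ hy, norm_smul, norm_δ, mul_one]
    exact norm_eq_zero.mp (tendsto_nhds_unique h2 h3)
  · obtain ⟨b, hb, hb1, -⟩ := exists_bump isClosed_closure.isOpen_compl hxU
    have h1 : HilbMod.leftMul S b = 0 := by
      ext1 m
      change b • m = 0
      refine Completion.induction_on m (isClosed_eq (continuous_const_smul b) continuous_const)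
        fun f => ?_
      rw [← Completion.coe_smul, ← Completion.coe_zero]
      congr 1
      refine PreMod.ext_mem fun y => ?_
      rw [lsmul_apply, PreMod.zero_apply]
      have : b y = 0 := by
        by_contra h0
        exact hb (subset_tsupport _ h0) (subset_closure y.2)
      rw [this, zero_mul]
    have h2 := DFunLike.congr_fun (ha.1 b h1) x
    rw [ContinuousMap.mul_apply, hb1, mul_one] at h2
    exact h2

/-- For a redundancy `(a, k)` with `a ∈ I₀`, both `a` and `k` multiply `δ y` by `a y` when `y ∈ U`
and kill it otherwise. -/
lemma orbitHom_eq_zero {x : Toeplitz S} (hx : x ∈ redundancyIdeal S) : orbitHom hV x = 0 := by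
  have hcl : IsClosed (TwoSidedIdeal.ker (orbitHom hV) : Set (Toeplitz S)) := by
    have h : (TwoSidedIdeal.ker (orbitHom hV) : Set (Toeplitz S)) = orbitHom hV ⁻¹' {0} := by
      ext y
      simp [TwoSidedIdeal.mem_ker]
    rw [h]
    exact isClosed_singleton.preimage (continuous_orbitHom hV)
  have h := mem_closedIdeal.mp (show x ∈ closedIdeal _ from hx) _ hcl ?_
  · exact (TwoSidedIdeal.mem_ker _).mp h
  · rintro _ ⟨a, ha, k, hk, rfl⟩
    refine (TwoSidedIdeal.mem_ker _).mpr (ext_δ fun y => ?_)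
    rw [map_sub, _root_.sub_apply, fn_δ, _root_.zero_apply]
    by_cases hy : (y : X) ∈ S.U
    · rw [redundancy_δ_eq hV hk y hy, sub_self]
    · have h1 := (K₁_δ_tendsto hV hk.1 y hy)
      have h2 : orbitHom hV k (δ y) = 0 := by
        rw [Metric.tendsto_nhds] at h1
        by_contra h0
        have h3 := (h1 ‖orbitHom hV k (δ y)‖ (norm_pos_iff.mpr h0)).self_of_nhds
        rw [dist_zero_right] at h3
        exact lt_irrefl _ h3
      rw [h2, eq_zero_of_isRedundancy ha hk hy, zero_smul, sub_zero]

end OrbitSpace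

end PartialCrossedProduct

end

/-! ### The core: elements of gauge degree zero. -/

noncomputable section

namespace PartialCrossedProduct

open TopologicalSpace Set Filter Topology UniformSpace PreMod
open scoped RightActions

set_option linter.unusedSectionVars false

variable {X : Type u} [TopologicalSpace X] [CompactSpace X] [T2Space X]
  {S : PartialLocalHomeo X}

namespace Toeplitz

/-- The creation operator attached to a function in `C_c(U)`. -/
def pvec (f : PreMod S) : Toeplitz S := vec (f : HilbMod S)

lemma fn_mul_pvec (a : C(X, ℂ)) (f : PreMod S) : fn S a * pvec f = pvec (a • f) := by
  rw [pvec, fn_mul_vec, pvec, Completion.coe_smul]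

lemma pvec_mul_fn (f : PreMod S) (a : C(X, ℂ)) : pvec f * fn S a = pvec (f <• a) := by
  rw [pvec, vec_mul_fn, pvec, Completion.coe_smul]

lemma star_pvec_mul_pvec (f g : PreMod S) :
    star (pvec f) * pvec g = fn S (inner C(X, ℂ) f g) := by
  rw [pvec, pvec, star_vec_mul_vec, HilbMod.inner_coe]

lemma star_pvec_mul_fn (f : PreMod S) (a : C(X, ℂ)) :
    star (pvec f) * fn S a = star (pvec (star a • f)) := by
  rw [← fn_mul_pvec, star_mul, fn_star, star_star]

lemma fn_mul_star_pvec (f : PreMod S) (a : C(X, ℂ)) :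
    fn S a * star (pvec f) = star (pvec (f <• star a)) := by
  rw [← pvec_mul_fn, star_mul, fn_star, star_star]

lemma pvec_eq_zero {f : PreMod S} (h : ∀ x, f x = 0) : pvec f = 0 := by
  have : f = 0 := PreMod.ext h
  rw [this, pvec, Completion.coe_zero]
  exact map_zero (vecL S)

/-- The elements of gauge degree zero built from at most `k` creations and annihilations. -/
def coreAlg (S : PartialLocalHomeo X) : ℕ → Submodule ℂ (Toeplitz S)
  | 0 => LinearMap.range (fnHom S).toAlgHom.toLinearMap
  | k + 1 => LinearMap.range (fnHom S).toAlgHom.toLinearMap ⊔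
      Submodule.span ℂ {y | ∃ (f g : PreMod S), ∃ x ∈ coreAlg S k, y = pvec f * x * star (pvec g)}

lemma fn_mem_coreAlg (k : ℕ) (a : C(X, ℂ)) : fn S a ∈ coreAlg S k := by
  cases k with
  | zero => exact ⟨a, rfl⟩
  | succ k => exact Submodule.mem_sup_left ⟨a, rfl⟩

lemma pvec_mul_mul_star_pvec_mem {k : ℕ} (f g : PreMod S) {x : Toeplitz S}
    (hx : x ∈ coreAlg S k) : pvec f * x * star (pvec g) ∈ coreAlg S (k + 1) :=
  Submodule.mem_sup_right (Submodule.subset_span ⟨f, g, x, hx, rfl⟩)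

/-- Scalars are absorbed into the middle factor `x`, so `p` need not be stable under scalar
multiplication. -/
lemma coreAlg_succ_induction {k : ℕ} {p : Toeplitz S → Prop} (hfn : ∀ a, p (fn S a))
    (hvec : ∀ f g : PreMod S, ∀ x ∈ coreAlg S k, p (pvec f * x * star (pvec g)))
    (hadd : ∀ x y, p x → p y → p (x + y)) {x : Toeplitz S} (hx : x ∈ coreAlg S (k + 1)) :
    p x := by
  obtain ⟨_, ⟨a, rfl⟩, y, hy, rfl⟩ := Submodule.mem_sup.mp hx
  refine hadd _ _ (hfn a) ?_
  have h0 : p 0 := by rw [← fn_zero]; exact hfn 0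
  rw [Submodule.mem_span_set'] at hy
  obtain ⟨n, c, g, rfl⟩ := hy
  refine Finset.sum_induction _ p hadd h0 fun i _ => ?_
  obtain ⟨f, g', x, hx, h⟩ := (g i).2
  rw [h, ← smul_mul_assoc, ← mul_smul_comm]
  exact hvec _ _ _ ((coreAlg S k).smul_mem _ hx)

lemma coreAlg_zero_induction {p : Toeplitz S → Prop} (hfn : ∀ a, p (fn S a))
    {x : Toeplitz S} (hx : x ∈ coreAlg S 0) : p x := by
  obtain ⟨a, rfl⟩ := hx
  exact hfn a

lemma coreAlg_le_succ (k : ℕ) : coreAlg S k ≤ coreAlg S (k + 1) := by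
  induction k with
  | zero => exact fun x hx => coreAlg_zero_induction (fn_mem_coreAlg _) hx
  | succ k ih =>
    intro x hx
    refine coreAlg_succ_induction (p := (· ∈ coreAlg S (k + 2))) (fn_mem_coreAlg _)
      (fun f g x hx => pvec_mul_mul_star_pvec_mem f g (ih hx))
      (fun _ _ => Submodule.add_mem _) hx

lemma coreAlg_mono : Monotone (coreAlg S) := monotone_nat_of_le_succ coreAlg_le_succ

lemma star_mem_coreAlg {k : ℕ} {x : Toeplitz S} (hx : x ∈ coreAlg S k) :
    star x ∈ coreAlg S k := by
  induction k generalizing x with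
  | zero =>
    refine coreAlg_zero_induction (p := fun x => star x ∈ coreAlg S 0) (fun a => ?_) hx
    rw [← fn_star]; exact fn_mem_coreAlg _ _
  | succ k ih =>
    refine coreAlg_succ_induction (p := fun x => star x ∈ coreAlg S (k + 1)) (fun a => ?_)
      (fun f g x hx => ?_) (fun x y hx hy => ?_) hx
    · rw [← fn_star]; exact fn_mem_coreAlg _ _
    · rw [star_mul, star_mul, star_star, ← mul_assoc]
      exact pvec_mul_mul_star_pvec_mem _ _ (ih hx)
    · rw [star_add]; exact Submodule.add_mem _ hx hy

lemma fn_mul_mem_coreAlg {k : ℕ} (a : C(X, ℂ)) {x : Toeplitz S} (hx : x ∈ coreAlg S k) :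
    fn S a * x ∈ coreAlg S k := by
  cases k with
  | zero =>
    refine coreAlg_zero_induction (p := fun x => fn S a * x ∈ coreAlg S 0) (fun b => ?_) hx
    rw [← fn_mul]; exact fn_mem_coreAlg _ _
  | succ k =>
    refine coreAlg_succ_induction (p := fun x => fn S a * x ∈ coreAlg S (k + 1)) (fun b => ?_)
      (fun f g x hx => ?_) (fun x y hx hy => ?_) hx
    · rw [← fn_mul]; exact fn_mem_coreAlg _ _
    · rw [← mul_assoc, ← mul_assoc, fn_mul_pvec]
      exact pvec_mul_mul_star_pvec_mem _ _ hx
    · rw [mul_add]; exact Submodule.add_mem _ hx hy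

lemma mul_fn_mem_coreAlg {k : ℕ} (a : C(X, ℂ)) {x : Toeplitz S} (hx : x ∈ coreAlg S k) :
    x * fn S a ∈ coreAlg S k := by
  have h := star_mem_coreAlg (fn_mul_mem_coreAlg (star a) (star_mem_coreAlg hx))
  rwa [star_mul, star_star, fn_star, star_star] at h

/-- The annihilation and the creation that meet in the middle contract to a function, so the depth
does not grow. -/
lemma mul_mem_coreAlg {k : ℕ} {x y : Toeplitz S} (hx : x ∈ coreAlg S k)
    (hy : y ∈ coreAlg S k) : x * y ∈ coreAlg S k := by
  induction k generalizing x y with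
  | zero =>
    exact coreAlg_zero_induction (p := fun x => x * y ∈ coreAlg S 0)
      (fun a => fn_mul_mem_coreAlg a hy) hx
  | succ k ih =>
    refine coreAlg_succ_induction (p := fun x => x * y ∈ coreAlg S (k + 1))
      (fun a => fn_mul_mem_coreAlg a hy) (fun f g x hx => ?_) (fun x x' hx hx' => ?_) hx
    · refine coreAlg_succ_induction
        (p := fun y => pvec f * x * star (pvec g) * y ∈ coreAlg S (k + 1))
        (fun a => mul_fn_mem_coreAlg a (pvec_mul_mul_star_pvec_mem f g hx))
        (fun f' g' x' hx' => ?_) (fun y y' hy hy' => ?_) hy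
      · have h : pvec f * x * star (pvec g) * (pvec f' * x' * star (pvec g')) =
            pvec f * (x * (fn S (inner C(X, ℂ) g f') * x')) * star (pvec g') := by
          rw [← star_pvec_mul_pvec]
          simp only [mul_assoc]
        rw [h]
        exact pvec_mul_mul_star_pvec_mem _ _ (ih hx (fn_mul_mem_coreAlg _ hx'))
      · rw [mul_add]; exact Submodule.add_mem _ hy hy'
    · rw [add_mul]; exact Submodule.add_mem _ hx hx'

/-- `coreAlg S k` as a star subalgebra. -/
def coreStarAlg (S : PartialLocalHomeo X) (k : ℕ) : StarSubalgebra ℂ (Toeplitz S) where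
  carrier := coreAlg S k
  mul_mem' := mul_mem_coreAlg
  add_mem' := (coreAlg S k).add_mem
  algebraMap_mem' c := by
    rw [← fn_algebraMap]; exact fn_mem_coreAlg _ _
  star_mem' := star_mem_coreAlg

/-- Compression by creation operators lowers the depth by one; this drives the induction in
`mem_of_mem_closure_coreAlg`. -/
lemma star_pvec_mul_mul_pvec_mem {k : ℕ} (f g : PreMod S) {x : Toeplitz S}
    (hx : x ∈ coreAlg S (k + 1)) : star (pvec f) * x * pvec g ∈ coreAlg S k := by
  refine coreAlg_succ_induction (p := fun x => star (pvec f) * x * pvec g ∈ coreAlg S k)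
    (fun a => ?_) (fun f' g' x hx => ?_) (fun x y hx hy => ?_) hx
  · rw [mul_assoc, fn_mul_pvec, star_pvec_mul_pvec]
    exact fn_mem_coreAlg _ _
  · have h : star (pvec f) * (pvec f' * x * star (pvec g')) * pvec g =
        fn S (inner C(X, ℂ) f f') * x * fn S (inner C(X, ℂ) g' g) := by
      rw [← star_pvec_mul_pvec, ← star_pvec_mul_pvec]
      simp only [mul_assoc]
    rw [h]
    exact mul_fn_mem_coreAlg _ (fn_mul_mem_coreAlg _ hx)
  · rw [mul_add, add_mul]; exact Submodule.add_mem _ hx hy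

/-- Away from a compact subset of `U`, elements of the core are functions. -/
lemma exists_eq_fn_of_cutoff {k : ℕ} {x : Toeplitz S} (hx : x ∈ coreAlg S (k + 1)) :
    ∃ K : Set X, IsClosed K ∧ K ⊆ S.U ∧ ∀ a : C(X, ℂ), (∀ y ∈ K, a y = 1) →
      (∃ c, fn S (1 - a) * x = fn S c) ∧ ∃ c, x * fn S (1 - a) = fn S c := by
  refine coreAlg_succ_induction (p := fun x => ∃ K : Set X, IsClosed K ∧ K ⊆ S.U ∧
    ∀ a : C(X, ℂ), (∀ y ∈ K, a y = 1) →
      (∃ c, fn S (1 - a) * x = fn S c) ∧ ∃ c, x * fn S (1 - a) = fn S c)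
    (fun c => ?_) (fun f g x _ => ?_) (fun x y hx hy => ?_) hx
  · exact ⟨∅, isClosed_empty, empty_subset _, fun a _ =>
      ⟨⟨_, (fn_mul _ _).symm⟩, ⟨_, (fn_mul _ _).symm⟩⟩⟩
  · refine ⟨tsupport f.1 ∪ tsupport g.1, (isClosed_tsupport _).union (isClosed_tsupport _),
      union_subset f.2 g.2, fun a ha => ⟨⟨0, ?_⟩, ⟨0, ?_⟩⟩⟩
    · rw [← mul_assoc, ← mul_assoc, fn_mul_pvec, pvec_eq_zero fun y => ?_, zero_mul, zero_mul,
        fn_zero]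
      rw [lsmul_apply]
      by_cases hy : y ∈ tsupport f.1
      · simp [ha y (.inl hy)]
      · have : f y = 0 := image_eq_zero_of_notMem_tsupport hy
        rw [this, mul_zero]
    · rw [mul_assoc, star_pvec_mul_fn, pvec_eq_zero (f := star (1 - a) • g) fun y => ?_, star_zero, mul_zero, fn_zero]
      rw [lsmul_apply]
      by_cases hy : y ∈ tsupport g.1
      · simp [ha y (.inr hy)]
      · have : g y = 0 := image_eq_zero_of_notMem_tsupport hy
        rw [this, mul_zero]
  · obtain ⟨K, hK, hKU, h⟩ := hx
    obtain ⟨K', hK', hKU', h'⟩ := hy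
    refine ⟨K ∪ K', hK.union hK', union_subset hKU hKU', fun a ha => ?_⟩
    obtain ⟨⟨c, hc⟩, ⟨d, hd⟩⟩ := h a fun y hy => ha y (.inl hy)
    obtain ⟨⟨c', hc'⟩, ⟨d', hd'⟩⟩ := h' a fun y hy => ha y (.inr hy)
    exact ⟨⟨c + c', by rw [mul_add, hc, hc', fn_add]⟩, ⟨d + d', by rw [add_mul, hd, hd', fn_add]⟩⟩

/-- The core: the closed union of the subspaces `coreAlg S k`. -/
def gaugeCore (S : PartialLocalHomeo X) : Set (Toeplitz S) := closure (⋃ k, (coreAlg S k : Set _))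

lemma exists_norm_sub_lt_of_mem_gaugeCore {b : Toeplitz S} (hb : b ∈ gaugeCore S) {ε : ℝ} (hε : 0 < ε) :
    ∃ k, ∃ x ∈ coreAlg S k, ‖b - x‖ < ε := by
  obtain ⟨x, hx, hd⟩ := Metric.mem_closure_iff.mp hb ε hε
  obtain ⟨k, hk⟩ := mem_iUnion.mp hx
  exact ⟨k, x, hk, by rwa [← dist_eq_norm]⟩

lemma star_mul_self_mem_gaugeCore {b : Toeplitz S} (hb : b ∈ gaugeCore S) : star b * b ∈ gaugeCore S := by
  have hc : Continuous fun b : Toeplitz S => star b * b := by fun_prop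
  refine map_mem_closure (f := fun b : Toeplitz S => star b * b) hc hb fun x hx => ?_
  obtain ⟨k, hk⟩ := mem_iUnion.mp hx
  exact mem_iUnion.mpr ⟨k, mul_mem_coreAlg (star_mem_coreAlg hk) hk⟩

lemma norm_fn_mul_le {a : C(X, ℂ)} (ha : ∀ x, ‖a x‖ ≤ 1) (x : Toeplitz S) :
    ‖fn S a * x‖ ≤ ‖x‖ := by
  have h1 : ‖a‖ ≤ 1 := (ContinuousMap.norm_le _ zero_le_one).mpr ha
  calc ‖fn S a * x‖ ≤ ‖fn S a‖ * ‖x‖ := norm_mul_le _ _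
    _ ≤ 1 * ‖x‖ := by gcongr; exact (norm_fn_le a).trans h1
    _ = ‖x‖ := one_mul _

lemma norm_mul_fn_le {a : C(X, ℂ)} (ha : ∀ x, ‖a x‖ ≤ 1) (x : Toeplitz S) :
    ‖x * fn S a‖ ≤ ‖x‖ := by
  have h1 : ‖a‖ ≤ 1 := (ContinuousMap.norm_le _ zero_le_one).mpr ha
  calc ‖x * fn S a‖ ≤ ‖x‖ * ‖fn S a‖ := norm_mul_le _ _
    _ ≤ ‖x‖ * 1 := by gcongr; exact (norm_fn_le a).trans h1
    _ = ‖x‖ := mul_one _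

end Toeplitz

open Toeplitz OrbitSpace

/-! ### The kernel of an orbit representation on the core. -/

section Kernel

variable {V : Opens X} (hV : IsInvariant S (V : Set X)) {J : TwoSidedIdeal (Toeplitz S)}
  (hfn : ∀ a ∈ C₀ V, fn S a ∈ J)
include hV hfn

/-- The diagonal coefficients of `x` vanish, so |c| ≤ ε off `V`. Hence {|c| ≥ 2ε} is a closed subset
of `V`, and a cutoff for it changes `c` by at most 2ε into an element of C₀(V). -/
lemma exists_norm_sub_le_of_norm_sub_fn_le {x : Toeplitz S} (hx : orbitHom hV x = 0)
    {c : C(X, ℂ)} {ε : ℝ} (hε : 0 < ε) (hc : ‖x - fn S c‖ ≤ ε) : ∃ j ∈ J, ‖x - j‖ ≤ 3 * ε := by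
  have h1 : ∀ y ∉ V, ‖c y‖ ≤ ε := fun y hy => by
    have h := norm_diag_le hV (x - fn S c) ⟨y, hy⟩
    rw [diag_sub, diag_fn, diag, hx] at h
    simpa using h.trans hc
  have hcl : IsClosed {y | 2 * ε ≤ ‖c y‖} := isClosed_le continuous_const (by fun_prop)
  obtain ⟨u, hu, hu1, -, hu2, -⟩ := exists_cutoff hcl V.isOpen fun y hy => by
    by_contra h
    have := h1 y h
    rw [mem_ofPred_eq] at hy
    linarith
  refine ⟨fn S (c * u), hfn _ fun y hy => ?_, ?_⟩
  · have : u y = 0 := by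
      by_contra h
      exact hy (hu (subset_tsupport _ h))
    simp [this]
  · have h2 : ‖c - c * u‖ ≤ 2 * ε := by
      refine (ContinuousMap.norm_le _ (by positivity)).mpr fun y => ?_
      have h3 : (c - c * u) y = c y * (1 - u y) := by simp; ring
      rw [h3, norm_mul]
      by_cases hy : 2 * ε ≤ ‖c y‖
      · rw [hu1 y hy, sub_self, norm_zero, mul_zero]
        positivity
      · exact (mul_le_of_le_one_right (norm_nonneg _) (hu2 y)).trans (not_le.mp hy).le
    have h3 : x - fn S (c * u) = (x - fn S c) + fn S (c - c * u) := by
      rw [fn_sub]; abel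
    rw [h3]
    refine (norm_add_le _ _).trans ?_
    linarith [norm_fn_le (S := S) (c - c * u)]

variable (hJ : IsClosed (J : Set (Toeplitz S))) (hR : ∀ x ∈ redundancyIdeal S, x ∈ J)
include hJ hR

/-- Induction on the depth. The compressions `star (pvec f) * b * pvec g` lie in `J` by the
induction hypothesis; as functions supported in `U` are sums of products of a creation and an
annihilation modulo redundancies, `a b a'` lies in `J` for all such `a`, `a'`. Away from a compact
subset of `U` the element `b` is nearly a function, and `exists_norm_sub_le_of_norm_sub_fn_le`
applies. -/
lemma mem_of_mem_closure_coreAlg {k : ℕ} {b : Toeplitz S}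
    (hb : b ∈ closure (coreAlg S k : Set (Toeplitz S))) (h0 : orbitHom hV b = 0) : b ∈ J := by
  induction k generalizing b with
  | zero =>
    refine mem_of_forall_exists_norm_sub_le hJ fun ε hε => ?_
    obtain ⟨x, ⟨c, rfl⟩, hx⟩ := Metric.mem_closure_iff.mp hb (ε / 3) (by positivity)
    rw [dist_eq_norm] at hx
    obtain ⟨j, hj, hle⟩ := exists_norm_sub_le_of_norm_sub_fn_le hV hfn h0 (by positivity) hx.le
    exact ⟨j, hj, by linarith⟩
  | succ k ih =>
    have h1 : ∀ f g : PreMod S, star (pvec f) * b * pvec g ∈ J := fun f g => by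
      refine ih ?_ ?_
      · have hc : Continuous fun b : Toeplitz S => star (pvec f) * b * pvec g := by fun_prop
        exact map_mem_closure (f := fun b : Toeplitz S => star (pvec f) * b * pvec g) hc hb
          fun x hx => star_pvec_mul_mul_pvec_mem f g hx
      · rw [map_mul, map_mul, h0, mul_zero, zero_mul]
    have h2 : ∀ a a' : C(X, ℂ), tsupport a ⊆ S.U → tsupport a' ⊆ S.U →
        fn S a * (b * fn S a') ∈ J := fun a a' ha ha' => by
      refine fn_mul_mem_of_forall hR (fun f => ?_) ha
      rw [← mul_assoc]
      exact mul_fn_mem_of_forall hR (fun g => h1 f g) ha'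
    refine mem_of_forall_exists_norm_sub_le hJ fun ε hε => ?_
    -- Two pieces of `b` will be approximated from `J`, each with error 3 · ε/6.
    obtain ⟨x, hx, hbx⟩ := Metric.mem_closure_iff.mp hb (ε / 6) (by positivity)
    rw [dist_eq_norm] at hbx
    obtain ⟨K, hK, hKU, hKx⟩ := exists_eq_fn_of_cutoff hx
    obtain ⟨a, ha, ha1, han, han', -⟩ := exists_cutoff hK S.U.isOpen hKU
    obtain ⟨⟨c, hc⟩, ⟨d, hd⟩⟩ := hKx a ha1
    have hsub : ∀ y, ‖(1 - a) y‖ ≤ 1 := han'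
    obtain ⟨j₁, hj₁, hle₁⟩ := exists_norm_sub_le_of_norm_sub_fn_le hV hfn
      (x := fn S (1 - a) * b) (c := c) (by rw [map_mul, h0, mul_zero])
      (by positivity : 0 < ε / 6) (by
        rw [← hc, ← mul_sub]
        exact (norm_fn_mul_le hsub _).trans hbx.le)
    obtain ⟨j₂, hj₂, hle₂⟩ := exists_norm_sub_le_of_norm_sub_fn_le hV hfn
      (x := fn S a * (b * fn S (1 - a))) (c := a * d) (by
        rw [map_mul, map_mul, h0, zero_mul, mul_zero])
      (by positivity : 0 < ε / 6) (by
        rw [fn_mul, ← hd, ← mul_sub, ← sub_mul]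
        exact (norm_fn_mul_le han _).trans ((norm_mul_fn_le hsub _).trans hbx.le))
    refine ⟨fn S a * (b * fn S a) + j₂ + j₁,
      J.add_mem (J.add_mem (h2 a a ha ha) hj₂) hj₁, ?_⟩
    -- The splitting `b = a b a + a b (1 - a) + (1 - a) b`, whose first term is in `J`.
    have h3 : b - (fn S a * (b * fn S a) + j₂ + j₁) =
        (fn S (1 - a) * b - j₁) + (fn S a * (b * fn S (1 - a)) - j₂) := by
      rw [fn_sub, fn_one]
      noncomm_ring
    rw [h3]
    refine (norm_add_le _ _).trans ?_
    linarith

/-- On the core, the orbit representation on `X \ V` is injective modulo `J`. -/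
theorem mem_of_mem_gaugeCore_of_orbitHom_eq_zero {b : Toeplitz S} (hb : b ∈ gaugeCore S)
    (h0 : orbitHom hV b = 0) : b ∈ J := by
  -- An approximant of finite depth to an element of the kernel need not be in the kernel; its image
  -- is only small. Functional calculus moves it close to `J`, which requires it to be self-adjoint:
  -- hence `star b * b` instead of `b`, and the real part `w` of the approximant.
  refine mem_of_star_mul_self_mem hJ (mem_of_forall_exists_norm_sub_le hJ fun ε hε => ?_)
  set x := star b * b with hx
  have hx0 : orbitHom hV x = 0 := by rw [hx, map_mul, h0, mul_zero]
  obtain ⟨k, z, hz, hxz⟩ := exists_norm_sub_lt_of_mem_gaugeCore (star_mul_self_mem_gaugeCore hb)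
    (half_pos hε)
  set w := (2 : ℂ)⁻¹ • (z + star z) with hw
  have hwsa : IsSelfAdjoint w := by
    rw [IsSelfAdjoint, hw, star_smul, star_add, star_star, add_comm]
    simp
  have hxw : ‖x - w‖ ≤ ε / 2 := by
    have h1 : x - w = (2 : ℂ)⁻¹ • ((x - z) + star (x - z)) := by
      have h2 : star x = x := by rw [hx, star_mul, star_star]
      rw [star_sub, h2, hw, ← sub_eq_zero]
      module
    rw [h1, norm_smul]
    have h2 := norm_add_le (x - z) (star (x - z))
    rw [norm_star] at h2
    have h3 : ‖(2 : ℂ)⁻¹‖ = 2⁻¹ := by simp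
    rw [h3]
    change ‖x - z‖ < _ at hxz
    linarith
  obtain ⟨j, hj, hle⟩ := exists_norm_sub_le_of_norm_map_le (orbitHom hV)
    (coreStarAlg S k).topologicalClosure (coreStarAlg S k).isClosed_topologicalClosure J
    (fun b hb h => mem_of_mem_closure_coreAlg (k := k) hV hfn hJ hR hb h) (b := w)
    (subset_closure ((coreAlg S k).smul_mem _ ((coreAlg S k).add_mem hz (star_mem_coreAlg hz))))
    hwsa (half_pos hε).le (by
      have h1 : orbitHom hV w = - orbitHom hV (x - w) := by rw [map_sub, hx0]; simp
      rw [h1, norm_neg]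
      exact (norm_orbitHom_le hV _).trans hxw)
  refine ⟨j, hj, ?_⟩
  have h1 : x - j = (x - w) + (w - j) := by abel
  rw [h1]
  exact (norm_add_le _ _).trans (by linarith)

end Kernel

/-! ### Localization: elements of the core that lie in an ideal. -/

/-- Elements of the core are locally multiplication operators, modulo redundancies. -/
lemma exists_fn_mul_mul_fn_sub_mem {k : ℕ} {x : Toeplitz S} (hx : x ∈ coreAlg S k) (y : X) :
    ∃ h : C(X, ℂ), h y = 1 ∧ (∀ z, ‖h z‖ ≤ 1) ∧
      ∃ g, fn S h * x * fn S h - fn S g ∈ redundancyIdeal S := by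
  induction k generalizing x y with
  | zero =>
    refine coreAlg_zero_induction (p := fun x => ∃ h : C(X, ℂ), h y = 1 ∧ (∀ z, ‖h z‖ ≤ 1) ∧
      ∃ g, fn S h * x * fn S h - fn S g ∈ redundancyIdeal S) (fun a => ?_) hx
    exact ⟨1, rfl, by simp, 1 * a * 1, by rw [fn_mul, fn_mul, sub_self]; exact Ideal.zero_mem _⟩
  | succ k ih =>
    refine coreAlg_succ_induction (p := fun x => ∃ h : C(X, ℂ), h y = 1 ∧ (∀ z, ‖h z‖ ≤ 1) ∧
      ∃ g, fn S h * x * fn S h - fn S g ∈ redundancyIdeal S) (fun a => ?_)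
      (fun f g x hx => ?_) (fun x₁ x₂ h₁ h₂ => ?_) hx
    · exact ⟨1, rfl, by simp, 1 * a * 1, by rw [fn_mul, fn_mul, sub_self]; exact Ideal.zero_mem _⟩
    · by_cases hy : y ∈ S.U
      · obtain ⟨W, hWo, hyW, hW⟩ := exists_isBisection ⟨y, hy⟩
        obtain ⟨a, ha, ha1, han, -⟩ := exists_bump hWo hyW
        -- The localizer at `y` is `a · (h' ∘ σ)`: `a` restricts to a bisection, and `h'` passes
        -- through the creation to localize the inner factor at σ(y).
        obtain ⟨h', hh1, hhn, g', hg'⟩ := ih hx (S.σ ⟨y, hy⟩)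
        let a' : PreMod S := of a (ha.trans hW.subset)
        let h : C(X, ℂ) := (a' <• h').1
        have hval : ∀ z : S.U, h z = a z * h' (S.σ z) := fun z => rsmul_apply a' h' z
        have hz0 : ∀ z, a z ≠ 0 → z ∈ W := fun z hz => ha (subset_tsupport _ hz)
        refine ⟨h, ?_, fun z => ?_, ?_⟩
        · rw [hval ⟨y, hy⟩, ha1, hh1, mul_one]
        · by_cases hz : z ∈ S.U
          · rw [hval ⟨z, hz⟩, norm_mul]
            exact mul_le_one₀ (han z) (norm_nonneg _) (hhn _)
          · have : h z = 0 := (a' <• h').apply_notMem hz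
            rw [this, norm_zero]
            exact zero_le_one
        · have h1 : fn S h * pvec f = pvec (a • f) * fn S h' := by
            rw [fn_mul_pvec, pvec_mul_fn]
            congr 1
            refine PreMod.ext_mem fun z => ?_
            rw [lsmul_apply, rsmul_apply, lsmul_apply, hval]
            ring
          have h2 : star (pvec g) * fn S h = fn S h' * star (pvec (star a • g)) := by
            rw [star_pvec_mul_fn, fn_mul_star_pvec]
            congr 2
            refine PreMod.ext_mem fun z => ?_
            rw [lsmul_apply, rsmul_apply, lsmul_apply, ContinuousMap.star_apply,
              ContinuousMap.star_apply, ContinuousMap.star_apply, hval, star_mul]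
            ring
          have h3 : fn S h * (pvec f * x * star (pvec g)) * fn S h =
              pvec (a • f) * (fn S h' * x * fn S h') * star (pvec (star a • g)) := by
            calc _ = (fn S h * pvec f) * x * (star (pvec g) * fn S h) := by
                  simp only [mul_assoc]
              _ = _ := by rw [h1, h2]; simp only [mul_assoc]
          have h4 := fn_sub_vec_mul_star_vec_mem hW (f := (a • f) <• g') (g := star a • g)
            (fun z hz => by
              by_cases hzU : z ∈ S.U
              · refine hz0 z fun h0 => hz ?_
                rw [rsmul_apply _ _ ⟨z, hzU⟩, lsmul_apply, h0, zero_mul, zero_mul]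
              · exact (hz (apply_notMem _ hzU)).elim)
            (fun z hz => hz0 z fun h0 => hz (by
              rw [lsmul_apply, ContinuousMap.star_apply, h0, star_zero, zero_mul]))
          refine ⟨((a • f) <• g').1 * star (star a • g).1, ?_⟩
          change fn S _ - pvec _ * star (pvec _) ∈ _ at h4
          -- Modulo redundancies the inner factor becomes the function `g'`; the product of a
          -- creation and an annihilation that remains is supported in a bisection, so it too is a
          -- function, by `h4`.
          have h5 : pvec (a • f) * (fn S h' * x * fn S h' - fn S g') * star (pvec (star a • g)) ∈
              redundancyIdeal S :=
            Ideal.mul_mem_right _ _ (Ideal.mul_mem_left _ _ hg')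
          have h6 := Ideal.sub_mem _ h5 h4
          rw [h3]
          convert h6 using 1
          rw [mul_sub, sub_mul, pvec_mul_fn]
          abel
      -- For `y ∉ U`, a bump off the support of `f` kills the whole term.
      · obtain ⟨h, hh, hh1, hhn, -⟩ := exists_bump (isClosed_tsupport f.1).isOpen_compl
          (x := y) fun hy' => hy (f.2 hy')
        refine ⟨h, hh1, hhn, 0, ?_⟩
        have : fn S h * pvec f = 0 := by
          rw [fn_mul_pvec]
          refine pvec_eq_zero fun z => ?_
          rw [lsmul_apply]
          by_cases hz : z ∈ tsupport f.1
          · have : h z = 0 := by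
              by_contra h0
              exact hh (subset_tsupport _ h0) hz
            rw [this, zero_mul]
          · have : f z = 0 := image_eq_zero_of_notMem_tsupport hz
            rw [this, mul_zero]
        rw [← mul_assoc, ← mul_assoc, this, fn_zero]
        simp
    · obtain ⟨h, hh1, hhn, g, hg⟩ := h₁
      obtain ⟨h', hh1', hhn', g', hg'⟩ := h₂
      refine ⟨h * h', by simp [hh1, hh1'], fun z => ?_, h' * g * h' + h * g' * h, ?_⟩
      · rw [ContinuousMap.mul_apply, norm_mul]
        exact mul_le_one₀ (hhn z) (norm_nonneg _) (hhn' z)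
      · have e1 : fn S h' * (fn S h * x₁ * fn S h - fn S g) * fn S h' ∈ redundancyIdeal S :=
          Ideal.mul_mem_right _ _ (Ideal.mul_mem_left _ _ hg)
        have e2 : fn S h * (fn S h' * x₂ * fn S h' - fn S g') * fn S h ∈ redundancyIdeal S :=
          Ideal.mul_mem_right _ _ (Ideal.mul_mem_left _ _ hg')
        have e3 := Ideal.add_mem _ e1 e2
        have hcomm : fn S h * fn S h' = fn S h' * fn S h := by
          rw [← fn_mul, mul_comm, fn_mul]
        convert e3 using 1
        simp only [fn_add, fn_mul]
        have e4 : fn S h * fn S h' * (x₁ + x₂) * (fn S h * fn S h') =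
            fn S h' * (fn S h * x₁ * fn S h) * fn S h' +
              fn S h * (fn S h' * x₂ * fn S h') * fn S h := by
          rw [mul_add, add_mul]
          congr 1
          · conv_lhs => rw [hcomm]
            conv_lhs => rw [← hcomm]
            nth_rewrite 1 [hcomm]
            simp only [mul_assoc]
          · nth_rewrite 2 [hcomm]
            simp only [mul_assoc]
        rw [e4]
        noncomm_ring

/-- The norm of a function modulo `I` dominates its values off `V`. If ‖g - t‖ < r < |g(y)|, invert
`g` near `y` by some `h` with ‖h‖ ≤ 1/r. Then `1 - h (g - t)` is invertible, and multiplied on the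
left by a bump `v` at `y` it becomes `v h t ∈ I`. So `v ∈ I`, although `v y = 1`. -/
lemma norm_apply_le_of_mem {I : TwoSidedIdeal (Toeplitz S)} {V : Opens X}
    (hI : ∀ a, fn S a ∈ I → a ∈ C₀ V) {t : Toeplitz S} (ht : t ∈ I) (g : C(X, ℂ)) {y : X}
    (hy : y ∉ V) : ‖g y‖ ≤ ‖fn S g - t‖ := by
  by_contra! hlt
  obtain ⟨r, hr, hrg⟩ := exists_between hlt
  have hr0 : 0 < r := (norm_nonneg _).trans_lt hr
  have hO : IsOpen {z | r < ‖g z‖} := isOpen_lt continuous_const (by fun_prop)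
  obtain ⟨v, hv, hv1, -⟩ := exists_bump hO hrg
  obtain ⟨u, hu, hu1, hun, -⟩ := exists_cutoff (isClosed_tsupport v) hO hv
  -- This is `u / g` on the set |g| > r that contains the support of `u`; the maximum keeps the
  -- denominator positive everywhere.
  let h : C(X, ℂ) := ⟨fun z => u z * star (g z) / ((max (r ^ 2) (‖g z‖ ^ 2) : ℝ) : ℂ), by
    refine Continuous.div (by fun_prop) (by fun_prop) fun z => ?_
    have : 0 < max (r ^ 2) (‖g z‖ ^ 2) := lt_max_of_lt_left (by positivity)
    exact_mod_cast this.ne'⟩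
  have hval : ∀ z, h z = u z * star (g z) / ((max (r ^ 2) (‖g z‖ ^ 2) : ℝ) : ℂ) := fun z => rfl
  have hhg : h * g = u := by
    ext z
    rw [ContinuousMap.mul_apply, hval]
    by_cases hz : r < ‖g z‖
    · have h1 : max (r ^ 2) (‖g z‖ ^ 2) = ‖g z‖ ^ 2 :=
        max_eq_right (by gcongr)
      have h2 : g z ≠ 0 := fun h0 => by
        rw [h0, norm_zero] at hz
        exact absurd hz (not_lt.mpr hr0.le)
      have h3 : ((‖g z‖ ^ 2 : ℝ) : ℂ) = star (g z) * g z := by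
        rw [Complex.star_def, Complex.conj_mul']
        push_cast; rfl
      rw [h1, h3, mul_div_mul_comm]
      have h4 : star (g z) ≠ 0 := star_ne_zero.mpr h2
      field_simp
    · have : u z = 0 := by
        by_contra h0
        exact hz (hu (subset_tsupport _ h0))
      simp [this]
  have hhn : ‖h‖ ≤ r⁻¹ := by
    refine (ContinuousMap.norm_le _ (by positivity)).mpr fun z => ?_
    have hm : 0 < max (r ^ 2) (‖g z‖ ^ 2) := lt_max_of_lt_left (by positivity)
    rw [hval, norm_div, norm_mul, norm_star, Complex.norm_real, Real.norm_of_nonneg hm.le,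
      div_le_iff₀ hm]
    have h1 : ‖u z‖ * ‖g z‖ ≤ ‖g z‖ := mul_le_of_le_one_left (norm_nonneg _) (hun z)
    refine h1.trans ?_
    rw [← div_eq_inv_mul, le_div_iff₀ hr0]
    rcases le_total r ‖g z‖ with hz | hz
    · exact le_max_of_le_right (by nlinarith [norm_nonneg (g z)])
    · exact le_max_of_le_left (by nlinarith [norm_nonneg (g z)])
  have hs : ‖fn S h * (fn S g - t)‖ < 1 := by
    calc ‖fn S h * (fn S g - t)‖ ≤ ‖fn S h‖ * ‖fn S g - t‖ := norm_mul_le _ _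
      _ ≤ r⁻¹ * ‖fn S g - t‖ := by gcongr; exact (norm_fn_le h).trans hhn
      _ < r⁻¹ * r := by gcongr
      _ = 1 := inv_mul_cancel₀ hr0.ne'
  obtain ⟨w, hw⟩ := isUnit_one_sub_of_norm_lt_one hs
  have hvu : v * u = v := by
    ext z
    rw [ContinuousMap.mul_apply]
    by_cases hz : z ∈ tsupport v
    · rw [hu1 z hz, mul_one]
    · rw [image_eq_zero_of_notMem_tsupport hz, zero_mul]
  have h1 : fn S v * (1 - fn S h * (fn S g - t)) = fn S v * (fn S h * t) := by
    have h0 : fn S v * (fn S h * fn S g) = fn S v := by rw [← fn_mul, ← fn_mul, hhg, hvu]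
    rw [mul_sub, mul_one, mul_sub, mul_sub, h0, sub_sub_cancel]
  have h2 : fn S v = fn S v * (fn S h * t) * ↑w⁻¹ := by
    rw [← h1, ← hw, mul_assoc, Units.mul_inv, mul_one]
  have h3 : fn S v ∈ I := by
    rw [h2]
    exact I.mul_mem_right _ _ (I.mul_mem_left _ _ (I.mul_mem_left _ _ ht))
  have h4 := hI v h3 y hy
  rw [hv1] at h4
  exact one_ne_zero h4

/-- The elements of the core in an ideal `I` with `I ∩ C(X) ⊆ C₀(V)` vanish in the orbit
representation on `X \ V`. -/
theorem orbitHom_eq_zero_of_mem_gaugeCore {V : Opens X} (hV : IsInvariant S (V : Set X))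
    {I : TwoSidedIdeal (Toeplitz S)} (hR : ∀ x ∈ redundancyIdeal S, x ∈ I)
    (hI : ∀ a, fn S a ∈ I → a ∈ C₀ V) {b : Toeplitz S} (hb : b ∈ gaugeCore S) (hbI : b ∈ I) :
    orbitHom hV b = 0 := by
  -- If `x` of finite depth is ε/2-close to `b ∈ I`, and `h x h` is the function `g` modulo
  -- redundancies, then `g` is ε/2-close to `I`, so |g(y)| ≤ ε/2. As `h y = 1`, the value `g y` is
  -- the diagonal coefficient of `x` at `y`.
  have key : ∀ b ∈ gaugeCore S, b ∈ I → ∀ y : {x // x ∉ (V : Set X)}, diag hV b y = 0 := by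
    intro b hb hbI y
    refine norm_le_zero_iff.mp (le_of_forall_pos_le_add fun ε hε => ?_)
    obtain ⟨k, x, hx, hbx⟩ := exists_norm_sub_lt_of_mem_gaugeCore hb (half_pos hε)
    obtain ⟨h, hh1, hhn, g, hg⟩ := exists_fn_mul_mul_fn_sub_mem hx (y : X)
    have ht : fn S h * b * fn S h - (fn S h * x * fn S h - fn S g) ∈ I :=
      I.sub_mem (I.mul_mem_right _ _ (I.mul_mem_left _ _ hbI)) (hR _ hg)
    have h1 := norm_apply_le_of_mem hI ht g y.2
    have h2 : fn S g - (fn S h * b * fn S h - (fn S h * x * fn S h - fn S g)) =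
        - (fn S h * (b - x) * fn S h) := by noncomm_ring
    rw [h2, norm_neg] at h1
    have h3 : ‖g y‖ ≤ ε / 2 :=
      h1.trans ((norm_mul_fn_le hhn _).trans ((norm_fn_mul_le hhn _).trans hbx.le))
    have h4 : diag hV x y = g y := by
      have h5 := orbitHom_eq_zero hV hg
      have h6 : diag hV (fn S h * x * fn S h - fn S g) y = 0 := by
        rw [diag, h5]; simp
      rw [diag_sub, diag_fn, sub_eq_zero] at h6
      rw [← h6, diag, diag, map_mul, map_mul, mul_apply_eq_comp, mul_apply_eq_comp, fn_δ,
        orbitHom_fn, hh1, one_smul, mulOp_apply, hh1, one_mul]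
    have h5 := norm_diag_le hV (b - x) y
    rw [diag_sub, h4] at h5
    have h6 := norm_add_le (diag hV b y - g y) (g y)
    rw [sub_add_cancel] at h6
    linarith
  -- The diagonal coefficient of `star b * b` at `y` is the squared norm of the image of `δ y` under
  -- `b`.
  refine ext_δ fun y => ?_
  have h := key _ (star_mul_self_mem_gaugeCore hb) (I.mul_mem_left _ _ hbI) y
  rw [diag_star_mul_self] at h
  have h2 : ‖orbitHom hV b (δ y)‖ ^ 2 = 0 := by exact_mod_cast h
  simpa using h2
-- Monomials and the gauge action.
namespace Toeplitz

/-- The product of the creations attached to a list of functions. -/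
def word (l : List (PreMod S)) : Toeplitz S := (l.map pvec).prod

lemma word_nil : word ([] : List (PreMod S)) = 1 := rfl

lemma word_cons (f : PreMod S) (l : List (PreMod S)) : word (f :: l) = pvec f * word l :=
  List.prod_cons

lemma word_append_singleton (l : List (PreMod S)) (f : PreMod S) :
    word (l ++ [f]) = word l * pvec f := by simp [word]

/-- Products of creations, a function, and annihilations. -/
def monomial (l : List (PreMod S)) (a : C(X, ℂ)) (l' : List (PreMod S)) : Toeplitz S :=
  word l * fn S a * star (word l')

lemma monomial_cons (f : PreMod S) (l : List (PreMod S)) (a : C(X, ℂ)) (l' : List (PreMod S)) :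
    monomial (f :: l) a l' = pvec f * monomial l a l' := by
  simp only [monomial, word_cons, mul_assoc]

lemma monomial_nil (a : C(X, ℂ)) (l' : List (PreMod S)) :
    monomial [] a l' = fn S a * star (word l') := by
  simp only [monomial, word_nil, one_mul]

variable (S) in
/-- The set of monomials in the generators. -/
def monomials : Set (Toeplitz S) := {x | ∃ l a l', x = monomial l a l'}

lemma fn_mul_monomials (a : C(X, ℂ)) {x : Toeplitz S} (hx : x ∈ monomials S) :
    fn S a * x ∈ monomials S := by
  obtain ⟨l, b, l', rfl⟩ := hx
  cases l with
  | nil => exact ⟨[], a * b, l', by rw [monomial_nil, monomial_nil, fn_mul, mul_assoc]⟩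
  | cons f l =>
    exact ⟨(a • f) :: l, b, l', by
      rw [monomial_cons, monomial_cons, ← mul_assoc, fn_mul_pvec]⟩

lemma pvec_mul_monomials (f : PreMod S) {x : Toeplitz S} (hx : x ∈ monomials S) :
    pvec f * x ∈ monomials S := by
  obtain ⟨l, b, l', rfl⟩ := hx
  exact ⟨f :: l, b, l', (monomial_cons _ _ _ _).symm⟩

lemma star_pvec_mul_monomials (f : PreMod S) {x : Toeplitz S} (hx : x ∈ monomials S) :
    star (pvec f) * x ∈ monomials S := by
  obtain ⟨l, b, l', rfl⟩ := hx
  cases l with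
  | nil =>
    -- The annihilation absorbs `b`, and its function goes to the end of the list because `star`
    -- reverses words.
    refine ⟨[], 1, l' ++ [star b • f], ?_⟩
    rw [monomial_nil, monomial_nil, ← mul_assoc, star_pvec_mul_fn, fn_one, one_mul,
      word_append_singleton, star_mul]
  | cons g l =>
    rw [monomial_cons, ← mul_assoc, star_pvec_mul_pvec]
    exact fn_mul_monomials _ ⟨l, b, l', rfl⟩

lemma mul_mem_closure_span {s : Set (Toeplitz S)} {c : Toeplitz S}
    (h : ∀ x ∈ s, c * x ∈ s) {x : Toeplitz S}
    (hx : x ∈ (Submodule.span ℂ s).topologicalClosure) :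
    c * x ∈ (Submodule.span ℂ s).topologicalClosure := by
  refine map_mem_closure (f := fun x => c * x) (by fun_prop) hx fun x hx => ?_
  refine Submodule.span_induction (p := fun x _ => c * x ∈ Submodule.span ℂ s)
    (fun x hx => Submodule.subset_span (h x hx)) (by simp) (fun x y _ _ hx hy => ?_)
    (fun a x _ hx => ?_) hx
  · rw [mul_add]; exact Submodule.add_mem _ hx hy
  · rw [mul_smul_comm]; exact Submodule.smul_mem _ _ hx

lemma coe_algebraMap (c : ℂ) : ((algebraMap ℂ (FreeToeplitz S) c : FreeToeplitz S) : Toeplitz S) =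
    algebraMap ℂ (Toeplitz S) c := rfl

lemma coe_ι_adj (m : HilbMod S) :
    ((FreeToeplitz.ι (.adj m) : FreeToeplitz S) : Toeplitz S) = star (vec m) := by
  rw [vec, ← coe_star, FreeToeplitz.star_ι]; rfl

/-- The closed span contains 1 and is stable under left multiplication by every generator: an
annihilation that meets a creation contracts to a function, and a function is absorbed by the next
creation. -/
lemma closure_span_monomials : (Submodule.span ℂ (monomials S)).topologicalClosure = ⊤ := by
  set P := (Submodule.span ℂ (monomials S)).topologicalClosure with hP
  have hcl : IsClosed (P : Set (Toeplitz S)) := Submodule.isClosed_topologicalClosure _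
  have hgen : ∀ g : Gen S, ∀ y ∈ P, ((FreeToeplitz.ι g : FreeToeplitz S) : Toeplitz S) * y ∈ P := by
    rintro (a | m | m) y hy
    · exact mul_mem_closure_span (fun x => fn_mul_monomials a) hy
    · change vec m * y ∈ P
      refine Completion.induction_on m (hcl.preimage (continuous_vec.mul continuous_const))
        fun f => ?_
      exact mul_mem_closure_span (fun x => pvec_mul_monomials f) hy
    · rw [coe_ι_adj]
      refine Completion.induction_on m
        (hcl.preimage ((continuous_vec (S := S)).star.mul continuous_const)) fun f => ?_
      exact mul_mem_closure_span (fun x => star_pvec_mul_monomials f) hy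
  have hmul : ∀ x : FreeToeplitz S, ∀ y ∈ P, (x : Toeplitz S) * y ∈ P := by
    intro x
    refine FreeToeplitz.induction (p := fun x => ∀ y ∈ P, (x : Toeplitz S) * y ∈ P)
      (fun c y hy => ?_) (fun g y hy => ?_) (fun x y hx hy z hz => ?_) (fun x y hx hy z hz => ?_) x
    · rw [coe_algebraMap, ← Algebra.smul_def]
      exact P.smul_mem c hy
    · exact hgen g y hy
    · rw [Completion.coe_mul, mul_assoc]
      exact hx _ (hy _ hz)
    · rw [Completion.coe_add, add_mul]
      exact P.add_mem (hx _ hz) (hy _ hz)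
  have h1 : (1 : Toeplitz S) ∈ P := subset_closure (Submodule.subset_span
    ⟨[], 1, [], by rw [monomial_nil, word_nil, fn_one, star_one, mul_one]⟩)
  rw [eq_top_iff]
  intro x _
  refine Completion.induction_on x hcl fun x => ?_
  rw [← mul_one (x : Toeplitz S)]
  exact hmul x 1 h1

/-- A property of elements of the Toeplitz algebra holds everywhere if it is closed, linear, and
true for monomials. -/
lemma monomial_induction {p : Toeplitz S → Prop} (hcl : IsClosed {x | p x})
    (hmon : ∀ l a l', p (monomial l a l')) (hadd : ∀ x y, p x → p y → p (x + y))
    (hsmul : ∀ (c : ℂ) x, p x → p (c • x)) (x : Toeplitz S) : p x := by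
  have hx : x ∈ (Submodule.span ℂ (monomials S)).topologicalClosure := by
    rw [closure_span_monomials]; trivial
  refine hcl.closure_subset_iff.mpr (fun x hx => ?_) hx
  refine Submodule.span_induction (p := fun x _ => p x) ?_ ?_ (fun x y _ _ => hadd x y)
    (fun c x _ => hsmul c x) hx
  · rintro _ ⟨l, a, l', rfl⟩
    exact hmon l a l'
  · have h := hsmul 0 _ (hmon [] 0 [])
    rwa [zero_smul] at h

lemma gauge_pvec (z : Circle) (f : PreMod S) : gauge S z (pvec f) = (z : ℂ) • pvec f :=
  gauge_vec z _

lemma gauge_word (z : Circle) (l : List (PreMod S)) :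
    gauge S z (word l) = ((z ^ l.length : Circle) : ℂ) • word l := by
  induction l with
  | nil => simp [word_nil]
  | cons f l ih =>
    rw [word_cons, map_mul, ih, gauge_pvec, smul_mul_smul_comm, List.length_cons, pow_succ']
    simp

lemma gauge_monomial (z : Circle) (l : List (PreMod S)) (a : C(X, ℂ)) (l' : List (PreMod S)) :
    gauge S z (monomial l a l') =
      ((z ^ ((l.length : ℤ) - l'.length) : Circle) : ℂ) • monomial l a l' := by
  rw [monomial, map_mul, map_mul, gauge_star, gauge_word, gauge_word, gauge_fn, star_smul,
    smul_mul_assoc, smul_mul_smul_comm]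
  congr 1
  rw [zpow_sub, zpow_natCast, zpow_natCast, Circle.coe_mul, Circle.coe_inv_eq_conj]
  rfl

lemma gauge_mul (z w : Circle) (x : Toeplitz S) : gauge S (z * w) x = gauge S z (gauge S w x) := by
  refine monomial_induction (p := fun x => gauge S (z * w) x = gauge S z (gauge S w x))
    (isClosed_eq (continuous_gauge _) ((continuous_gauge _).comp (continuous_gauge _)))
    (fun l a l' => ?_) (fun x y hx hy => ?_) (fun c x hx => ?_) x
  · rw [gauge_monomial, gauge_monomial, gauge_smul, gauge_monomial, smul_smul, mul_zpow,
      Circle.coe_mul, mul_comm]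
  · rw [map_add, map_add, map_add, hx, hy]
  · rw [gauge_smul, gauge_smul, gauge_smul, hx]

lemma gauge_one (x : Toeplitz S) : gauge S 1 x = x := by
  refine monomial_induction (p := fun x => gauge S 1 x = x)
    (isClosed_eq (continuous_gauge _) continuous_id)
    (fun l a l' => ?_) (fun x y hx hy => ?_) (fun c x hx => ?_) x
  · rw [gauge_monomial, one_zpow, Circle.coe_one, one_smul]
  · rw [map_add, hx, hy]
  · rw [gauge_smul, hx]

/-- Monomials are eigenvectors with eigenvalue a power of `z`. The gauge maps are contractive, so
limits of such elements have orbits that are uniform limits of continuous ones. -/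
lemma continuous_gauge_apply (x : Toeplitz S) : Continuous fun z : Circle => gauge S z x := by
  refine monomial_induction (p := fun x => Continuous fun z : Circle => gauge S z x)
    ?_ (fun l a l' => ?_) (fun x y hx hy => ?_) (fun c x hx => ?_) x
  · rw [← closure_subset_iff_isClosed]
    intro x hx
    refine continuous_of_uniform_approx_of_continuous fun u hu => ?_
    obtain ⟨ε, hε, hεu⟩ := Metric.mem_uniformity_dist.mp hu
    obtain ⟨y, hy, hd⟩ := Metric.mem_closure_iff.mp hx ε hε
    refine ⟨_, hy, fun z => hεu ?_⟩
    rw [dist_eq_norm, ← map_sub]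
    rw [dist_eq_norm] at hd
    exact (norm_gauge_le z _).trans_lt hd
  · simp only [gauge_monomial]
    have h : ∀ n : ℤ, Continuous fun z : Circle => ((z ^ n : Circle) : ℂ) := fun n => by
      simp only [Circle.coe_zpow]
      exact (continuous_subtype_val : Continuous fun z : Circle => (z : ℂ)).zpow₀ _ fun z => .inl (Circle.coe_ne_zero z)
    exact (h _).smul continuous_const
  · simp only [map_add]
    exact hx.add hy
  · simp only [gauge_smul]
    exact hx.const_smul c

/-- The balanced monomials lie in the core. -/
lemma monomial_mem_coreAlg (l : List (PreMod S)) (a : C(X, ℂ)) (l' : List (PreMod S))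
    (h : l.length = l'.length) : monomial l a l' ∈ coreAlg S l.length := by
  induction l generalizing l' with
  | nil =>
    obtain rfl : l' = [] := List.length_eq_zero_iff.mp h.symm
    rw [monomial_nil, word_nil, star_one, mul_one]
    exact fn_mem_coreAlg _ _
  | cons f l ih =>
    cases l' with
    | nil => simp at h
    | cons g l' =>
      have h1 : monomial (f :: l) a (g :: l') = pvec f * monomial l a l' * star (pvec g) := by
        simp only [monomial, word_cons, star_mul, mul_assoc]
      rw [h1]
      exact pvec_mul_mul_star_pvec_mem f g (ih l' (by simpa using h))

lemma gaugeCore_eq : gaugeCore S =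
    ((⨆ k, coreAlg S k).topologicalClosure : Submodule ℂ (Toeplitz S)) := by
  rw [gaugeCore, Submodule.topologicalClosure_coe,
    Submodule.coe_iSup_of_directed _ coreAlg_mono.directed_le]

/-! ### Spectral components. -/

open MeasureTheory AddCircle

instance fact_zero_lt_one : Fact ((0 : ℝ) < 1) := ⟨zero_lt_one⟩

/-- The orbit of `x` under the gauge action, as a function on `ℝ / ℤ`. -/
def orbit (x : Toeplitz S) (t : AddCircle (1 : ℝ)) : Toeplitz S := gauge S (toCircle t) x

lemma continuous_orbit (x : Toeplitz S) : Continuous (orbit x) :=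
  (continuous_gauge_apply x).comp AddCircle.continuous_toCircle

/-- The spectral component of `x` of degree `n`. -/
def component (n : ℤ) (x : Toeplitz S) : Toeplitz S := fourierCoeff (orbit x) n

lemma integrable_orbit (n : ℤ) (x : Toeplitz S) :
    Integrable (fun t => fourier n t • orbit x t) haarAddCircle :=
  ((fourier n).continuous.smul (continuous_orbit x)).integrable_of_hasCompactSupport
    (HasCompactSupport.of_compactSpace _)

/-- The component is an average, for a probability measure, of points of the closed convex set `I`.
-/
lemma component_mem {I : TwoSidedIdeal (Toeplitz S)} (hI : IsClosed (I : Set (Toeplitz S)))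
    (hg : ∀ z : Circle, ∀ x ∈ I, gauge S z x ∈ I) (n : ℤ) {x : Toeplitz S} (hx : x ∈ I) :
    component n x ∈ I := by
  have hc : Convex ℝ (I : Set (Toeplitz S)) := by
    intro x hx y hy a b _ _ _
    refine I.add_mem ?_ ?_
    · rw [Algebra.smul_def]; exact I.mul_mem_left _ _ hx
    · rw [Algebra.smul_def]; exact I.mul_mem_left _ _ hy
  refine hc.integral_mem hI (Filter.Eventually.of_forall fun t => ?_) (integrable_orbit _ x)
  change _ • _ ∈ I
  rw [Algebra.smul_def]
  exact I.mul_mem_left _ _ (hg _ x hx)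

/-- Translation invariance of Haar measure transfers the rotation of the orbit to the character. -/
lemma gauge_component (s : AddCircle (1 : ℝ)) (n : ℤ) (x : Toeplitz S) :
    gauge S (toCircle s) (component n x) = fourier n s • component n x := by
  let G : Toeplitz S →L[ℂ] Toeplitz S :=
    { toFun := gauge S (toCircle s), map_add' := map_add _, map_smul' := gauge_smul _
      cont := continuous_gauge _ }
  change G (∫ t, fourier (-n) t • orbit x t ∂haarAddCircle) = _
  rw [← G.integral_comp_comm (integrable_orbit _ x), component, fourierCoeff, ← integral_smul,
    ← integral_add_right_eq_self (fun t => fourier n s • fourier (-n) t • orbit x t) s]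
  congr 1
  ext1 t
  rw [map_smul]
  change _ • gauge S (toCircle s) (gauge S (toCircle t) x) = _
  rw [← gauge_mul, ← toCircle_add, add_comm s t, smul_smul]
  congr 1
  simp only [fourier_apply, zsmul_add, toCircle_add, neg_smul, toCircle_neg]
  have h : (toCircle (n • s) : ℂ) ≠ 0 := Circle.coe_ne_zero _
  rw [Circle.coe_inv, Circle.coe_inv, Circle.coe_mul]
  field_simp

lemma norm_component_sub_le (n : ℤ) (x y : Toeplitz S) :
    ‖component n x - component n y‖ ≤ ‖x - y‖ := by
  rw [component, component, fourierCoeff, fourierCoeff,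
    ← integral_sub (integrable_orbit _ x) (integrable_orbit _ y)]
  refine (norm_integral_le_of_norm_le_const (C := ‖x - y‖)
    (Filter.Eventually.of_forall fun t => ?_)).trans_eq (by simp)
  rw [← smul_sub, norm_smul, orbit, orbit, ← map_sub]
  have h : ‖fourier (-n) t‖ = 1 := Circle.norm_coe _
  rw [h, one_mul]
  exact norm_gauge_le _ _

/-- Averaging fixes the balanced monomials, which are in the core, and kills the others, because a
nontrivial character has integral zero. The average is contractive, which extends this to all
elements. -/
lemma component_zero_mem_gaugeCore (x : Toeplitz S) : component 0 x ∈ gaugeCore S := by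
  rw [gaugeCore_eq]
  set P : Submodule ℂ (Toeplitz S) := (⨆ k, coreAlg S k).topologicalClosure
  have hcl : IsClosed (P : Set (Toeplitz S)) := Submodule.isClosed_topologicalClosure _
  have hlip : LipschitzWith 1 (component (S := S) 0) := LipschitzWith.of_dist_le_mul fun x y => by
    rw [dist_eq_norm, dist_eq_norm, NNReal.coe_one, one_mul]
    exact norm_component_sub_le 0 x y
  refine monomial_induction (p := fun x => component 0 x ∈ P)
    (hcl.preimage hlip.continuous) (fun l a l' => ?_) (fun x y hx hy => ?_) (fun c x hx => ?_) x
  · have h1 : component 0 (monomial l a l') =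
        (∫ t : AddCircle (1 : ℝ), fourier ((l.length : ℤ) - l'.length) t ∂haarAddCircle) •
          monomial l a l' := by
      rw [component, fourierCoeff, ← integral_smul_const]
      congr 1
      ext1 t
      rw [orbit, gauge_monomial, neg_zero, fourier_zero, one_smul, fourier_apply, toCircle_zsmul]
    rw [h1]
    by_cases h : (l.length : ℤ) - l'.length = 0
    · refine P.smul_mem _ (subset_closure ?_)
      exact Submodule.mem_iSup_of_mem l.length (monomial_mem_coreAlg l a l' (by omega))
    · rw [integral_eq_zero_of_add_right_eq_neg (μ := haarAddCircle)
        (fourier_add_half_inv_index h zero_lt_one), zero_smul]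
      exact P.zero_mem
  · have h : component 0 (x + y) = component 0 x + component 0 y := by
      rw [component, component, component, fourierCoeff, fourierCoeff, fourierCoeff,
        ← integral_add (integrable_orbit _ x) (integrable_orbit _ y)]
      congr 1
      ext1 t
      rw [orbit, map_add, smul_add]; rfl
    rw [h]
    exact P.add_mem hx hy
  · have h : component 0 (c • x) = c • component 0 x := by
      rw [component, component, fourierCoeff, fourierCoeff, ← integral_smul]
      congr 1
      ext1 t
      rw [orbit, gauge_smul, smul_comm]; rfl
    rw [h]
    exact P.smul_mem c hx

/-- Gauge-invariant elements lie in the core. -/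
lemma mem_gaugeCore {x : Toeplitz S} (hx : ∀ t : AddCircle (1 : ℝ), gauge S (toCircle t) x = x) :
    x ∈ gaugeCore S := by
  have h : component 0 x = x := by
    rw [component, fourierCoeff]
    have h1 : (fun t : AddCircle (1 : ℝ) => fourier (-0) t • orbit x t) = fun _ => x := by
      ext1 t
      rw [orbit, hx, neg_zero, fourier_zero, one_smul]
    rw [h1]
    simp
  rw [← h]
  exact component_zero_mem_gaugeCore x

lemma star_component_mul_component_mem_gaugeCore (n : ℤ) (x : Toeplitz S) :
    star (component n x) * component n x ∈ gaugeCore S := by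
  refine mem_gaugeCore fun t => ?_
  rw [map_mul, gauge_star, gauge_component, star_smul, smul_mul_smul_comm]
  have h : star (fourier n t) * fourier n t = (1 : ℂ) := by
    rw [fourier_apply, Complex.star_def, ← Complex.normSq_eq_conj_mul_self, Circle.normSq_coe,
      Complex.ofReal_one]
  rw [h, one_smul]

/-- An element whose spectral components lie in a closed ideal lies in that ideal. -/
lemma mem_of_component_mem {J : TwoSidedIdeal (Toeplitz S)} (hJ : IsClosed (J : Set (Toeplitz S)))
    {x : Toeplitz S} (hx : ∀ n, component n x ∈ J) : x ∈ J := by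
  by_contra hxJ
  let P : Submodule ℂ (Toeplitz S) := J.asIdeal.restrictScalars ℂ
  have hPm : ∀ y, y ∈ P ↔ y ∈ J := fun y => TwoSidedIdeal.mem_asIdeal
  have hP : IsClosed (P : Set (Toeplitz S)) := by
    have h : (P : Set (Toeplitz S)) = J := Set.ext hPm
    rwa [h]
  -- A functional that vanishes on `J` but not at `x` turns the orbit into a continuous scalar
  -- function `F` with Fourier coefficients `φ (component n x) = 0`. Its Fourier series is trivially
  -- summable and so converges to it pointwise, whence `φ x = F 0 = 0`.
  obtain ⟨ψ, hψ⟩ := SeparatingDual.exists_ne_zero (R := ℂ) (x := P.mkQ x) (by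
    rw [Ne, Submodule.mkQ_apply, Submodule.Quotient.mk_eq_zero]
    exact fun h => hxJ ((hPm x).mp h))
  let φ : Toeplitz S →L[ℂ] ℂ := ψ.comp P.mkQL
  have hφ : ∀ y ∈ J, φ y = 0 := fun y hy => by
    change ψ (P.mkQ y) = 0
    rw [Submodule.mkQ_apply, (Submodule.Quotient.mk_eq_zero P).mpr ((hPm y).mpr hy), map_zero]
  let F : C(AddCircle (1 : ℝ), ℂ) := ⟨fun t => φ (orbit x t), φ.continuous.comp (continuous_orbit x)⟩
  have hF : fourierCoeff F = 0 := by
    ext1 n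
    have h1 : fourierCoeff F n = φ (component n x) := by
      rw [component, fourierCoeff, fourierCoeff,
        ← φ.integral_comp_comm (integrable_orbit _ x)]
      congr 1
      ext1 t
      rw [map_smul]; rfl
    rw [h1, hφ _ (hx n)]
    rfl
  have hsum := has_pointwise_sum_fourier_series_of_summable (f := F)
    (by rw [hF]; exact summable_zero) 0
  rw [hF] at hsum
  simp only [Pi.zero_apply, zero_smul] at hsum
  have h0 : F 0 = 0 := hsum.unique hasSum_zero
  refine hψ ?_
  have h1 : F 0 = φ (gauge S (toCircle 0) x) := rfl
  rw [toCircle_zero, gauge_one] at h1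
  exact h1.symm.trans h0

end Toeplitz

/-! ### Comparison of ideals through their functions; invariance of the open set. -/

open Toeplitz OrbitSpace

/-- Gauge-invariant ideals of the Toeplitz algebra that contain the redundancies are determined by
their intersection with `C(X)`. -/
theorem le_of_fn_mem_imp {V : Opens X} (hV : IsInvariant S (V : Set X))
    {I J : TwoSidedIdeal (Toeplitz S)} (hIcl : IsClosed (I : Set (Toeplitz S)))
    (hJcl : IsClosed (J : Set (Toeplitz S))) (hIR : ∀ x ∈ redundancyIdeal S, x ∈ I)
    (hJR : ∀ x ∈ redundancyIdeal S, x ∈ J) (hg : ∀ z : Circle, ∀ x ∈ I, gauge S z x ∈ I)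
    (hI : ∀ a, fn S a ∈ I → a ∈ C₀ V) (hJ : ∀ a ∈ C₀ V, fn S a ∈ J) : I ≤ J := by
  intro x hx
  -- For a component `c` of `x`, the element `star c * c` is in the core, where the kernel of the
  -- orbit representation contains what comes from `I` and is contained in `J`.
  refine mem_of_component_mem hJcl fun n => mem_of_star_mul_self_mem hJcl ?_
  have h1 := component_mem hIcl hg n hx
  have h2 := star_component_mul_component_mem_gaugeCore n x
  exact mem_of_mem_gaugeCore_of_orbitHom_eq_zero hV hJ hJcl hJR h2
    (orbitHom_eq_zero_of_mem_gaugeCore hV hIR hI h2 (I.mul_mem_left _ _ h1))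
lemma C₀_injective {V V' : Opens X} (h : C₀ V = C₀ V') : V = V' := by
  have key : ∀ V V' : Opens X, C₀ V = C₀ V' → V ≤ V' := fun V V' h x hx => by
    obtain ⟨a, ha, ha1, -⟩ := exists_bump V.isOpen hx
    have h1 : a ∈ C₀ V := fun y hy => by
      by_contra h0
      exact hy (ha (subset_tsupport _ h0))
    by_contra hx'
    have h2 := (h ▸ h1 : a ∈ C₀ V') x hx'
    rw [ha1] at h2
    exact one_ne_zero h2
  exact le_antisymm (key _ _ h) (key _ _ h.symm)

section Invariance

open Toeplitz

variable {V : Opens X} {I : TwoSidedIdeal (Toeplitz S)} (hR : ∀ x ∈ redundancyIdeal S, x ∈ I)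
  (hI : ∀ a, fn S a ∈ I ↔ a ∈ C₀ V)
include hR hI

/-- The open set that belongs to an ideal is invariant. -/
theorem isInvariant_of_fn_mem_iff : IsInvariant S (V : Set X) where
  apply_mem y hy := by
    obtain ⟨W, hWo, hyW, hW⟩ := exists_isBisection y
    obtain ⟨a, ha, ha1, -⟩ := exists_bump (hWo.inter V.isOpen) ⟨hyW, hy⟩
    have haV : a ∈ C₀ V := fun z hz => by
      by_contra h0
      exact hz (ha (subset_tsupport _ h0)).2
    let f : PreMod S := of a (ha.trans (inter_subset_left.trans hW.subset))
    -- Compression pushes `a` forward along σ: the resulting function has value 1 at σ(y).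
    have h1 : star (pvec f) * (fn S a * pvec f) ∈ I :=
      I.mul_mem_left _ _ (I.mul_mem_right _ _ ((hI a).mpr haV))
    rw [fn_mul_pvec, star_pvec_mul_pvec] at h1
    by_contra h2
    have h3 := (hI _).mp h1 _ h2
    rw [inner_apply_of_isBisection hW (fun z hz => (ha (subset_tsupport _ hz)).1) _ y hyW,
      lsmul_apply] at h3
    simp [f, ha1] at h3
  mem_of_apply_mem y hy := by
    obtain ⟨W, hWo, hyW, hW⟩ := exists_isBisection y
    obtain ⟨a, ha, ha1, -⟩ := exists_bump hWo hyW
    obtain ⟨b, hb, hb1, -⟩ := exists_bump V.isOpen hy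
    have hbV : b ∈ C₀ V := fun z hz => by
      by_contra h0
      exact hz (hb (subset_tsupport _ h0))
    let f : PreMod S := of a (ha.trans hW.subset)
    have hf : ∀ z, f z ≠ 0 → z ∈ W := fun z hz => ha (subset_tsupport _ hz)
    -- Conjugation the other way pulls `b` back along σ: modulo redundancies the result is the
    -- function |f|² (b ∘ σ), with value 1 at `y`.
    have h1 : pvec f * fn S b * star (pvec f) ∈ I :=
      I.mul_mem_right _ _ (I.mul_mem_left _ _ ((hI b).mpr hbV))
    rw [pvec_mul_fn] at h1
    have h2 := fn_sub_vec_mul_star_vec_mem hW (f := f <• b) (g := f) (fun z hz => by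
      by_cases hzU : z ∈ S.U
      · refine hf z fun h0 => hz ?_
        rw [rsmul_apply _ _ ⟨z, hzU⟩, h0, zero_mul]
      · exact (hz (apply_notMem _ hzU)).elim) hf
    have h3 := I.add_mem (hR _ h2) h1
    change fn S _ - pvec _ * star (pvec _) + _ ∈ I at h3
    rw [sub_add_cancel, hI] at h3
    by_contra h4
    have h5 : (f <• b) y * star (f y) = 0 := h3 y h4
    rw [rsmul_apply] at h5
    simp [f, ha1, hb1] at h5

end Invariance

/-! ### Passage to the quotient O(X, α, L). -/

namespace CrossedProduct

variable (S) in
/-- The quotient map `T(X, α, L) → O(X, α, L)`. -/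
def mk : Toeplitz S →+* CrossedProduct S := Ideal.Quotient.mk (redundancyIdeal S)

lemma mk_surjective : Function.Surjective (mk S) := Ideal.Quotient.mk_surjective

lemma mk_eq_zero {x : Toeplitz S} : mk S x = 0 ↔ x ∈ redundancyIdeal S :=
  Ideal.Quotient.eq_zero_iff_mem

lemma isClosed_iff {Z : Set (CrossedProduct S)} : IsClosed Z ↔ IsClosed (mk S ⁻¹' Z) :=
  isClosed_coinduced

lemma continuous_mk : Continuous (mk S) := continuous_coinduced_rng

lemma gauge_mk (z : Circle) (x : Toeplitz S) : gauge S z (mk S x) = mk S (Toeplitz.gauge S z x) :=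
  Ideal.quotientMap_mk

lemma mk_fn (a : C(X, ℂ)) : mk S (Toeplitz.fn S a) = fn S a := rfl

/-- The preimage in `T(X, α, L)` of an ideal of `O(X, α, L)`. -/
def pullback (I : TwoSidedIdeal (CrossedProduct S)) : TwoSidedIdeal (Toeplitz S) := I.comap (mk S)

lemma mem_pullback {I : TwoSidedIdeal (CrossedProduct S)} {x : Toeplitz S} :
    x ∈ pullback I ↔ mk S x ∈ I := TwoSidedIdeal.mem_comap _

lemma isClosed_pullback {I : TwoSidedIdeal (CrossedProduct S)}
    (hI : IsClosed (I : Set (CrossedProduct S))) : IsClosed (pullback I : Set (Toeplitz S)) := by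
  have h : (pullback I : Set (Toeplitz S)) = mk S ⁻¹' I := Set.ext fun _ => mem_pullback
  rw [h]
  exact hI.preimage continuous_mk

lemma mem_pullback_of_mem_redundancyIdeal (I : TwoSidedIdeal (CrossedProduct S)) {x : Toeplitz S}
    (hx : x ∈ redundancyIdeal S) : x ∈ pullback I := by
  rw [mem_pullback, mk_eq_zero.mpr hx]
  exact I.zero_mem

lemma le_of_pullback_le {I J : TwoSidedIdeal (CrossedProduct S)} (h : pullback I ≤ pullback J) :
    I ≤ J := by
  intro x hx
  obtain ⟨x, rfl⟩ := mk_surjective x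
  exact mem_pullback.mp (h (mem_pullback.mpr hx))

/-- The ideal of `O(X, α, L)` generated by `C₀(V)`. -/
def idealOf (S : PartialLocalHomeo X) (V : Opens X) : TwoSidedIdeal (CrossedProduct S) :=
  closedIdeal (fn S '' C₀ V)

lemma fn_mem_idealOf {V : Opens X} {a : C(X, ℂ)} (ha : a ∈ C₀ V) : fn S a ∈ idealOf S V :=
  subset_closedIdeal _ ⟨a, ha, rfl⟩

lemma isGaugeInvariantIdeal_idealOf (V : Opens X) : IsGaugeInvariantIdeal S (idealOf S V) where
  isClosed := isClosed_closedIdeal _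
  gauge_mem z x hx := by
    have hcl : IsClosed ((idealOf S V).comap (gauge S z) : Set (CrossedProduct S)) := by
      rw [isClosed_iff]
      have h : mk S ⁻¹' ((idealOf S V).comap (gauge S z) : Set (CrossedProduct S)) =
          Toeplitz.gauge S z ⁻¹' (pullback (idealOf S V) : Set (Toeplitz S)) := by
        ext x
        simp only [mem_preimage, SetLike.mem_coe, TwoSidedIdeal.mem_comap, mem_pullback, gauge_mk]
      rw [h]
      exact (isClosed_pullback (isClosed_closedIdeal _)).preimage (Toeplitz.continuous_gauge z)
    refine (TwoSidedIdeal.mem_comap _).mp (mem_closedIdeal.mp hx _ hcl ?_)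
    rintro _ ⟨a, ha, rfl⟩
    refine (TwoSidedIdeal.mem_comap _).mpr ?_
    rw [← mk_fn, gauge_mk, Toeplitz.gauge_fn]
    exact fn_mem_idealOf ha

open OrbitSpace

/-- The orbit representation of `O(X, α, L)` on `ℓ²(X \ V)`. -/
def orbitHom {V : Set X} (hV : IsInvariant S V) :
    CrossedProduct S →+* (OrbitSpace V →L[ℂ] OrbitSpace V) :=
  Ideal.Quotient.lift (redundancyIdeal S) (OrbitSpace.orbitHom hV : Toeplitz S →+* _)
    fun _ hx => orbitHom_eq_zero hV hx

lemma orbitHom_mk {V : Set X} (hV : IsInvariant S V) (x : Toeplitz S) :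
    orbitHom hV (mk S x) = OrbitSpace.orbitHom hV x := Ideal.Quotient.lift_mk _ _ _

lemma apply_eq_zero_of_orbitHom_fn_eq_zero {V : Set X} (hV : IsInvariant S V) {a : C(X, ℂ)}
    (h : orbitHom hV (fn S a) = 0) {x : X} (hx : x ∉ V) : a x = 0 := by
  rw [← mk_fn, orbitHom_mk] at h
  have h1 := diag_fn hV a ⟨x, hx⟩
  rw [diag, h] at h1
  exact h1.symm

/-- The empty set is invariant, and the diagonal of the representation on ℓ²(X) recovers every value
of a function. -/
lemma fn_injective : Function.Injective (fn S) := by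
  intro a b hab
  rw [← sub_eq_zero]
  ext x
  refine apply_eq_zero_of_orbitHom_fn_eq_zero (isInvariant_empty S) (x := x) ?_ (fun h => h)
  rw [← mk_fn, Toeplitz.fn_sub, map_sub, mk_fn, mk_fn, hab, sub_self, map_zero]

/-- The kernel of the orbit representation on ℓ²(X \ V) is a closed ideal that contains C₀(V), hence
`idealOf S V`, and the functions in it vanish off `V`. -/
lemma interFn_idealOf {V : Opens X} (hV : IsInvariant S (V : Set X)) :
    interFn S (idealOf S V) = C₀ V := by
  refine Subset.antisymm (fun a ha => ?_) fun a ha => fn_mem_idealOf ha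
  have hcl : IsClosed (TwoSidedIdeal.ker (orbitHom hV) : Set (CrossedProduct S)) := by
    rw [isClosed_iff]
    have h : mk S ⁻¹' (TwoSidedIdeal.ker (orbitHom hV) : Set (CrossedProduct S)) =
        OrbitSpace.orbitHom hV ⁻¹' {0} := by
      ext x
      simp only [mem_preimage, SetLike.mem_coe, TwoSidedIdeal.mem_ker, orbitHom_mk,
        mem_singleton_iff]
    rw [h]
    exact isClosed_singleton.preimage (continuous_orbitHom hV)
  have h := mem_closedIdeal.mp (show fn S a ∈ closedIdeal _ from ha) _ hcl ?_
  · exact fun x hx => apply_eq_zero_of_orbitHom_fn_eq_zero hV ((TwoSidedIdeal.mem_ker _).mp h) hx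
  · rintro _ ⟨b, hb, rfl⟩
    refine (TwoSidedIdeal.mem_ker _).mpr ?_
    rw [← mk_fn, orbitHom_mk, orbitHom_fn]
    ext ξ y
    rw [mulOp_apply, hb _ y.2, zero_mul]
    rfl

lemma exists_interFn_eq {I : TwoSidedIdeal (CrossedProduct S)}
    (hI : IsClosed (I : Set (CrossedProduct S))) : ∃ V : Opens X, interFn S I = C₀ V := by
  let A : Ideal C(X, ℂ) :=
    { carrier := interFn S I
      add_mem' := fun {a b} ha hb => by
        change fn S (a + b) ∈ I
        rw [← mk_fn, Toeplitz.fn_add, map_add]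
        exact I.add_mem ha hb
      zero_mem' := by
        change fn S 0 ∈ I
        rw [← mk_fn, Toeplitz.fn_zero, map_zero]
        exact I.zero_mem
      smul_mem' := fun c a ha => by
        change fn S (c * a) ∈ I
        rw [← mk_fn, Toeplitz.fn_mul, map_mul]
        exact I.mul_mem_left _ _ ha }
  have hA : IsClosed (A : Set C(X, ℂ)) :=
    hI.preimage (continuous_mk.comp Toeplitz.continuous_fn)
  refine ⟨ContinuousMap.opensOfIdeal A, ?_⟩
  have h := ContinuousMap.idealOfSet_ofIdeal_isClosed hA
  ext a
  change a ∈ A ↔ _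
  refine (SetLike.ext_iff.mp h a).symm.trans ?_
  rw [ContinuousMap.mem_idealOfSet]
  rfl

variable {I : TwoSidedIdeal (CrossedProduct S)} {V : Opens X}

lemma isInvariant_of_interFn_eq (h : interFn S I = C₀ V) : IsInvariant S (V : Set X) :=
  isInvariant_of_fn_mem_iff (I := pullback I) (fun _ => mem_pullback_of_mem_redundancyIdeal I)
    fun a => by rw [mem_pullback, ← h]; rfl

/-- A gauge-invariant ideal is generated by its intersection with `C(X)`. -/
lemma eq_idealOf (hI : IsGaugeInvariantIdeal S I) (h : interFn S I = C₀ V) :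
    I = idealOf S V := by
  have hfn : ∀ a, fn S a ∈ I ↔ a ∈ C₀ V := fun a => by rw [← h]; rfl
  refine le_antisymm (le_of_pullback_le ?_) fun x hx => ?_
  · refine le_of_fn_mem_imp (isInvariant_of_interFn_eq h) (isClosed_pullback hI.isClosed)
      (isClosed_pullback (isClosed_closedIdeal _))
      (fun _ => mem_pullback_of_mem_redundancyIdeal I)
      (fun _ => mem_pullback_of_mem_redundancyIdeal _) (fun z x hx => ?_)
      (fun a ha => (hfn a).mp (mem_pullback.mp ha)) fun a ha => ?_
    · rw [mem_pullback, ← gauge_mk]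
      exact hI.gauge_mem z _ (mem_pullback.mp hx)
    · exact mem_pullback.mpr (fn_mem_idealOf ha)
  · refine mem_closedIdeal.mp hx I hI.isClosed ?_
    rintro _ ⟨a, ha, rfl⟩
    exact (hfn a).mpr ha

end CrossedProduct

end PartialCrossedProduct

end

/-! ### The bijection. -/

open PartialCrossedProduct

theorem theorem3p9 {X : Type u} [TopologicalSpace X] [CompactSpace X] [T2Space X]
    (S : PartialCrossedProduct.PartialLocalHomeo X) :
    Function.Injective (PartialCrossedProduct.CrossedProduct.fn S) ∧
    ∃ Φ : {I : TwoSidedIdeal (PartialCrossedProduct.CrossedProduct S) //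
          PartialCrossedProduct.IsGaugeInvariantIdeal S I} →
        {V : TopologicalSpace.Opens X // PartialCrossedProduct.IsInvariant S (V : Set X)},
      Function.Bijective Φ ∧
      (∀ I, ∀ V : TopologicalSpace.Opens X,
        PartialCrossedProduct.interFn S I.1 = PartialCrossedProduct.C₀ V ↔ V = (Φ I).1) ∧
      ∀ I, I.1 = PartialCrossedProduct.closedIdeal
        (PartialCrossedProduct.CrossedProduct.fn S '' PartialCrossedProduct.C₀ (Φ I).1) := by
  refine ⟨CrossedProduct.fn_injective, ?_⟩
  -- The choice is forced, since `C₀_injective` makes the open set unique; the equivalence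
  -- characterizing `Φ I` rests on this.
  choose V hV using fun I : {I : TwoSidedIdeal (CrossedProduct S) // IsGaugeInvariantIdeal S I} =>
    CrossedProduct.exists_interFn_eq I.2.isClosed
  refine ⟨fun I => ⟨V I, CrossedProduct.isInvariant_of_interFn_eq (hV I)⟩, ⟨fun I I' h => ?_,
    fun W => ?_⟩, fun I W => ⟨fun h => ?_, ?_⟩, fun I => CrossedProduct.eq_idealOf I.2 (hV I)⟩
  · have h1 : V I = V I' := congrArg Subtype.val h
    refine Subtype.ext ?_
    rw [CrossedProduct.eq_idealOf I.2 (hV I), CrossedProduct.eq_idealOf I'.2 (hV I'), h1]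
  · refine ⟨⟨CrossedProduct.idealOf S W, CrossedProduct.isGaugeInvariantIdeal_idealOf _⟩,
      Subtype.ext (C₀_injective ?_)⟩
    rw [← hV, CrossedProduct.interFn_idealOf W.2]
  · exact C₀_injective (h.symm.trans (hV I))
  · rintro rfl
    exact hV I
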